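/- **Setting.** Let $Y$, $Y^\diamond$ be real Banach spaces forming a norming dual pair: there is a bounded bilinear pairing $\langle\cdot,\cdot\rangle:Y^\diamond\times Y\to\mathbb R$ with $\|y\|=\sup\{|\langle y^\diamond,y\rangle|:\|y^\diamond\|\le1\}$ and $\|y^\diamond\|=\sup\{|\langle y^\diamond,y\rangle|:\|y\|\le1\}$. A *twin operator* is a bounded bilinear map $L:Y^\diamond\times Y\to\mathbb R$, $(y^\diamond,y)\mapsto y^\diamond Ly$, that is $\sigma(Y^\diamond,Y)$-continuous in $y^\diamond$ and $\sigma(Y,Y^\diamond)$-continuous in $y$; it is then represented by maps $y\mapsto Ly$ of $Y$ and $y^\diamond\mapsto y^\diamond L$ of $Y^\diamond$ with $y^\diamond Ly=\langle y^\diamond,Ly\rangle=\langle y^\diamond L,y\rangle$, and $y^\diamond L_1L_2y:=\langle y^\diamond L_1,L_2y\rangle$. A *twin semigroup* is a family $\{S(t)\}_{t\ge0}$ of twin operators with $S(0)=I$, $S(t+s)=S(t)S(s)$, with $t\mapsto y^\diamond S(t)y$ Borel measurable for all $y,y^\diamond$, and with constants $M\ge1$, $\omega\in\mathbb R$ such that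 $|y^\diamond S(t)y|\le Me^{\omega t}\|y\|\|y^\diamond\|$ and such that for $\mathrm{Re}\,\lambda>\omega$ there is a twin operator $\overline S(\lambda)$ (on the complexified pair) with $y^\diamond\overline S(\lambda)y=\int_0^\infty e^{-\lambda t}y^\diamond S(t)y\,dt$. Its *generator* is the (possibly multi-valued) operator $C=\lambda I-\overline S(\lambda)^{-1}$ on $Y$, i.e. $x\in Cy$ iff $y=\overline S(\lambda)(\lambda y-x)$, where $\lambda>\omega$ is real; it does not depend on $\lambda$. $NBV_{loc}$ is the space of functions on $[0,\infty)$ that vanish at $0$, are right continuous on $(0,\infty)$ and have bounded variation on every $[0,T]$ (componentwise for vectors and matrices). For $f\in NBV_{loc}$ let $\mu_f$ be the local measure with $\mu_f([0,t])=f(t)$ for $t>0$ (so $\mu_f(\{0\})=f(0+)$), and write $\int_0^t g(\tau)f(d\tau)=\int_{[0,t]}g\,d\mu_f$ for $t>0$, and $0$ for $t=0$. For $f,g\in NBV_{loc}$ let $(f\star g)(t)=\int_0^tf(d\tau)\,g(t-\tau)$, where for $\tau=t$ the factor $g(0)$ is read as $g(0+)$ (no change if $g$ is continuous at $0$); i.e.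 $(f\star g)(t)=(\mu_f*\mu_g)([0,t])$ for $t>0$. **Theorem.** Assume that * $(Y^\diamond,\sigma(Y^\diamond,Y))$ is sequentially complete, and every sequentially continuous linear map $(Y^\diamond,\sigma(Y^\diamond,Y))\to\mathbb R$ is continuous; * $\{S_0(t)\}$ is a twin semigroup on $(Y,Y^\diamond)$ with generator $C_0$; * $q_1,\dots,q_n\in Y$ and $Q_1^\diamond,\dots,Q_n^\diamond\in Y^\diamond$ are such that every $K_{ij}(t)=Q_i^\diamond(S_0(t)-I)q_j$ belongs to $NBV_{loc}$ and is continuous at $t=0$; * for every $y\in Y$ the function $t\mapsto V_0(t)y:=\big(Q_i^\diamond(S_0(t)-I)y\big)_{i=1}^n\in\mathbb R^n$ belongs to $NBV_{loc}$. Then $K$ has a unique resolvent, i.e. there is exactly one matrix-valued $R\in NBV_{loc}$ with $K+R\star K=R=K+K\star R$. For every $y\in Y$ the function $V(\cdot)y:=V_0(\cdot)y+R\star V_0(\cdot)y$ belongs to $NBV_{loc}$, and $$y^\diamond S(t)y=y^\diamond S_0(t)y+\sum_{j=1}^n\int_0^t y^\diamond S_0(t-\tau)q_j\;V_j(d\tau)y\qquad(t\ge0)$$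 defines a twin semigroup $\{S(t)\}_{t\ge0}$ on $(Y,Y^\diamond)$, whose generator $C$ is given by $$D(C)=D(C_0),\qquad Cy=C_0y+\sum_{j=1}^n\langle Q_j^\diamond,C_0y\rangle q_j,$$ which for multi-valued $C_0$ means $Cy=\{w+\sum_j\langle Q_j^\diamond,w\rangle q_j: w\in C_0y\}$. -/

import Mathlib

open Set Filter Topology MeasureTheory
open scoped NNReal

/-! ### Norming dual pairs

Throughout, `Z` plays the role of the second space `Y^⋄` of the pair, and
`B z y` is the pairing `⟨z, y⟩` of `z ∈ Y^⋄` and `y ∈ Y`. The weak topology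
`σ(Y^⋄, Y)` is the topology of `WeakBilin B`, and `σ(Y, Y^⋄)` that of `WeakBilin B.flip`. -/

/-- `(Y, Z)` with the pairing `B` is a norming dual pair: the pairing is bounded, and each of the
two norms is recovered as a supremum of pairings over the unit ball of the other space. -/
structure IsNormingDualPair {Y Z : Type*} [NormedAddCommGroup Y] [NormedSpace ℝ Y]
    [NormedAddCommGroup Z] [NormedSpace ℝ Z] (B : Z →ₗ[ℝ] Y →ₗ[ℝ] ℝ) : Prop where
  bounded : ∃ M : ℝ, 1 ≤ M ∧ ∀ z y, |B z y| ≤ M * ‖z‖ * ‖y‖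
  norm_eq : ∀ y : Y, IsLUB {r : ℝ | ∃ z : Z, ‖z‖ ≤ 1 ∧ r = |B z y|} ‖y‖
  norm_eq' : ∀ z : Z, IsLUB {r : ℝ | ∃ y : Y, ‖y‖ ≤ 1 ∧ r = |B z y|} ‖z‖

/-- `(Z, σ(Z, Y))` is sequentially complete. (A sequence is Cauchy, resp. convergent, for
`σ(Z, Y)` iff all its pairings with elements of `Y` are Cauchy, resp. converge accordingly.) -/
def WeakSeqComplete {Y Z : Type*} [AddCommGroup Y] [Module ℝ Y] [AddCommGroup Z] [Module ℝ Z]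
    (B : Z →ₗ[ℝ] Y →ₗ[ℝ] ℝ) : Prop :=
  ∀ u : ℕ → Z, (∀ y, CauchySeq fun m => B (u m) y) →
    ∃ z : Z, ∀ y, Tendsto (fun m => B (u m) y) atTop (𝓝 (B z y))

/-- Every sequentially continuous linear map `(Z, σ(Z, Y)) → ℝ` is continuous. -/
def WeakSeqContinuousImpContinuous {Y Z : Type*} [AddCommGroup Y] [Module ℝ Y]
    [AddCommGroup Z] [Module ℝ Z] (B : Z →ₗ[ℝ] Y →ₗ[ℝ] ℝ) : Prop :=
  ∀ φ : WeakBilin B →ₗ[ℝ] ℝ, SeqContinuous φ → Continuous φ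

/-! ### Twin operators and twin semigroups -/

/-- A twin operator: a bounded bilinear map `Z × Y → ℝ`, written `(z, y) ↦ z L y`, that is
`σ(Z, Y)`-continuous in `z` and `σ(Y, Z)`-continuous in `y`. -/
structure TwinOperator {Y Z : Type*} [NormedAddCommGroup Y] [NormedSpace ℝ Y]
    [NormedAddCommGroup Z] [NormedSpace ℝ Z] (B : Z →ₗ[ℝ] Y →ₗ[ℝ] ℝ) where
  form : Z →ₗ[ℝ] Y →ₗ[ℝ] ℝ
  bounded : ∃ c : ℝ, 0 < c ∧ ∀ z y, |form z y| ≤ c * ‖z‖ * ‖y‖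
  continuous_left : ∀ y, Continuous fun z : WeakBilin B => form z y
  continuous_right : ∀ z, Continuous fun y : WeakBilin B.flip => form z y

namespace TwinOperator

variable {Y Z : Type*} [NormedAddCommGroup Y] [NormedSpace ℝ Y]
  [NormedAddCommGroup Z] [NormedSpace ℝ Z] {B : Z →ₗ[ℝ] Y →ₗ[ℝ] ℝ}

/-- The weakly continuous functional `z ↦ z L y` is represented by an element `L y` of `Y`. -/
theorem exists_right (L : TwinOperator B) (y : Y) : ∃ x : Y, ∀ z, B z x = L.form z y := by
  obtain ⟨x, hx⟩ := LinearMap.dualEmbedding_surjective B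
    (⟨L.form.flip y, L.continuous_left y⟩ : StrongDual ℝ (WeakBilin B))
  exact ⟨x, fun z => DFunLike.congr_fun hx z⟩

/-- The weakly continuous functional `y ↦ z L y` is represented by an element `z L` of `Z`. -/
theorem exists_left (L : TwinOperator B) (z : Z) : ∃ x : Z, ∀ y, B x y = L.form z y := by
  obtain ⟨x, hx⟩ := LinearMap.dualEmbedding_surjective B.flip
    (⟨L.form z, L.continuous_right z⟩ : StrongDual ℝ (WeakBilin B.flip))
  exact ⟨x, fun y => DFunLike.congr_fun hx y⟩

/-- The element `L y` of `Y`, i.e. `L` as a map from `Y` to `Y`. (In a norming dual pair the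
representing element is unique.) -/
noncomputable def onRight (L : TwinOperator B) (y : Y) : Y := (L.exists_right y).choose

/-- The element `z L` of `Z`, i.e. `L` as a map from `Z` to `Z`. -/
noncomputable def onLeft (L : TwinOperator B) (z : Z) : Z := (L.exists_left z).choose

theorem pairing_onRight (L : TwinOperator B) (z : Z) (y : Y) : B z (L.onRight y) = L.form z y :=
  (L.exists_right y).choose_spec z

theorem pairing_onLeft (L : TwinOperator B) (z : Z) (y : Y) : B (L.onLeft z) y = L.form z y :=
  (L.exists_left z).choose_spec y

end TwinOperator

section Semigroups

variable {Y Z : Type*} [NormedAddCommGroup Y] [NormedSpace ℝ Y]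
  [NormedAddCommGroup Z] [NormedSpace ℝ Z] {B : Z →ₗ[ℝ] Y →ₗ[ℝ] ℝ}

/-- The exponential estimate `|z S(t) y| ≤ M e^{ω t} ‖y‖ ‖z‖` with `M ≥ 1`. -/
def HasGrowthBound (S : ℝ≥0 → TwinOperator B) (M ω : ℝ) : Prop :=
  1 ≤ M ∧ ∀ t z y, |(S t).form z y| ≤ M * Real.exp (ω * t) * ‖y‖ * ‖z‖

/-- The Laplace transform of `t ↦ z S(t) y` at `lam` is `z P y + i z P' y` for all `z` and `y`,
where `P` and `P'` are twin operators: the (complex) Laplace transform at `lam` is a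
twin operator on the complexified pair, with real part `P` and imaginary part `P'`. -/
def HasLaplaceTransformAt (S : ℝ≥0 → TwinOperator B) (lam : ℂ) (P P' : TwinOperator B) : Prop :=
  ∀ z y, ((P.form z y : ℂ) + (P'.form z y : ℂ) * Complex.I) =
    ∫ t in Ioi (0 : ℝ), Complex.exp (-lam * t) * (((S t.toNNReal).form z y : ℝ) : ℂ)

/-- A twin semigroup. The product of twin operators is `z (L₁ L₂) y = ⟨z L₁, L₂ y⟩`. -/
structure IsTwinSemigroup (S : ℝ≥0 → TwinOperator B) : Prop where
  map_zero : ∀ z y, (S 0).form z y = B z y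
  map_add : ∀ t s z y, (S (t + s)).form z y = B ((S t).onLeft z) ((S s).onRight y)
  measurable : ∀ z y, Measurable fun t => (S t).form z y
  laplace : ∃ M ω : ℝ, HasGrowthBound S M ω ∧
    ∀ lam : ℂ, ω < lam.re → ∃ P P' : TwinOperator B, HasLaplaceTransformAt S lam P P'

/-- The (graph of the possibly multi-valued) generator `C = λ I - P(λ)⁻¹` of a twin semigroup,
where `P(λ)` is the Laplace transform of the semigroup at a real `λ > ω` and `P(λ)⁻¹` is the inverse
relation: `x ∈ C y` iff `y = P(λ) (λ y - x)`. -/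
def twinGenerator (S : ℝ≥0 → TwinOperator B) : Set (Y × Y) :=
  {p | ∃ M ω lam : ℝ, HasGrowthBound S M ω ∧ ω < lam ∧ ∃ P : TwinOperator B,
    (∀ z y, P.form z y = ∫ t in Ioi (0 : ℝ), Real.exp (-lam * t) * (S t.toNNReal).form z y) ∧
    p.1 = P.onRight (lam • p.1 - p.2)}

end Semigroups

/-! ### Functions of normalized bounded variation and Stieltjes integrals -/

/-- `NBV_loc([0,∞); ℝ)`: zero at `0`, right continuous on `(0,∞)` (a jump at `0` is allowed), and
of bounded variation on compact intervals. -/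
structure IsNBVLoc (f : ℝ≥0 → ℝ) : Prop where
  map_zero : f 0 = 0
  rightCts : ∀ t, 0 < t → ContinuousWithinAt f (Ici t) t
  locBV : LocallyBoundedVariationOn f univ

open Classical in
/-- The signed measure on `[0,T]` (extended by zero) given by the function `f` stopped at time `T`.
For `f` in `NBV_loc` and `0 < s ≤ T` it gives mass `f s` to `[0,s]`; so the mass at `0` is `f(0+)`
for `T > 0`. For `T = 0` the measure is zero. -/
noncomputable def stieltjesMeasure (f : ℝ≥0 → ℝ) (T : ℝ≥0) : SignedMeasure ℝ≥0 :=
  if h : BoundedVariationOn (fun s => f (min s T)) univ then h.vectorMeasure else 0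

/-- The Stieltjes integral `∫_{[0,T]} g(τ) f(dτ)`, through the Jordan decomposition of the signed
measure of `f` on `[0,T]`. -/
noncomputable def stieltjesIntegral (f : ℝ≥0 → ℝ) (T : ℝ≥0) (g : ℝ≥0 → ℝ) : ℝ :=
  (∫ τ in Iic T, g τ ∂(stieltjesMeasure f T).toJordanDecomposition.posPart) -
    ∫ τ in Iic T, g τ ∂(stieltjesMeasure f T).toJordanDecomposition.negPart

/-- The convolution `(f ⋆ g)(t) = ∫_{[0,t]} f(dτ) g(t-τ)` of `NBV_loc` functions, identified with
local measures. `Function.rightLim g` equals `g` on `(0,∞)`, and at `0` it is the mass `g(0+)`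
that the measure of `g` has at `0` (it is `g 0 = 0` when `g` is continuous at `0`), so that for
`t > 0` the value is the mass of `[0,t]` under the convolution of the two measures. -/
noncomputable def stieltjesConv (f g : ℝ≥0 → ℝ) (t : ℝ≥0) : ℝ :=
  stieltjesIntegral f t fun τ => Function.rightLim g (t - τ)

/-- `R` is a resolvent of the matrix-valued function `K`: it is `NBV_loc` and
`K + R ⋆ K = R = K + K ⋆ R`. -/
structure IsResolvent {n : ℕ} (K R : Fin n → Fin n → ℝ≥0 → ℝ) : Prop where
  nbv : ∀ i j, IsNBVLoc (R i j)
  eq_left : ∀ i j t, R i j t = K i j t + ∑ k, stieltjesConv (R i k) (K k j) t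
  eq_right : ∀ i j t, R i j t = K i j t + ∑ k, stieltjesConv (K i k) (R k j) t

/-! ### The data of the perturbation -/

section Perturbation

variable {Y Z : Type*} [NormedAddCommGroup Y] [NormedSpace ℝ Y]
  [NormedAddCommGroup Z] [NormedSpace ℝ Z] {B : Z →ₗ[ℝ] Y →ₗ[ℝ] ℝ} {n : ℕ}

/-- The `i`-th component of `V₀(t) y = Q^⋄ (S₀(t) - I) y`, as a function of `t`. -/
def pertV₀ (S₀ : ℝ≥0 → TwinOperator B) (Q : Fin n → Z) (y : Y) (i : Fin n) (t : ℝ≥0) : ℝ :=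
  (S₀ t).form (Q i) y - B (Q i) y

/-- The kernel `K_ij(t) = Q_i^⋄ (S₀(t) - I) q_j`. -/
def pertK (S₀ : ℝ≥0 → TwinOperator B) (Q : Fin n → Z) (q : Fin n → Y) (i j : Fin n) (t : ℝ≥0) :
    ℝ :=
  (S₀ t).form (Q i) (q j) - B (Q i) (q j)

/-- The `i`-th component of `V(t) y = V₀(t) y + ∫_{[0,t]} R(dτ) V₀(t-τ) y`. -/
noncomputable def pertV (S₀ : ℝ≥0 → TwinOperator B) (Q : Fin n → Z)
    (R : Fin n → Fin n → ℝ≥0 → ℝ) (y : Y) (i : Fin n) (t : ℝ≥0) : ℝ :=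
  pertV₀ S₀ Q y i t + ∑ j, stieltjesConv (R i j) (pertV₀ S₀ Q y j) t

/-- The graph of `C y = C₀ y + ⟨Q^⋄, C₀ y⟩ · q` on `D(C) = D(C₀)`, for a possibly
multi-valued `C₀`. -/
def relBoundedPerturbation (B : Z →ₗ[ℝ] Y →ₗ[ℝ] ℝ) (C₀ : Set (Y × Y)) (Q : Fin n → Z)
    (q : Fin n → Y) : Set (Y × Y) :=
  {p | ∃ w, (p.1, w) ∈ C₀ ∧ p.2 = w + ∑ j, B (Q j) w • q j}

end Perturbation

/-! # Relatively bounded finite-rank perturbations of twin semigroups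

The proof rests on an algebra of local signed measures. A locally finite measure `μ` on `[0,∞)` acts
on the locally bounded Borel functions by convolution, `h ↦ ∫_{[0,t]} h(t-τ) μ(dτ)`, and the
differences of such operators form a commutative ring `cvRing`. Taking distribution functions
identifies `cvRing` with `NBV_loc` (`cvRing.isNBVLoc_fn`, `IsNBVLoc.exists_fn_eq`,
`cvRing.fn_injective`), the product with `⋆` (`stieltjesConv_fn`), and the action on functions with
the Stieltjes integrals of the theorem (`stieltjesIntegral_fn`). So `K` is a matrix over a
commutative ring, and `R` is a resolvent iff `(1 - K)(1 + R) = 1`. Uniqueness, and the equivalence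
of the two resolvent equations, are then matrix algebra. Existence is a Neumann series
(`cvRing.exists_resolvent`): since `K` has no atom at `0`, the total masses of `e^{-ωτ} K(dτ)` are
small for large `ω`, and the series converges as a series of positive measures. This also bounds
the growth of the variation of `R`.

That `S(t)` is a twin operator needs, for fixed `z` and `t`, a representation in `Y^⋄` of
`y ↦ ∫ z S₀(t-τ) q_j V_j(dτ) y`. It holds for the distribution functions `V₀(t)y`, and
passes to all bounded Borel integrands by a monotone class argument and sequential completeness
(`cvRing.exists_cv_eq_pairing`). Continuity in `z` is sequential continuity, by dominated
convergence. Boundedness of `S(t)`, on `[0,1]` uniformly in `t`, follows from the uniform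
boundedness principle; the same principle gives a bound by `c ‖y‖` of the variation of
`V₀(·)y` on `[0,1]`, and `V₀(t+s)y - V₀(s)y = V₀(t)S₀(s)y` then makes the variation grow at most
exponentially (`hasWeight_pertV₀`).

For the semigroup law one compares two solutions of a renewal equation: the increments after
time `s` of `V(·)y` and the function `V(·)S(s)y` both solve `W = V₀(·)S(s)y + K ⋆ W`, so they
agree (`perturbed_shift`), and a convolution over `[0,t+s]` splits at `s`.

Laplace transforms turn `⋆` into products, whence `z S̄(λ) y = z S̄₀(λ) y + ∑ z S̄₀(λ) q_j v_j(y)`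
with `v = (1 + r) v₀`, `(1 - k)(1 + r) = 1` and `v₀(y) = λ Q S̄₀(λ) y - Q y` (`lapl_perturbed`): a
combination of `S̄₀(λ)` and operators of rank one. By the resolvent identity the generators may be
read off at one common real `λ` (`mem_twinGenerator_iff`). The rest is linear algebra
(`resolvent_rel_iff`): if `y = S̄₀(λ) u` with `u = λ y - w`, then `v₀(u) = Q w`. -/

/-! ### Convolution operators of locally finite measures -/

/-- The space of Borel functions on `[0,∞)` that are bounded on every `[0,t]`, on which
convolution with locally finite measures acts. -/
def LocBdd : Submodule ℝ (ℝ≥0 → ℝ) where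
  carrier := {h | Measurable h ∧ ∀ t, ∃ C, ∀ s ≤ t, |h s| ≤ C}
  add_mem' := by
    rintro f g ⟨hf, hf'⟩ ⟨hg, hg'⟩
    refine ⟨hf.add hg, fun t => ?_⟩
    obtain ⟨C, hC⟩ := hf' t
    obtain ⟨D, hD⟩ := hg' t
    exact ⟨C + D, fun s hs => (abs_add_le _ _).trans (add_le_add (hC s hs) (hD s hs))⟩
  zero_mem' := ⟨measurable_const, fun t => ⟨0, by simp⟩⟩
  smul_mem' := by
    rintro c f ⟨hf, hf'⟩
    refine ⟨hf.const_smul c, fun t => ?_⟩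
    obtain ⟨C, hC⟩ := hf' t
    refine ⟨|c| * C, fun s hs => ?_⟩
    simp only [Pi.smul_apply, smul_eq_mul, abs_mul]
    exact mul_le_mul_of_nonneg_left (hC s hs) (abs_nonneg c)

namespace LocBdd

theorem measurable (h : LocBdd) : Measurable h.1 := h.2.1

theorem exists_bound (h : LocBdd) (t : ℝ≥0) : ∃ C, 0 ≤ C ∧ ∀ s ≤ t, |h.1 s| ≤ C := by
  obtain ⟨C, hC⟩ := h.2.2 t
  exact ⟨C, (abs_nonneg _).trans (hC 0 zero_le), hC⟩

/-- The constant function `1`. -/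
def one : LocBdd := ⟨fun _ => 1, measurable_const, fun _ => ⟨1, by simp⟩⟩

/-- The integrand `τ ↦ h (t - τ)` of a convolution, cut off outside `[0,t]`. -/
noncomputable def kernel (h : ℝ≥0 → ℝ) (t τ : ℝ≥0) : ℝ := if τ ≤ t then h (t - τ) else 0

theorem measurable_kernel_uncurry {h : ℝ≥0 → ℝ} (hh : Measurable h) :
    Measurable (Function.uncurry (kernel h)) :=
  Measurable.ite (measurableSet_le measurable_snd measurable_fst)
    (hh.comp (measurable_fst.sub measurable_snd)) measurable_const

theorem measurable_kernel {h : ℝ≥0 → ℝ} (hh : Measurable h) (t : ℝ≥0) :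
    Measurable (kernel h t) :=
  (measurable_kernel_uncurry hh).comp measurable_prodMk_left

theorem kernel_eq_indicator (h : ℝ≥0 → ℝ) (t : ℝ≥0) :
    kernel h t = (Iic t).indicator fun τ => h (t - τ) := by
  ext τ
  simp [kernel, indicator]

theorem kernel_add (h : ℝ≥0 → ℝ) (t x y : ℝ≥0) :
    kernel h t (x + y) = if x ≤ t then kernel h (t - x) y else 0 := by
  unfold kernel
  by_cases hx : x ≤ t
  · simp only [if_pos hx, le_tsub_iff_left hx, tsub_tsub]
  · rw [if_neg hx, if_neg fun h' => hx (le_self_add.trans h')]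

end LocBdd

theorem measure_Iic_lt_top (μ : Measure ℝ≥0) [IsLocallyFiniteMeasure μ] (t : ℝ≥0) :
    μ (Iic t) < ⊤ := by
  rw [← Icc_bot]
  exact isCompact_Icc.measure_lt_top

theorem isLocallyFiniteMeasure_of_Iic {μ : Measure ℝ≥0} (h : ∀ t, μ (Iic t) < ⊤) :
    IsLocallyFiniteMeasure μ :=
  ⟨fun t => ⟨Iic (t + 1), Iic_mem_nhds (by simp), h _⟩⟩

theorem integrableOn_Iic_of_bound (μ : Measure ℝ≥0) [IsLocallyFiniteMeasure μ] {g : ℝ≥0 → ℝ}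
    (hg : Measurable g) {t : ℝ≥0} {C : ℝ} (hC : ∀ s ≤ t, |g s| ≤ C) :
    IntegrableOn g (Iic t) μ :=
  Measure.integrableOn_of_bounded (measure_Iic_lt_top μ t).ne hg.aestronglyMeasurable
    (ae_restrict_of_forall_mem measurableSet_Iic fun s hs => hC s hs)

namespace LocBdd

theorem integrableOn_sub (μ : Measure ℝ≥0) [IsLocallyFiniteMeasure μ] (h : LocBdd) (t : ℝ≥0) :
    IntegrableOn (fun τ => h.1 (t - τ)) (Iic t) μ := by
  obtain ⟨C, -, hC⟩ := LocBdd.exists_bound h t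
  exact integrableOn_Iic_of_bound μ
    ((LocBdd.measurable h).comp (measurable_const.sub measurable_id)) fun s _ => hC _ tsub_le_self

theorem integrable_kernel (μ : Measure ℝ≥0) [IsLocallyFiniteMeasure μ] (h : LocBdd) (t : ℝ≥0) :
    Integrable (kernel h.1 t) μ := by
  rw [kernel_eq_indicator, integrable_indicator_iff measurableSet_Iic]
  exact LocBdd.integrableOn_sub μ h t

end LocBdd

theorem integral_kernel (μ : Measure ℝ≥0) (h : ℝ≥0 → ℝ) (t : ℝ≥0) :
    ∫ τ, LocBdd.kernel h t τ ∂μ = ∫ τ in Iic t, h (t - τ) ∂μ := by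
  rw [LocBdd.kernel_eq_indicator, integral_indicator measurableSet_Iic]

theorem abs_setIntegral_Iic_le (μ : Measure ℝ≥0) [IsLocallyFiniteMeasure μ] {g : ℝ≥0 → ℝ}
    {t : ℝ≥0} {C : ℝ} (hC : ∀ s ≤ t, |g s| ≤ C) :
    |∫ τ in Iic t, g τ ∂μ| ≤ C * μ.real (Iic t) :=
  norm_setIntegral_le_of_norm_le_const (f := g) (measure_Iic_lt_top μ t) fun s hs => hC s hs

/-- Convolution `(h * μ)(t) = ∫_{[0,t]} h(t-τ) μ(dτ)` with a locally finite measure. -/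
noncomputable def convOp (μ : Measure ℝ≥0) [IsLocallyFiniteMeasure μ] :
    Module.End ℝ LocBdd where
  toFun h := ⟨fun t => ∫ τ in Iic t, h.1 (t - τ) ∂μ, by
    constructor
    · simp_rw [← integral_kernel]
      exact (LocBdd.measurable_kernel_uncurry
        (LocBdd.measurable h)).stronglyMeasurable.integral_prod_right.measurable
    · intro t
      obtain ⟨C, hC0, hC⟩ := LocBdd.exists_bound h t
      refine ⟨C * μ.real (Iic t), fun s hs => ?_⟩
      refine (abs_setIntegral_Iic_le μ
        (fun τ _ => hC (s - τ) (tsub_le_self.trans hs))).trans ?_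
      exact mul_le_mul_of_nonneg_left
        (measureReal_mono (Iic_subset_Iic.2 hs) (measure_Iic_lt_top μ t).ne) hC0⟩
  map_add' f g := by
    ext t
    exact integral_add (LocBdd.integrableOn_sub μ f t) (LocBdd.integrableOn_sub μ g t)
  map_smul' c f := by
    ext t
    exact integral_const_mul c _

/-- A shortcut, through which `rw` and `noncomm_ring` find the ring structure. -/
noncomputable instance : Ring (Module.End ℝ LocBdd) := Module.End.instRing

theorem convOp_apply (μ : Measure ℝ≥0) [IsLocallyFiniteMeasure μ] (h : LocBdd) (t : ℝ≥0) :
    (convOp μ h).1 t = ∫ τ in Iic t, h.1 (t - τ) ∂μ := rfl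

theorem convOp_one_apply (μ : Measure ℝ≥0) [IsLocallyFiniteMeasure μ] (t : ℝ≥0) :
    (convOp μ LocBdd.one).1 t = μ.real (Iic t) := by
  simp [convOp_apply, LocBdd.one]

/-- Rewriting `μ` directly would leave the instance argument of `convOp` behind. -/
theorem convOp_congr {μ ν : Measure ℝ≥0} [IsLocallyFiniteMeasure μ] [IsLocallyFiniteMeasure ν]
    (h : μ = ν) : convOp μ = convOp ν := by
  subst h
  rfl

instance isLocallyFiniteMeasure_add (μ ν : Measure ℝ≥0) [IsLocallyFiniteMeasure μ]
    [IsLocallyFiniteMeasure ν] : IsLocallyFiniteMeasure (μ + ν) :=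
  isLocallyFiniteMeasure_of_Iic fun t =>
    ENNReal.add_lt_top.2 ⟨measure_Iic_lt_top μ t, measure_Iic_lt_top ν t⟩

theorem convOp_add (μ ν : Measure ℝ≥0) [IsLocallyFiniteMeasure μ] [IsLocallyFiniteMeasure ν] :
    convOp (μ + ν) = convOp μ + convOp ν := by
  ext h t
  simp only [convOp_apply, Measure.restrict_add, LinearMap.add_apply, Submodule.coe_add,
    Pi.add_apply]
  exact integral_add_measure (LocBdd.integrableOn_sub μ h t) (LocBdd.integrableOn_sub ν h t)

theorem convOp_zero : convOp (0 : Measure ℝ≥0) = 0 := by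
  ext h t
  simp [convOp_apply]

theorem convOp_dirac_zero : convOp (Measure.dirac (0 : ℝ≥0)) = 1 := by
  ext h t
  rw [convOp_apply, ← integral_kernel, integral_dirac]
  simp [LocBdd.kernel]

theorem conv_Iic_le (μ ν : Measure ℝ≥0) [SFinite ν] (t : ℝ≥0) :
    (μ ∗ ν) (Iic t) ≤ μ (Iic t) * ν (Iic t) := by
  rw [Measure.conv, Measure.map_apply (by fun_prop) measurableSet_Iic,
    ← Measure.prod_prod]
  refine measure_mono ?_
  rintro ⟨x, y⟩ h
  have h' : x + y ≤ t := h
  exact ⟨le_trans le_self_add h', le_trans le_add_self h'⟩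

instance isLocallyFiniteMeasure_conv (μ ν : Measure ℝ≥0) [IsLocallyFiniteMeasure μ]
    [IsLocallyFiniteMeasure ν] : IsLocallyFiniteMeasure (μ ∗ ν) :=
  isLocallyFiniteMeasure_of_Iic fun t => (conv_Iic_le μ ν t).trans_lt
    (ENNReal.mul_lt_top (measure_Iic_lt_top μ t) (measure_Iic_lt_top ν t))

theorem convOp_conv (μ ν : Measure ℝ≥0) [IsLocallyFiniteMeasure μ] [IsLocallyFiniteMeasure ν] :
    convOp (μ ∗ ν) = convOp μ * convOp ν := by
  ext h t
  rw [convOp_apply, ← integral_kernel, integral_conv (LocBdd.integrable_kernel _ h t)]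
  simp_rw [LocBdd.kernel_add]
  rw [Module.End.mul_apply, convOp_apply, ← integral_indicator measurableSet_Iic]
  congr 1
  ext x
  by_cases hx : x ≤ t
  · simp only [hx, if_true]
    rw [indicator_of_mem (show x ∈ Iic t from hx), convOp_apply, integral_kernel]
  · simp [hx, indicator]

/-! ### The ring of local signed measures -/

/-- The ring of local signed measures on `[0,∞)` under convolution. A local signed measure is a
formal difference of two locally finite measures, encoded by the convolution operator on
`LocBdd` that it defines. -/
def cvRing : Subring (Module.End ℝ LocBdd) where
  carrier := {a | ∃ (μ ν : Measure ℝ≥0) (_ : IsLocallyFiniteMeasure μ)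
    (_ : IsLocallyFiniteMeasure ν), a = convOp μ - convOp ν}
  mul_mem' := by
    rintro _ _ ⟨μ, ν, _, _, rfl⟩ ⟨μ', ν', _, _, rfl⟩
    refine ⟨μ ∗ μ' + ν ∗ ν', μ ∗ ν' + ν ∗ μ', inferInstance, inferInstance, ?_⟩
    simp only [convOp_add, convOp_conv]
    noncomm_ring
  one_mem' := ⟨Measure.dirac 0, 0, inferInstance, inferInstance, by
    rw [convOp_dirac_zero, convOp_zero]
    exact (sub_zero _).symm⟩
  add_mem' := by
    rintro _ _ ⟨μ, ν, _, _, rfl⟩ ⟨μ', ν', _, _, rfl⟩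
    refine ⟨μ + μ', ν + ν', inferInstance, inferInstance, ?_⟩
    simp only [convOp_add]
    abel
  zero_mem' := ⟨0, 0, inferInstance, inferInstance, (sub_self _).symm⟩
  neg_mem' := by
    rintro _ ⟨μ, ν, _, _, rfl⟩
    exact ⟨ν, μ, inferInstance, inferInstance, neg_sub _ _⟩

namespace cvRing

theorem exists_rep (a : cvRing) : ∃ (μ ν : Measure ℝ≥0) (_ : IsLocallyFiniteMeasure μ)
    (_ : IsLocallyFiniteMeasure ν), a.1 = convOp μ - convOp ν := a.2

noncomputable instance : CommRing cvRing :=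
  { (inferInstance : Ring cvRing) with
    mul_comm := by
      rintro ⟨_, μ, ν, _, _, rfl⟩ ⟨_, μ', ν', _, _, rfl⟩
      apply Subtype.ext
      change (convOp μ - convOp ν) * (convOp μ' - convOp ν') =
        (convOp μ' - convOp ν') * (convOp μ - convOp ν)
      simp only [sub_mul, mul_sub, ← convOp_conv]
      rw [convOp_congr (Measure.conv_comm μ μ'), convOp_congr (Measure.conv_comm μ ν'),
        convOp_congr (Measure.conv_comm ν μ'), convOp_congr (Measure.conv_comm ν ν')]
      abel }

/-- The convolution of a local signed measure with a function, with the value at `0` replaced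
by `0` (the convention for Stieltjes integrals over `[0,0]`). -/
noncomputable def cv (a : cvRing) (h : LocBdd) (t : ℝ≥0) : ℝ := if t = 0 then 0 else (a.1 h).1 t

/-- The distribution function of a local signed measure: the mass of `[0,t]` for `t > 0`, and `0`
for `t = 0`. -/
noncomputable def fn (a : cvRing) : ℝ≥0 → ℝ := cv a LocBdd.one

theorem cv_zero (a : cvRing) (h : LocBdd) : cv a h 0 = 0 := if_pos rfl

theorem cv_of_pos (a : cvRing) (h : LocBdd) {t : ℝ≥0} (ht : 0 < t) : cv a h t = (a.1 h).1 t :=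
  if_neg ht.ne'

theorem fn_zero (a : cvRing) : fn a 0 = 0 := cv_zero _ _

theorem fn_of_pos (a : cvRing) {t : ℝ≥0} (ht : 0 < t) : fn a t = (a.1 LocBdd.one).1 t :=
  cv_of_pos _ _ ht

theorem cv_add (a b : cvRing) (h : LocBdd) (t : ℝ≥0) : cv (a + b) h t = cv a h t + cv b h t := by
  unfold cv
  split_ifs
  · simp
  · rfl

theorem cv_sub (a b : cvRing) (h : LocBdd) (t : ℝ≥0) : cv (a - b) h t = cv a h t - cv b h t := by
  unfold cv
  split_ifs
  · simp
  · rfl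

theorem cv_sum {ι : Type*} (s : Finset ι) (a : ι → cvRing) (h : LocBdd) (t : ℝ≥0) :
    cv (∑ i ∈ s, a i) h t = ∑ i ∈ s, cv (a i) h t := by
  classical
  induction s using Finset.induction_on with
  | empty =>
    unfold cv
    split_ifs <;> rfl
  | insert i s hi ih => rw [Finset.sum_insert hi, Finset.sum_insert hi, cv_add, ih]

theorem cv_add_right (a : cvRing) (h k : LocBdd) (t : ℝ≥0) :
    cv a (h + k) t = cv a h t + cv a k t := by
  unfold cv
  split_ifs
  · simp
  · rw [map_add]
    rfl

theorem cv_smul_right (a : cvRing) (c : ℝ) (h : LocBdd) (t : ℝ≥0) :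
    cv a (c • h) t = c * cv a h t := by
  unfold cv
  split_ifs
  · simp
  · rw [map_smul]
    rfl

theorem cv_mul (a b : cvRing) (h : LocBdd) (t : ℝ≥0) : cv (a * b) h t = cv a (b.1 h) t := rfl

theorem fn_add (a b : cvRing) (t : ℝ≥0) : fn (a + b) t = fn a t + fn b t := cv_add _ _ _ _

theorem fn_sub (a b : cvRing) (t : ℝ≥0) : fn (a - b) t = fn a t - fn b t := cv_sub _ _ _ _

theorem fn_sum {ι : Type*} (s : Finset ι) (a : ι → cvRing) (t : ℝ≥0) :
    fn (∑ i ∈ s, a i) t = ∑ i ∈ s, fn (a i) t := cv_sum _ _ _ _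

theorem one_apply_of_rep {a : cvRing} {μ ν : Measure ℝ≥0} [IsLocallyFiniteMeasure μ]
    [IsLocallyFiniteMeasure ν] (h : a.1 = convOp μ - convOp ν) (t : ℝ≥0) :
    (a.1 LocBdd.one).1 t = μ.real (Iic t) - ν.real (Iic t) := by
  rw [h, ← convOp_one_apply, ← convOp_one_apply]
  rfl

end cvRing

theorem tendsto_measureReal_Iic_nhdsGE (μ : Measure ℝ≥0) [IsLocallyFiniteMeasure μ] (t : ℝ≥0) :
    ContinuousWithinAt (fun s => μ.real (Iic s)) (Ici t) t := by
  rw [← continuousWithinAt_Ioi_iff_Ici]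
  have hI : Iic t = ⋂ r > t, Iic r := by
    ext x
    simp only [mem_Iic, mem_iInter]
    exact ⟨fun h r hr => h.trans hr.le, fun h => le_of_forall_gt_imp_ge_of_dense h⟩
  have h := tendsto_measure_biInter_gt (μ := μ) (s := fun r => Iic r) (a := t)
    (fun r _ => measurableSet_Iic.nullMeasurableSet)
    (fun i j _ hij => Iic_subset_Iic.2 hij) ⟨t + 1, by simp, (measure_Iic_lt_top μ _).ne⟩
  rw [← hI] at h
  exact (ENNReal.tendsto_toReal (measure_Iic_lt_top μ t).ne).comp h

theorem measurableSpace_eq_generateFrom_Iic :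
    (NNReal.measurableSpace : MeasurableSpace ℝ≥0) = MeasurableSpace.generateFrom (range Iic) := by
  rw [← borel_eq_generateFrom_Iic]
  exact BorelSpace.measurable_eq

theorem measure_ext_of_Iic_pos {μ ν : Measure ℝ≥0} [IsLocallyFiniteMeasure μ]
    [IsLocallyFiniteMeasure ν] (h : ∀ t, 0 < t → μ.real (Iic t) = ν.real (Iic t)) : μ = ν := by
  have h' : ∀ t, μ.real (Iic t) = ν.real (Iic t) := by
    intro t
    have h1 := (tendsto_measureReal_Iic_nhdsGE μ t).mono (Ioi_subset_Ici_self)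
    have h2 := (tendsto_measureReal_Iic_nhdsGE ν t).mono (Ioi_subset_Ici_self)
    refine tendsto_nhds_unique (h1.congr' ?_) h2
    filter_upwards [self_mem_nhdsWithin] with s hs
    exact h s (pos_of_gt hs)
  refine Measure.ext_of_generateFrom_of_iUnion (range Iic) (fun n : ℕ => Iic (n : ℝ≥0))
    measurableSpace_eq_generateFrom_Iic isPiSystem_Iic ?_ (fun n => mem_range_self _)
    (fun n => (measure_Iic_lt_top μ _).ne) ?_
  · refine eq_univ_of_forall fun t => mem_iUnion.2 ?_
    exact exists_nat_ge t
  · rintro _ ⟨t, rfl⟩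
    have := h' t
    rwa [measureReal_def, measureReal_def,
      ENNReal.toReal_eq_toReal_iff' (measure_Iic_lt_top μ t).ne (measure_Iic_lt_top ν t).ne] at this

namespace cvRing

/-- A local signed measure is determined by its distribution function. -/
theorem fn_injective : Function.Injective fn := by
  rintro ⟨a, μ, ν, _, _, rfl⟩ ⟨b, μ', ν', _, _, rfl⟩ h
  apply Subtype.ext
  have key : μ + ν' = μ' + ν := by
    apply measure_ext_of_Iic_pos
    intro t ht
    have h1 := congrFun h t
    rw [fn_of_pos _ ht, fn_of_pos _ ht, one_apply_of_rep rfl, one_apply_of_rep rfl] at h1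
    rw [measureReal_add_apply (measure_Iic_lt_top μ t).ne (measure_Iic_lt_top ν' t).ne,
      measureReal_add_apply (measure_Iic_lt_top μ' t).ne (measure_Iic_lt_top ν t).ne]
    linarith
  have := convOp_congr key
  rw [convOp_add, convOp_add] at this
  change convOp μ - convOp ν = convOp μ' - convOp ν'
  rw [sub_eq_sub_iff_add_eq_add, this]

theorem continuousWithinAt_one_apply (a : cvRing) (t : ℝ≥0) :
    ContinuousWithinAt (a.1 LocBdd.one).1 (Ici t) t := by
  obtain ⟨μ, ν, _, _, h⟩ := exists_rep a
  have : (a.1 LocBdd.one).1 = fun t => μ.real (Iic t) - ν.real (Iic t) :=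
    funext (one_apply_of_rep h)
  rw [this]
  exact (tendsto_measureReal_Iic_nhdsGE μ t).sub (tendsto_measureReal_Iic_nhdsGE ν t)

theorem rightLim_fn (a : cvRing) (t : ℝ≥0) :
    Function.rightLim (fn a) t = (a.1 LocBdd.one).1 t := by
  have h := ((continuousWithinAt_one_apply a t).mono Ioi_subset_Ici_self)
  refine rightLim_eq_of_tendsto (Tendsto.congr' ?_ h)
  filter_upwards [self_mem_nhdsWithin] with s hs
  exact (fn_of_pos a (pos_of_gt hs)).symm

end cvRing

/-! ### Functions of locally bounded variation and local signed measures -/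

theorem eVariationOn_sub_le (p q : ℝ≥0 → ℝ) (s : Set ℝ≥0) :
    eVariationOn (fun t => p t - q t) s ≤ eVariationOn p s + eVariationOn q s := by
  refine iSup_le fun u => ?_
  have h1 := eVariationOn.sum_le (f := p) (n := u.1) u.2.2.1 u.2.2.2
  have h2 := eVariationOn.sum_le (f := q) (n := u.1) u.2.2.1 u.2.2.2
  refine le_trans ?_ (add_le_add h1 h2)
  rw [← Finset.sum_add_distrib]
  refine Finset.sum_le_sum fun i _ => ?_
  rw [edist_dist, edist_dist, edist_dist, ← ENNReal.ofReal_add dist_nonneg dist_nonneg]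
  exact ENNReal.ofReal_le_ofReal (dist_sub_sub_le _ _ _ _)

theorem locallyBoundedVariationOn_sub {p q : ℝ≥0 → ℝ} {s : Set ℝ≥0}
    (hp : LocallyBoundedVariationOn p s) (hq : LocallyBoundedVariationOn q s) :
    LocallyBoundedVariationOn (fun t => p t - q t) s := fun a b ha hb =>
  ne_top_of_le_ne_top (ENNReal.add_ne_top.2 ⟨hp a b ha hb, hq a b ha hb⟩)
    (eVariationOn_sub_le p q _)

namespace cvRing

theorem isNBVLoc_fn (a : cvRing) : IsNBVLoc (fn a) := by
  refine ⟨fn_zero a, fun t ht => ?_, ?_⟩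
  · refine (continuousWithinAt_one_apply a t).congr (fun s hs => ?_) (fn_of_pos a ht)
    exact fn_of_pos a (ht.trans_le hs)
  · obtain ⟨μ, ν, _, _, h⟩ := exists_rep a
    have hm : ∀ (ρ : Measure ℝ≥0) [IsLocallyFiniteMeasure ρ],
        LocallyBoundedVariationOn (fun t : ℝ≥0 => if t = 0 then 0 else ρ.real (Iic t)) univ := by
      intro ρ _
      refine MonotoneOn.locallyBoundedVariationOn fun x _ y _ hxy => ?_
      by_cases hx : x = 0
      · simp only [hx, if_true]
        split_ifs <;> simp
      · have hy : y ≠ 0 := fun h' => hx (le_antisymm (hxy.trans h'.le) zero_le)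
        simp only [hx, hy, if_false]
        exact measureReal_mono (Iic_subset_Iic.2 hxy) (measure_Iic_lt_top ρ y).ne
    convert! locallyBoundedVariationOn_sub (hm μ) (hm ν) using 1
    ext t
    by_cases ht : t = 0
    · simp [ht, fn_zero]
    · simp only [ht, if_false]
      rw [fn_of_pos a (pos_iff_ne_zero.2 ht), one_apply_of_rep h]

end cvRing

/-- The measure with distribution function `t ↦ p(t+) - p(0)` for a monotone `p`. -/
theorem exists_measure_of_monotone {p : ℝ≥0 → ℝ} (hp : Monotone p) :
    ∃ (μ : Measure ℝ≥0) (_ : IsLocallyFiniteMeasure μ),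
      ∀ t, μ.real (Iic t) = Function.rightLim p t - p 0 := by
  set P := hp.stieltjesFunction
  have h0 : p 0 ≤ Function.rightLim p 0 := hp.le_rightLim le_rfl
  set c : NNReal := ⟨Function.rightLim p 0 - p 0, sub_nonneg.2 h0⟩
  have hbot : (botSet : Set ℝ≥0) = {0} := botSet_eq_singleton_of_isBot fun _ => zero_le
  have hP : ∀ t, P.measure (Iic t) =
      ENNReal.ofReal (Function.rightLim p t - Function.rightLim p 0) := by
    intro t
    have : Iic t = {0} ∪ Ioc 0 t := by
      rw [← Icc_bot, ← Ioc_union_left (bot_le : ⊥ ≤ t), union_comm]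
      rfl
    rw [this, measure_union (by simp) measurableSet_Ioc, ← hbot, P.measure_botSet,
      P.measure_Ioc, zero_add]
    rfl
  have hfin : ∀ t, (P.measure + c • Measure.dirac 0 : Measure ℝ≥0) (Iic t) =
      ENNReal.ofReal (Function.rightLim p t - p 0) := by
    intro t
    have hc : (c : ENNReal) = ENNReal.ofReal (Function.rightLim p 0 - p 0) := by
      rw [ENNReal.ofReal_eq_coe_nnreal (sub_nonneg.2 h0)]
      rfl
    rw [Measure.add_apply, hP, Measure.smul_apply, Measure.dirac_apply' _ measurableSet_Iic]
    simp only [indicator, mem_Iic, zero_le, if_true, Pi.one_apply, ENNReal.smul_def, smul_eq_mul,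
      mul_one]
    rw [hc, ← ENNReal.ofReal_add (sub_nonneg.2 (hp.rightLim zero_le)) (sub_nonneg.2 h0)]
    congr 1
    ring
  refine ⟨_, isLocallyFiniteMeasure_of_Iic (μ := P.measure + c • Measure.dirac 0) fun t => ?_,
    fun t => ?_⟩
  · rw [hfin]
    exact ENNReal.ofReal_lt_top
  · rw [measureReal_def, hfin, ENNReal.toReal_ofReal]
    exact sub_nonneg.2 (h0.trans (hp.rightLim zero_le))

/-- Every `NBV_loc` function is the distribution function of a local signed measure. -/
theorem IsNBVLoc.exists_fn_eq {f : ℝ≥0 → ℝ} (hf : IsNBVLoc f) : ∃ a, cvRing.fn a = f := by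
  obtain ⟨p, q, hp, hq, hpq⟩ := hf.locBV.exists_monotoneOn_sub_monotoneOn
  rw [monotoneOn_univ] at hp hq
  obtain ⟨μ, _, hμ⟩ := exists_measure_of_monotone hp
  obtain ⟨ν, _, hν⟩ := exists_measure_of_monotone hq
  let a : cvRing := ⟨convOp μ - convOp ν, μ, ν, inferInstance, inferInstance, rfl⟩
  refine ⟨a, funext fun t => ?_⟩
  rcases eq_zero_or_pos t with rfl | ht
  · rw [cvRing.fn_zero, hf.map_zero]
  rw [cvRing.fn_of_pos _ ht, cvRing.one_apply_of_rep (a := a) rfl, hμ, hν]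
  have h0 : p 0 - q 0 = 0 := by
    rw [← hf.map_zero, hpq]
    rfl
  have hlim : Tendsto f (𝓝[>] t) (𝓝 (Function.rightLim p t - Function.rightLim q t)) := by
    rw [hpq]
    exact (hp.tendsto_rightLim t).sub (hq.tendsto_rightLim t)
  have := tendsto_nhds_unique hlim ((hf.rightCts t ht).mono Ioi_subset_Ici_self)
  linarith

/-- Identification of the signed measure of a function of bounded variation from its values on
the sets `[0,u]`. -/
theorem vectorMeasure_eq_sub {f : ℝ≥0 → ℝ} (hf : BoundedVariationOn f univ)
    (α β : Measure ℝ≥0) [IsFiniteMeasure α] [IsFiniteMeasure β] (T : ℝ≥0)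
    (hα : α (Ioi T) = 0) (hβ : β (Ioi T) = 0) (hT : hf.vectorMeasure (Ioi T) = 0)
    (h : ∀ u, Function.rightLim f u - f 0 = α.real (Iic u) - β.real (Iic u)) :
    hf.vectorMeasure = α.toSignedMeasure - β.toSignedMeasure := by
  have hI : ∀ u, hf.vectorMeasure (Iic u) = (α.toSignedMeasure - β.toSignedMeasure) (Iic u) := by
    intro u
    rw [← Icc_bot, hf.vectorMeasure_Icc bot_le, leftLim_eq_of_isBot isBot_bot, Icc_bot,
      sub_apply, Measure.toSignedMeasure_apply_measurable measurableSet_Iic,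
      Measure.toSignedMeasure_apply_measurable measurableSet_Iic]
    exact h u
  refine VectorMeasure.ext_of_generateFrom (range Iic) ?_
    measurableSpace_eq_generateFrom_Iic isPiSystem_Iic ?_
  · rintro _ ⟨u, rfl⟩
    exact hI u
  · rw [← Iic_union_Ioi (a := T), VectorMeasure.of_union (Iic_disjoint_Ioi le_rfl)
      measurableSet_Iic measurableSet_Ioi, VectorMeasure.of_union (Iic_disjoint_Ioi le_rfl)
      measurableSet_Iic measurableSet_Ioi, hI, hT, sub_apply _ _ (Ioi T),
      Measure.toSignedMeasure_apply_measurable measurableSet_Ioi,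
      Measure.toSignedMeasure_apply_measurable measurableSet_Ioi]
    simp [measureReal_def, hα, hβ]

theorem boundedVariationOn_stopped {f : ℝ≥0 → ℝ} (hf : LocallyBoundedVariationOn f univ)
    (T : ℝ≥0) : BoundedVariationOn (fun s => f (min s T)) univ := by
  have h := hf 0 T (mem_univ _) (mem_univ _)
  refine ne_top_of_le_ne_top h ?_
  exact eVariationOn.comp_le_of_monotoneOn f (fun s => min s T)
    (fun x _ y _ hxy => min_le_min_right T hxy) fun x _ => ⟨mem_univ _, zero_le, min_le_right _ _⟩

/-- If a signed measure is the difference of two finite measures, then the integral through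
its Jordan decomposition is the difference of the integrals. -/
theorem jordan_integral_eq (α β : Measure ℝ≥0) [IsFiniteMeasure α] [IsFiniteMeasure β]
    {s : SignedMeasure ℝ≥0} (hs : s = α.toSignedMeasure - β.toSignedMeasure) {g : ℝ≥0 → ℝ}
    (hg : Measurable g) {A : Set ℝ≥0} (hA : MeasurableSet A) {C : ℝ} (hC : ∀ x ∈ A, |g x| ≤ C) :
    (∫ τ in A, g τ ∂s.toJordanDecomposition.posPart) -
      ∫ τ in A, g τ ∂s.toJordanDecomposition.negPart =
    (∫ τ in A, g τ ∂α) - ∫ τ in A, g τ ∂β := by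
  set j := s.toJordanDecomposition
  have hj : j.posPart.toSignedMeasure - j.negPart.toSignedMeasure =
      α.toSignedMeasure - β.toSignedMeasure := by
    rw [← hs]
    exact s.toSignedMeasure_toJordanDecomposition
  have key : j.posPart + β = j.negPart + α := by
    rw [← Measure.toSignedMeasure_eq_toSignedMeasure_iff, Measure.toSignedMeasure_add,
      Measure.toSignedMeasure_add]
    rw [sub_eq_sub_iff_add_eq_add] at hj
    rw [hj, add_comm]
  have hint : ∀ (ρ : Measure ℝ≥0) [IsFiniteMeasure ρ], IntegrableOn g A ρ := fun ρ _ =>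
    Measure.integrableOn_of_bounded (measure_lt_top ρ A).ne hg.aestronglyMeasurable
      (ae_restrict_of_forall_mem hA hC)
  have h2 : ∫ τ in A, g τ ∂(j.posPart + β) = ∫ τ in A, g τ ∂(j.negPart + α) := by rw [key]
  rw [Measure.restrict_add, Measure.restrict_add, integral_add_measure (hint _) (hint _),
    integral_add_measure (hint _) (hint _)] at h2
  linarith

/-- The Stieltjes integral in terms of any representation of the function by locally finite
measures. -/
theorem stieltjesIntegral_fn_of_rep {a : cvRing} {μ ν : Measure ℝ≥0} [IsLocallyFiniteMeasure μ]
    [IsLocallyFiniteMeasure ν] (ha : a.1 = convOp μ - convOp ν) {T : ℝ≥0} (hT : 0 < T)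
    {g : ℝ≥0 → ℝ} (hg : Measurable g) {C : ℝ} (hC : ∀ x ≤ T, |g x| ≤ C) :
    stieltjesIntegral (cvRing.fn a) T g = (∫ τ in Iic T, g τ ∂μ) - ∫ τ in Iic T, g τ ∂ν := by
  have hbv := boundedVariationOn_stopped (cvRing.isNBVLoc_fn a).locBV T
  have : IsFiniteMeasure (μ.restrict (Iic T)) :=
    ⟨by simpa using measure_Iic_lt_top μ T⟩
  have : IsFiniteMeasure (ν.restrict (Iic T)) :=
    ⟨by simpa using measure_Iic_lt_top ν T⟩
  have hR : ∀ u, Function.rightLim (fun s => cvRing.fn a (min s T)) u =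
      μ.real (Iic (min u T)) - ν.real (Iic (min u T)) := by
    intro u
    rw [← cvRing.one_apply_of_rep ha]
    refine rightLim_eq_of_tendsto ?_
    rcases lt_or_ge u T with hu | hu
    · rw [min_eq_left hu.le]
      have h1 := (cvRing.continuousWithinAt_one_apply a u).mono Ioi_subset_Ici_self
      refine Tendsto.congr' ?_ h1
      filter_upwards [Ioo_mem_nhdsGT hu] with s hs
      rw [min_eq_left hs.2.le, cvRing.fn_of_pos a (pos_of_gt hs.1)]
    · rw [min_eq_right hu, ← cvRing.fn_of_pos a hT]
      refine tendsto_const_nhds.congr' ?_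
      filter_upwards [self_mem_nhdsWithin] with s hs
      rw [min_eq_right (hu.trans (le_of_lt hs))]
  have hs := vectorMeasure_eq_sub hbv (μ.restrict (Iic T)) (ν.restrict (Iic T)) T
    (by rw [Measure.restrict_apply measurableSet_Ioi, inter_comm,
      (Iic_disjoint_Ioi le_rfl).inter_eq, measure_empty])
    (by rw [Measure.restrict_apply measurableSet_Ioi, inter_comm,
      (Iic_disjoint_Ioi le_rfl).inter_eq, measure_empty])
    (by
      rw [hbv.vectorMeasure_Ioi, hR, sub_eq_zero]
      refine Tendsto.limUnder_eq ?_
      rw [← cvRing.one_apply_of_rep ha, min_self, ← cvRing.fn_of_pos a hT]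
      refine tendsto_const_nhds.congr' ?_
      filter_upwards [eventually_ge_atTop T] with s hs
      rw [min_eq_right hs])
    (fun u => by
      rw [hR, min_eq_left zero_le, cvRing.fn_zero, sub_zero,
        measureReal_restrict_apply measurableSet_Iic,
        measureReal_restrict_apply measurableSet_Iic, Iic_inter_Iic])
  have := jordan_integral_eq _ _ (s := stieltjesMeasure (cvRing.fn a) T)
    (by rw [stieltjesMeasure, dif_pos hbv]; exact hs) hg (measurableSet_Iic (a := T)) hC
  rw [stieltjesIntegral, this, Measure.restrict_restrict measurableSet_Iic,
    Measure.restrict_restrict measurableSet_Iic, inter_self]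

theorem stieltjesMeasure_zero (f : ℝ≥0 → ℝ) : stieltjesMeasure f 0 = 0 := by
  have hbv : BoundedVariationOn (fun s => f (min s 0)) univ := by
    simp only [min_eq_right zero_le]
    refine ne_of_eq_of_ne (eVariationOn.constant_on ?_) ENNReal.zero_ne_top
    rintro _ ⟨x, -, rfl⟩ _ ⟨y, -, rfl⟩
    rfl
  have hconst : (fun s : ℝ≥0 => f (min s 0)) = fun _ => f 0 := by
    ext s
    rw [min_eq_right zero_le]
  have hr : ∀ u, Function.rightLim (fun s : ℝ≥0 => f (min s 0)) u = f 0 := by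
    intro u
    rw [hconst]
    exact rightLim_eq_of_tendsto tendsto_const_nhds
  have := vectorMeasure_eq_sub hbv 0 0 0 (by simp) (by simp)
    (by
      rw [hbv.vectorMeasure_Ioi, hr, sub_eq_zero, hconst]
      exact tendsto_const_nhds.limUnder_eq)
    (fun u => by rw [hr, min_eq_right zero_le]; simp)
  rw [stieltjesMeasure, dif_pos hbv, this, sub_self]

theorem stieltjesIntegral_zero (f g : ℝ≥0 → ℝ) : stieltjesIntegral f 0 g = 0 := by
  rw [stieltjesIntegral, stieltjesMeasure_zero, SignedMeasure.toJordanDecomposition_zero]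
  simp

theorem stieltjesIntegral_fn (a : cvRing) (h : LocBdd) (t : ℝ≥0) :
    (stieltjesIntegral (cvRing.fn a) t fun τ => h.1 (t - τ)) = cvRing.cv a h t := by
  rcases eq_zero_or_pos t with rfl | ht
  · rw [stieltjesIntegral_zero, cvRing.cv_zero]
  obtain ⟨μ, ν, _, _, ha⟩ := cvRing.exists_rep a
  obtain ⟨C, -, hC⟩ := LocBdd.exists_bound h t
  have hm : Measurable fun τ => h.1 (t - τ) :=
    (LocBdd.measurable h).comp (measurable_const.sub measurable_id)
  rw [stieltjesIntegral_fn_of_rep ha ht hm (fun s _ => hC _ tsub_le_self),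
    cvRing.cv_of_pos _ _ ht, ha]
  rfl

theorem stieltjesConv_fn (a b : cvRing) (t : ℝ≥0) :
    stieltjesConv (cvRing.fn a) (cvRing.fn b) t = cvRing.fn (a * b) t := by
  rw [stieltjesConv, cvRing.fn.eq_1 (a * b), cvRing.cv_mul, ← stieltjesIntegral_fn]
  congr 1
  ext τ
  exact cvRing.rightLim_fn b _

/-! ### Exponential weights -/

/-- The mass of `e^{-ω τ} μ(dτ)`. -/
noncomputable def wmass (ω : ℝ) (μ : Measure ℝ≥0) : ENNReal :=
  ∫⁻ τ, ENNReal.ofReal (Real.exp (-ω * τ)) ∂μ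

theorem measurable_expWeight (ω : ℝ) :
    Measurable fun τ : ℝ≥0 => ENNReal.ofReal (Real.exp (-ω * τ)) := by fun_prop

theorem wmass_zero (ω : ℝ) : wmass ω 0 = 0 := by simp [wmass]

theorem wmass_add (ω : ℝ) (μ ν : Measure ℝ≥0) : wmass ω (μ + ν) = wmass ω μ + wmass ω ν :=
  lintegral_add_measure _ _ _

theorem wmass_finsetSum {ι : Type*} (ω : ℝ) (s : Finset ι) (μ : ι → Measure ℝ≥0) :
    wmass ω (∑ i ∈ s, μ i) = ∑ i ∈ s, wmass ω (μ i) :=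
  lintegral_finsetSum_measure _ _ _

theorem wmass_sum (ω : ℝ) (μ : ℕ → Measure ℝ≥0) :
    wmass ω (Measure.sum μ) = ∑' i, wmass ω (μ i) := lintegral_sum_measure _ _

theorem wmass_conv (ω : ℝ) (μ ν : Measure ℝ≥0) [SFinite ν] :
    wmass ω (μ ∗ ν) = wmass ω μ * wmass ω ν := by
  unfold wmass
  rw [Measure.lintegral_conv (measurable_expWeight ω)]
  have : ∀ x y : ℝ≥0, ENNReal.ofReal (Real.exp (-ω * (x + y : ℝ≥0))) =
      ENNReal.ofReal (Real.exp (-ω * x)) * ENNReal.ofReal (Real.exp (-ω * y)) := by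
    intro x y
    rw [← ENNReal.ofReal_mul (Real.exp_pos _).le, ← Real.exp_add]
    congr 2
    push_cast
    ring
  simp_rw [this]
  simp_rw [lintegral_const_mul _ (measurable_expWeight ω)]
  rw [lintegral_mul_const _ (measurable_expWeight ω)]

theorem wmass_anti {ω ω' : ℝ} (h : ω ≤ ω') (μ : Measure ℝ≥0) : wmass ω' μ ≤ wmass ω μ := by
  refine lintegral_mono fun τ => ENNReal.ofReal_le_ofReal (Real.exp_le_exp.2 ?_)
  nlinarith [τ.2, mul_le_mul_of_nonneg_right h τ.2]

theorem wmass_mono_measure (ω : ℝ) {μ ν : Measure ℝ≥0} (h : μ ≤ ν) : wmass ω μ ≤ wmass ω ν :=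
  lintegral_mono' h le_rfl

theorem measure_Iic_le_wmass {ω : ℝ} (hω : 0 ≤ ω) (μ : Measure ℝ≥0) (t : ℝ≥0) :
    μ (Iic t) ≤ ENNReal.ofReal (Real.exp (ω * t)) * wmass ω μ := by
  calc μ (Iic t) = ∫⁻ _ in Iic t, 1 ∂μ := by simp
    _ ≤ ∫⁻ τ in Iic t, ENNReal.ofReal (Real.exp (ω * t)) *
        ENNReal.ofReal (Real.exp (-ω * τ)) ∂μ := by
      refine setLIntegral_mono' measurableSet_Iic fun τ hτ => ?_
      rw [← ENNReal.ofReal_mul (Real.exp_pos _).le, ← Real.exp_add, ← ENNReal.ofReal_one]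
      refine ENNReal.ofReal_le_ofReal (Real.one_le_exp ?_)
      have : (τ : ℝ) ≤ t := hτ
      nlinarith
    _ ≤ ∫⁻ τ, ENNReal.ofReal (Real.exp (ω * t)) *
        ENNReal.ofReal (Real.exp (-ω * τ)) ∂μ := setLIntegral_le_lintegral _ _
    _ = _ := by
      rw [lintegral_const_mul _ (measurable_expWeight ω)]
      rfl

theorem isLocallyFiniteMeasure_of_wmass {ω : ℝ} (hω : 0 ≤ ω) {μ : Measure ℝ≥0}
    (h : wmass ω μ < ⊤) : IsLocallyFiniteMeasure μ :=
  isLocallyFiniteMeasure_of_Iic fun t => (measure_Iic_le_wmass hω μ t).trans_lt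
    (ENNReal.mul_lt_top ENNReal.ofReal_lt_top h)

theorem integrable_exp_of_wmass {ω : ℝ} {μ : Measure ℝ≥0} (h : wmass ω μ < ⊤) :
    Integrable (fun τ : ℝ≥0 => Real.exp (-ω * τ)) μ :=
  ⟨by fun_prop, by
    rw [hasFiniteIntegral_iff_ofReal (Eventually.of_forall fun _ => (Real.exp_pos _).le)]
    exact h⟩

/-- `e^{-ωt} h(t)` is bounded. -/
def ExpBdd (ω : ℝ) (h : ℝ≥0 → ℝ) : Prop := ∃ C, ∀ t : ℝ≥0, |h t| ≤ C * Real.exp (ω * t)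

theorem ExpBdd.mono {ω ω' : ℝ} (h : ω ≤ ω') {f : ℝ≥0 → ℝ} (hf : ExpBdd ω f) : ExpBdd ω' f := by
  obtain ⟨C, hC⟩ := hf
  have hC0 : 0 ≤ C := by simpa using (abs_nonneg _).trans (hC 0)
  refine ⟨C, fun t => (hC t).trans (mul_le_mul_of_nonneg_left (Real.exp_le_exp.2 ?_) hC0)⟩
  exact mul_le_mul_of_nonneg_right h t.2

theorem ExpBdd.sub {ω : ℝ} {f g : ℝ≥0 → ℝ} (hf : ExpBdd ω f) (hg : ExpBdd ω g) :
    ExpBdd ω fun t => f t - g t := by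
  obtain ⟨C, hC⟩ := hf
  obtain ⟨D, hD⟩ := hg
  refine ⟨C + D, fun t => (abs_sub _ _).trans ?_⟩
  rw [add_mul]
  exact add_le_add (hC t) (hD t)

theorem expBdd_one {ω : ℝ} (hω : 0 ≤ ω) : ExpBdd ω LocBdd.one.1 :=
  ⟨1, fun t => by
    simp only [LocBdd.one, abs_one, one_mul]
    exact Real.one_le_exp (mul_nonneg hω t.2)⟩

theorem expBdd_convOp {ω : ℝ} {μ : Measure ℝ≥0} [IsLocallyFiniteMeasure μ] (hμ : wmass ω μ < ⊤)
    {h : LocBdd} (hh : ExpBdd ω h.1) : ExpBdd ω (convOp μ h).1 := by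
  obtain ⟨C, hC⟩ := hh
  have hC0 : 0 ≤ C := by simpa using (abs_nonneg _).trans (hC 0)
  have hint := integrable_exp_of_wmass hμ
  refine ⟨C * ∫ τ : ℝ≥0, Real.exp (-ω * τ) ∂μ, fun t => ?_⟩
  have h1 : |(convOp μ h).1 t| ≤ ∫ τ in Iic t, C * Real.exp (ω * t) * Real.exp (-ω * τ) ∂μ := by
    rw [convOp_apply]
    refine norm_integral_le_of_norm_le (f := fun τ => h.1 (t - τ))
      (hint.const_mul _).integrableOn (ae_restrict_of_forall_mem measurableSet_Iic fun τ hτ => ?_)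
    refine (hC _).trans_eq ?_
    rw [mul_assoc, ← Real.exp_add, NNReal.coe_sub hτ]
    ring_nf
  refine h1.trans ((setIntegral_le_integral (hint.const_mul _)
    (Eventually.of_forall fun τ => by positivity)).trans_eq ?_)
  rw [integral_const_mul]
  ring

namespace cvRing

/-- The local signed measure has finite total variation after multiplication by `e^{-ω τ}`. -/
def HasWeight (ω : ℝ) (a : cvRing) : Prop :=
  ∃ (μ ν : Measure ℝ≥0) (_ : IsLocallyFiniteMeasure μ) (_ : IsLocallyFiniteMeasure ν),
    wmass ω μ < ⊤ ∧ wmass ω ν < ⊤ ∧ a.1 = convOp μ - convOp ν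

theorem HasWeight.mono {ω ω' : ℝ} (h : ω ≤ ω') {a : cvRing} (ha : HasWeight ω a) :
    HasWeight ω' a := by
  obtain ⟨μ, ν, _, _, h1, h2, h3⟩ := ha
  exact ⟨μ, ν, inferInstance, inferInstance, (wmass_anti h μ).trans_lt h1,
    (wmass_anti h ν).trans_lt h2, h3⟩

theorem hasWeight_zero (ω : ℝ) : HasWeight ω 0 :=
  ⟨0, 0, inferInstance, inferInstance, by simp [wmass_zero], by simp [wmass_zero],
    (sub_self _).symm⟩

theorem HasWeight.add {ω : ℝ} {a b : cvRing} (ha : HasWeight ω a) (hb : HasWeight ω b) :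
    HasWeight ω (a + b) := by
  obtain ⟨μ, ν, _, _, h1, h2, h3⟩ := ha
  obtain ⟨μ', ν', _, _, h1', h2', h3'⟩ := hb
  refine ⟨μ + μ', ν + ν', inferInstance, inferInstance, ?_, ?_, ?_⟩
  · rw [wmass_add]
    exact ENNReal.add_lt_top.2 ⟨h1, h1'⟩
  · rw [wmass_add]
    exact ENNReal.add_lt_top.2 ⟨h2, h2'⟩
  · rw [Subring.coe_add, h3, h3']
    simp only [convOp_add]
    abel

theorem HasWeight.mul {ω : ℝ} {a b : cvRing} (ha : HasWeight ω a) (hb : HasWeight ω b) :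
    HasWeight ω (a * b) := by
  obtain ⟨μ, ν, _, _, h1, h2, h3⟩ := ha
  obtain ⟨μ', ν', _, _, h1', h2', h3'⟩ := hb
  refine ⟨μ ∗ μ' + ν ∗ ν', μ ∗ ν' + ν ∗ μ', inferInstance, inferInstance, ?_, ?_, ?_⟩
  · simp only [wmass_add, wmass_conv]
    exact ENNReal.add_lt_top.2 ⟨ENNReal.mul_lt_top h1 h1', ENNReal.mul_lt_top h2 h2'⟩
  · simp only [wmass_add, wmass_conv]
    exact ENNReal.add_lt_top.2 ⟨ENNReal.mul_lt_top h1 h2', ENNReal.mul_lt_top h2 h1'⟩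
  · rw [Subring.coe_mul, h3, h3']
    simp only [convOp_add, convOp_conv]
    noncomm_ring

theorem HasWeight.sum {ι : Type*} {ω : ℝ} {s : Finset ι} {a : ι → cvRing}
    (ha : ∀ i, HasWeight ω (a i)) : HasWeight ω (∑ i ∈ s, a i) := by
  classical
  induction s using Finset.induction_on with
  | empty => exact hasWeight_zero ω
  | insert i s hi ih =>
    rw [Finset.sum_insert hi]
    exact (ha i).add ih

theorem HasWeight.expBdd {ω : ℝ} {a : cvRing} (ha : HasWeight ω a) {h : LocBdd}
    (hh : ExpBdd ω h.1) : ExpBdd ω (a.1 h).1 := by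
  obtain ⟨μ, ν, _, _, h1, h2, h3⟩ := ha
  rw [h3]
  exact (expBdd_convOp h1 hh).sub (expBdd_convOp h2 hh)

end cvRing

/-! ### Laplace transforms -/

/-- The Laplace transform `∫₀^∞ e^{-λt} h(t) dt`. -/
noncomputable def lapl (lam : ℂ) (h : ℝ≥0 → ℝ) : ℂ :=
  ∫ t in Ioi (0 : ℝ), Complex.exp (-lam * t) * ((h t.toNNReal : ℝ) : ℂ)

theorem norm_cexp_neg_mul (lam : ℂ) (t : ℝ) :
    ‖Complex.exp (-lam * t)‖ = Real.exp (-lam.re * t) := by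
  rw [Complex.norm_exp]
  congr 1
  simp

theorem ExpBdd.integrableOn_lapl {ω : ℝ} {h : ℝ≥0 → ℝ} (hh : ExpBdd ω h) (hm : Measurable h)
    {lam : ℂ} (hlam : ω < lam.re) :
    IntegrableOn (fun t : ℝ => Complex.exp (-lam * t) * ((h t.toNNReal : ℝ) : ℂ)) (Ioi 0) := by
  obtain ⟨C, hC⟩ := hh
  have hi : IntegrableOn (fun t : ℝ => C * Real.exp (-(lam.re - ω) * t)) (Ioi 0) :=
    (exp_neg_integrableOn_Ioi 0 (sub_pos.2 hlam)).const_mul C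
  refine hi.mono' ?_ (ae_restrict_of_forall_mem measurableSet_Ioi fun t ht => ?_)
  · have : Measurable fun t : ℝ => ((h t.toNNReal : ℝ) : ℂ) :=
      Complex.measurable_ofReal.comp (hm.comp measurable_real_toNNReal)
    have h2 : Measurable fun t : ℝ => Complex.exp (-lam * t) := by fun_prop
    exact (h2.mul this).aestronglyMeasurable
  · rw [norm_mul, norm_cexp_neg_mul, Complex.norm_real]
    have h1 := hC t.toNNReal
    rw [Real.coe_toNNReal _ (le_of_lt ht)] at h1
    calc Real.exp (-lam.re * t) * ‖h t.toNNReal‖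
        ≤ Real.exp (-lam.re * t) * (C * Real.exp (ω * t)) :=
          mul_le_mul_of_nonneg_left h1 (Real.exp_pos _).le
      _ = C * Real.exp (-(lam.re - ω) * t) := by
          rw [mul_left_comm, ← Real.exp_add]
          ring_nf

theorem lapl_congr {lam : ℂ} {f g : ℝ≥0 → ℝ} (h : ∀ t, 0 < t → f t = g t) :
    lapl lam f = lapl lam g := by
  refine setIntegral_congr_fun measurableSet_Ioi fun t ht => ?_
  rw [h _ (Real.toNNReal_pos.2 ht)]

theorem lapl_add {ω : ℝ} {lam : ℂ} (hlam : ω < lam.re) {f g : ℝ≥0 → ℝ} (hf : Measurable f)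
    (hg : Measurable g) (hf' : ExpBdd ω f) (hg' : ExpBdd ω g) :
    lapl lam (fun t => f t + g t) = lapl lam f + lapl lam g := by
  rw [lapl, lapl, lapl, ← integral_add (hf'.integrableOn_lapl hf hlam)
    (hg'.integrableOn_lapl hg hlam)]
  congr 1
  ext t
  push_cast
  ring

theorem lapl_sub {ω : ℝ} {lam : ℂ} (hlam : ω < lam.re) {f g : ℝ≥0 → ℝ} (hf : Measurable f)
    (hg : Measurable g) (hf' : ExpBdd ω f) (hg' : ExpBdd ω g) :
    lapl lam (fun t => f t - g t) = lapl lam f - lapl lam g := by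
  rw [lapl, lapl, lapl, ← integral_sub (hf'.integrableOn_lapl hf hlam)
    (hg'.integrableOn_lapl hg hlam)]
  congr 1
  ext t
  push_cast
  ring

theorem lapl_sum {ι : Type*} (s : Finset ι) {ω : ℝ} {lam : ℂ} (hlam : ω < lam.re)
    {f : ι → ℝ≥0 → ℝ} (hf : ∀ i, Measurable (f i)) (hf' : ∀ i, ExpBdd ω (f i)) :
    lapl lam (fun t => ∑ i ∈ s, f i t) = ∑ i ∈ s, lapl lam (f i) := by
  unfold lapl
  rw [← integral_finsetSum _ fun i _ => (hf' i).integrableOn_lapl (hf i) hlam]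
  congr 1
  ext t
  push_cast
  rw [Finset.mul_sum]

theorem lapl_const {lam : ℂ} (hlam : 0 < lam.re) (c : ℝ) :
    lapl lam (fun _ => c) = c / lam := by
  unfold lapl
  rw [integral_mul_const]
  have h := integral_exp_mul_complex_Ioi (a := -lam) (by simpa using hlam) 0
  rw [h]
  have : lam ≠ 0 := by
    rintro rfl
    simp at hlam
  field_simp
  simp

theorem indicator_Ioi_shift_ae {E : Type*} [Zero E] (φ : ℝ≥0 → E) (τ : ℝ≥0) :
    ∀ᵐ t : ℝ, (Ioi (0 : ℝ)).indicator
      (fun t => if τ ≤ t.toNNReal then φ (t.toNNReal - τ) else 0) t =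
      (Ioi (0 : ℝ)).indicator (fun t => φ t.toNNReal) (t - τ) := by
  have : ∀ᵐ t : ℝ, t ≠ τ := by simp [ae_iff]
  filter_upwards [this] with t ht
  rcases lt_or_gt_of_ne ht with h | h
  · rw [indicator_of_notMem (s := Ioi (0 : ℝ)) (a := t - τ) (by simpa using h.le)]
    by_cases h0 : 0 < t
    · rw [indicator_of_mem (show t ∈ Ioi 0 from h0), if_neg]
      rw [not_le, Real.toNNReal_lt_iff_lt_coe h0.le]
      exact h
    · rw [indicator_of_notMem (by simpa using h0)]
  · have h0 : 0 < t := lt_of_le_of_lt τ.2 h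
    rw [indicator_of_mem (show t ∈ Ioi 0 from h0),
      indicator_of_mem (show t - τ ∈ Ioi 0 from sub_pos.2 h), if_pos]
    · congr 1
      rw [NNReal.sub_def, Real.coe_toNNReal t h0.le]
    · exact (Real.le_toNNReal_iff_coe_le h0.le).2 h.le

/-- Translation of a function supported on `[τ,∞)`. -/
theorem integral_Ioi_shift {E : Type*} [NormedAddCommGroup E] [NormedSpace ℝ E]
    (φ : ℝ≥0 → E) (τ : ℝ≥0) :
    ∫ t in Ioi (0 : ℝ), (if τ ≤ t.toNNReal then φ (t.toNNReal - τ) else 0) =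
      ∫ t in Ioi (0 : ℝ), φ t.toNNReal := by
  rw [← integral_indicator measurableSet_Ioi, ← integral_indicator measurableSet_Ioi,
    integral_congr_ae (indicator_Ioi_shift_ae φ τ)]
  exact integral_sub_right_eq_self ((Ioi (0 : ℝ)).indicator fun t => φ t.toNNReal) (τ : ℝ)

theorem integrableOn_Ioi_shift {E : Type*} [NormedAddCommGroup E]
    {φ : ℝ≥0 → E} (hφ : IntegrableOn (fun t : ℝ => φ t.toNNReal) (Ioi 0)) (τ : ℝ≥0) :
    IntegrableOn (fun t : ℝ => if τ ≤ t.toNNReal then φ (t.toNNReal - τ) else 0) (Ioi 0) := by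
  rw [← integrable_indicator_iff measurableSet_Ioi] at hφ ⊢
  exact (hφ.comp_sub_right (τ : ℝ)).congr (by
    filter_upwards [indicator_Ioi_shift_ae φ τ] with t ht using ht.symm)

/-- The Laplace transform of a convolution with a measure. -/
theorem lapl_convOp {ω : ℝ} {lam : ℂ} (hlam : ω < lam.re) {μ : Measure ℝ≥0}
    [IsLocallyFiniteMeasure μ] (hμ : wmass ω μ < ⊤) {h : LocBdd} (hh : ExpBdd ω h.1) :
    lapl lam (convOp μ h).1 = (∫ τ : ℝ≥0, Complex.exp (-lam * τ) ∂μ) * lapl lam h.1 := by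
  -- the weighted function, whose translates are the weighted kernels
  set φ : ℝ≥0 → ℂ := fun s => Complex.exp (-lam * (s : ℝ)) * ((h.1 s : ℝ) : ℂ) with hφ
  have hφm : Measurable φ := by
    have : Measurable fun s : ℝ≥0 => ((h.1 s : ℝ) : ℂ) :=
      Complex.measurable_ofReal.comp (LocBdd.measurable h)
    have h2 : Measurable fun s : ℝ≥0 => Complex.exp (-lam * (s : ℝ)) := by fun_prop
    exact h2.mul this
  have hφl : ∫ t in Ioi (0 : ℝ), φ t.toNNReal = lapl lam h.1 := by
    refine setIntegral_congr_fun measurableSet_Ioi fun t ht => ?_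
    simp only [hφ, Real.coe_toNNReal t (le_of_lt ht)]
  have hφi : IntegrableOn (fun t : ℝ => φ t.toNNReal) (Ioi 0) := by
    refine (hh.integrableOn_lapl (LocBdd.measurable h) hlam).congr_fun (fun t ht => ?_)
      measurableSet_Ioi
    simp only [hφ, Real.coe_toNNReal t (le_of_lt ht)]
  set F : ℝ → ℝ≥0 → ℂ := fun t τ => Complex.exp (-lam * (τ : ℝ)) *
    (if τ ≤ t.toNNReal then φ (t.toNNReal - τ) else 0) with hF
  have hFm : Measurable (Function.uncurry F) := by
    have h1 : Measurable fun p : ℝ × ℝ≥0 => Complex.exp (-lam * (p.2 : ℝ)) := by fun_prop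
    have h2 : Measurable fun p : ℝ × ℝ≥0 =>
        if p.2 ≤ p.1.toNNReal then φ (p.1.toNNReal - p.2) else 0 :=
      Measurable.ite (measurableSet_le measurable_snd (by fun_prop))
        (hφm.comp ((measurable_real_toNNReal.comp measurable_fst).sub measurable_snd))
        measurable_const
    exact h1.mul h2
  have hint : Integrable (Function.uncurry F) ((volume.restrict (Ioi 0)).prod μ) := by
    rw [integrable_prod_iff' hFm.aestronglyMeasurable]
    constructor
    · refine Eventually.of_forall fun τ => ?_
      exact (integrableOn_Ioi_shift hφi τ).const_mul (Complex.exp (-lam * (τ : ℝ)))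
    · have : ∀ τ : ℝ≥0, ∫ t in Ioi (0 : ℝ), ‖Function.uncurry F (t, τ)‖ =
          Real.exp (-lam.re * τ) * ∫ t in Ioi (0 : ℝ), ‖φ t.toNNReal‖ := by
        intro τ
        rw [← integral_Ioi_shift (fun s => ‖φ s‖) τ, ← integral_const_mul]
        congr 1
        ext t
        simp only [Function.uncurry, hF, norm_mul, norm_cexp_neg_mul]
        split_ifs <;> simp
      simp_rw [this]
      exact (integrable_exp_of_wmass ((wmass_anti hlam.le μ).trans_lt hμ)).mul_const _
  calc lapl lam (convOp μ h).1 = ∫ t in Ioi (0 : ℝ), ∫ τ, F t τ ∂μ := by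
        refine setIntegral_congr_fun measurableSet_Ioi fun t ht => ?_
        simp only [convOp_apply]
        rw [← integral_kernel, ← integral_complex_ofReal, ← integral_const_mul]
        congr 1
        ext τ
        simp only [hF, LocBdd.kernel, hφ]
        split_ifs with hτ
        · rw [← mul_assoc, ← Complex.exp_add, NNReal.coe_sub hτ,
            Real.coe_toNNReal t (le_of_lt ht)]
          congr 2
          push_cast
          ring
        · simp
    _ = ∫ τ, (∫ t in Ioi (0 : ℝ), F t τ) ∂μ := integral_integral_swap hint
    _ = _ := by
        rw [← integral_mul_const]
        congr 1
        ext τ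
        simp only [hF]
        rw [integral_const_mul, integral_Ioi_shift, hφl]

namespace cvRing

/-- The Laplace transform turns convolution into multiplication; the Laplace–Stieltjes transform
of a distribution function `f` is written as `λ` times its Laplace transform. -/
theorem lapl_cv {ω : ℝ} (hω : 0 ≤ ω) {lam : ℂ} (hlam : ω < lam.re) {a : cvRing}
    (ha : HasWeight ω a) {h : LocBdd} (hh : ExpBdd ω h.1) :
    lapl lam (cv a h) = lam * lapl lam (fn a) * lapl lam h.1 := by
  obtain ⟨μ, ν, _, _, h1, h2, h3⟩ := ha
  have key : ∀ k : LocBdd, ExpBdd ω k.1 → lapl lam (cv a k) =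
      ((∫ τ : ℝ≥0, Complex.exp (-lam * τ) ∂μ) - ∫ τ : ℝ≥0, Complex.exp (-lam * τ) ∂ν) *
        lapl lam k.1 := by
    intro k hk
    rw [sub_mul, ← lapl_convOp hlam h1 hk, ← lapl_convOp hlam h2 hk,
      ← lapl_sub hlam (LocBdd.measurable _) (LocBdd.measurable _) (expBdd_convOp h1 hk)
        (expBdd_convOp h2 hk)]
    refine lapl_congr fun t ht => ?_
    rw [cv_of_pos _ _ ht, h3]
    rfl
  have h0 : lam ≠ 0 := by
    rintro rfl
    exact absurd hlam (by simpa using hω)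
  rw [key h hh, fn, key _ (expBdd_one hω),
    show LocBdd.one.1 = fun _ => 1 from rfl, lapl_const (hω.trans_lt hlam)]
  push_cast
  field_simp

end cvRing

/-! ### Resolvents -/

theorem conv_measure_sum (μ : Measure ℝ≥0) (ν : ℕ → Measure ℝ≥0) [∀ m, SFinite (ν m)] :
    μ ∗ Measure.sum ν = Measure.sum fun m => μ ∗ ν m := by
  unfold Measure.conv
  rw [Measure.prod_sum_right, Measure.map_sum (by fun_prop)]

theorem measure_sum_finsetSum {ι : Type*} (s : Finset ι) (μ : ι → ℕ → Measure ℝ≥0) :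
    (Measure.sum fun m => ∑ k ∈ s, μ k m) = ∑ k ∈ s, Measure.sum (μ k) := by
  ext A hA
  rw [Measure.sum_apply _ hA, Measure.finsetSum_apply]
  simp_rw [Measure.finsetSum_apply, Measure.sum_apply _ hA]
  exact Summable.tsum_finsetSum fun _ _ => ENNReal.summable

theorem measure_sum_succ (μ : ℕ → Measure ℝ≥0) :
    Measure.sum μ = μ 0 + Measure.sum fun m => μ (m + 1) := by
  ext A hA
  rw [Measure.add_apply, Measure.sum_apply _ hA, Measure.sum_apply _ hA,
    tsum_eq_zero_add' ENNReal.summable]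

instance isLocallyFiniteMeasure_finsetSum {ι : Type*} (s : Finset ι) (μ : ι → Measure ℝ≥0)
    [∀ i, IsLocallyFiniteMeasure (μ i)] : IsLocallyFiniteMeasure (∑ i ∈ s, μ i) :=
  isLocallyFiniteMeasure_of_Iic fun t => by
    rw [Measure.finsetSum_apply]
    exact ENNReal.sum_lt_top.2 fun i _ => measure_Iic_lt_top _ _

theorem convOp_finsetSum {ι : Type*} (s : Finset ι) (μ : ι → Measure ℝ≥0)
    [∀ i, IsLocallyFiniteMeasure (μ i)] : convOp (∑ i ∈ s, μ i) = ∑ i ∈ s, convOp (μ i) := by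
  classical
  induction s using Finset.induction_on with
  | empty =>
    rw [convOp_congr (Finset.sum_empty (f := μ)), convOp_zero, Finset.sum_empty]
  | insert i s hi ih =>
    rw [convOp_congr (Finset.sum_insert (f := μ) hi), convOp_add, ih, Finset.sum_insert hi]

theorem tendsto_wmass_atTop {ω : ℝ} {μ : Measure ℝ≥0} (h : wmass ω μ < ⊤) (h0 : μ {0} = 0) :
    Tendsto (fun N : ℕ => wmass (ω + N) μ) atTop (𝓝 0) := by
  have := tendsto_lintegral_of_dominated_convergence (μ := μ)
    (F := fun (N : ℕ) (τ : ℝ≥0) => ENNReal.ofReal (Real.exp (-(ω + N) * τ))) (f := fun _ => 0)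
    (fun τ => ENNReal.ofReal (Real.exp (-ω * τ))) (fun N => measurable_expWeight _)
    (fun N => Eventually.of_forall fun τ => ENNReal.ofReal_le_ofReal (Real.exp_le_exp.2 (by
      have : (0 : ℝ) ≤ N * τ := by positivity
      nlinarith)))
    h.ne ?_
  · simpa [wmass] using this
  · have hae : ∀ᵐ τ ∂μ, τ ≠ 0 := by simpa [ae_iff] using h0
    filter_upwards [hae] with τ hτ
    have hpos : (0 : ℝ) < τ := NNReal.coe_pos.2 (pos_iff_ne_zero.2 hτ)
    rw [← ENNReal.ofReal_zero]
    refine ENNReal.tendsto_ofReal (Real.tendsto_exp_atBot.comp ?_)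
    have h1 : Tendsto (fun N : ℕ => ω + (N : ℝ)) atTop atTop :=
      tendsto_atTop_add_const_left _ _ tendsto_natCast_atTop_atTop
    simpa using (tendsto_neg_atTop_atBot.comp h1).atBot_mul_const hpos

/-- The Neumann series for a matrix of local signed measures with small positive and negative
parts `κ · · false` and `κ · · true`: the parts `ρ` of its sum satisfy the resolvent equation. The
series is one of positive measures, so that its convergence is only a matter of total mass. -/
theorem exists_neumann {n : ℕ} {ω : ℝ} (hω : 0 ≤ ω) (κ : Fin n → Fin n → Bool → Measure ℝ≥0)
    (hκ : ∀ i j b, wmass ω (κ i j b) ≤ ENNReal.ofReal (1 / (4 * (n + 1)))) :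
    ∃ ρ : Fin n → Fin n → Bool → Measure ℝ≥0, (∀ i j b, wmass ω (ρ i j b) < ⊤) ∧
      ∀ i j b, ρ i j b = κ i j b + ∑ k, (κ i k false ∗ ρ k j b + κ i k true ∗ ρ k j (!b)) := by
  -- the parts of the convolution powers
  obtain ⟨p, hp0, hp⟩ : ∃ p : ℕ → Fin n → Fin n → Bool → Measure ℝ≥0, p 0 = κ ∧
      ∀ m i j b, p (m + 1) i j b =
        ∑ k, (κ i k false ∗ p m k j b + κ i k true ∗ p m k j (!b)) :=
    ⟨fun m => Nat.rec κ
      (fun _ r i j b => ∑ k, (κ i k false ∗ r k j b + κ i k true ∗ r k j (!b))) m,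
      rfl, fun _ _ _ _ => rfl⟩
  have hmass : ∀ m i j b, wmass ω (p m i j b) ≤ ENNReal.ofReal ((1 / 2) ^ m) := by
    intro m
    induction m with
    | zero =>
      intro i j b
      rw [hp0]
      refine (hκ i j b).trans (ENNReal.ofReal_le_ofReal ?_)
      rw [pow_zero, div_le_one (by positivity)]
      have : (0 : ℝ) ≤ n := Nat.cast_nonneg n
      linarith
    | succ m ih =>
      intro i j b
      have hlf : ∀ k b, IsLocallyFiniteMeasure (p m k j b) := fun k b =>
        isLocallyFiniteMeasure_of_wmass hω ((ih k j b).trans_lt ENNReal.ofReal_lt_top)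
      have hn : (0 : ℝ) ≤ n := Nat.cast_nonneg n
      have hε : (0 : ℝ) ≤ 1 / (4 * (n + 1)) := by positivity
      rw [hp, wmass_finsetSum]
      calc ∑ k, wmass ω (κ i k false ∗ p m k j b + κ i k true ∗ p m k j (!b))
          ≤ ∑ _k : Fin n, ENNReal.ofReal (2 * (1 / (4 * (n + 1)) * (1 / 2) ^ m)) := by
            refine Finset.sum_le_sum fun k _ => ?_
            rw [wmass_add, wmass_conv, wmass_conv, two_mul,
              ENNReal.ofReal_add (by positivity) (by positivity), ENNReal.ofReal_mul hε]
            gcongr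
            · exact hκ _ _ _
            · exact ih _ _ _
            · exact hκ _ _ _
            · exact ih _ _ _
        _ = ENNReal.ofReal (n * (2 * (1 / (4 * (n + 1)) * (1 / 2) ^ m))) := by
            rw [Finset.sum_const, Finset.card_univ, Fintype.card_fin, nsmul_eq_mul,
              ENNReal.ofReal_mul hn, ENNReal.ofReal_natCast]
        _ ≤ ENNReal.ofReal ((1 / 2) ^ (m + 1)) := by
            refine ENNReal.ofReal_le_ofReal ?_
            have h1 : (n : ℝ) * (2 * (1 / (4 * (n + 1)))) ≤ 1 / 2 := by
              rw [mul_one_div, mul_div_assoc', div_le_div_iff₀ (by positivity) (by norm_num)]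
              linarith
            rw [pow_succ]
            nlinarith [pow_pos (show (0 : ℝ) < 1 / 2 by norm_num) m]
  have hlf : ∀ m i j b, IsLocallyFiniteMeasure (p m i j b) := fun m i j b =>
    isLocallyFiniteMeasure_of_wmass hω ((hmass m i j b).trans_lt ENNReal.ofReal_lt_top)
  refine ⟨fun i j b => Measure.sum fun m => p m i j b, fun i j b => ?_, fun i j b => ?_⟩
  · rw [wmass_sum]
    refine (ENNReal.tsum_le_tsum fun m => hmass m i j b).trans_lt ?_
    rw [← ENNReal.ofReal_tsum_of_nonneg (fun m => by positivity) summable_geometric_two]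
    exact ENNReal.ofReal_lt_top
  · simp only
    rw [measure_sum_succ, hp0]
    congr 1
    have h1 : ∀ (i k j : Fin n) (b b' : Bool), κ i k b' ∗ Measure.sum (fun m => p m k j b) =
        Measure.sum fun m => κ i k b' ∗ p m k j b := fun i k j b b' =>
      conv_measure_sum (κ i k b') fun m => p m k j b
    simp_rw [h1, Measure.sum_add_sum]
    rw [← measure_sum_finsetSum]
    simp_rw [hp]

namespace cvRing

theorem one_apply_zero_of_continuousAt {a : cvRing} (h : ContinuousAt (fn a) 0) :
    (a.1 LocBdd.one).1 0 = 0 := by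
  rw [← rightLim_fn, ← fn_zero a]
  exact rightLim_eq_of_tendsto (h.mono_left nhdsWithin_le_nhds)

/-- A local signed measure without atom at `0` is the difference of two measures without atom
at `0`. -/
theorem HasWeight.exists_rep_no_atom {ω : ℝ} {a : cvRing} (ha : HasWeight ω a)
    (h0 : (a.1 LocBdd.one).1 0 = 0) :
    ∃ (μ ν : Measure ℝ≥0) (_ : IsLocallyFiniteMeasure μ) (_ : IsLocallyFiniteMeasure ν),
      wmass ω μ < ⊤ ∧ wmass ω ν < ⊤ ∧ a.1 = convOp μ - convOp ν ∧ μ {0} = 0 ∧ ν {0} = 0 := by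
  obtain ⟨μ, ν, _, _, h1, h2, h3⟩ := ha
  have hlf : ∀ (ρ : Measure ℝ≥0) [IsLocallyFiniteMeasure ρ],
      IsLocallyFiniteMeasure (ρ.restrict {0}ᶜ) := fun ρ _ =>
    isLocallyFiniteMeasure_of_Iic fun t =>
      (Measure.restrict_apply_le _ _).trans_lt (measure_Iic_lt_top ρ t)
  have := hlf μ
  have := hlf ν
  have hlf' : ∀ (ρ : Measure ℝ≥0) [IsLocallyFiniteMeasure ρ],
      IsLocallyFiniteMeasure (ρ.restrict {0}) := fun ρ _ =>
    isLocallyFiniteMeasure_of_Iic fun t =>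
      (Measure.restrict_apply_le _ _).trans_lt (measure_Iic_lt_top ρ t)
  have := hlf' μ
  have := hlf' ν
  have hI : Iic (0 : ℝ≥0) = {0} := by
    ext x
    simp
  have h00 : μ {0} = ν {0} := by
    rw [one_apply_of_rep h3, hI, sub_eq_zero, measureReal_def, measureReal_def] at h0
    rwa [ENNReal.toReal_eq_toReal_iff' (hI ▸ (measure_Iic_lt_top μ 0).ne)
      (hI ▸ (measure_Iic_lt_top ν 0).ne)] at h0
  have hr : μ.restrict {0} = ν.restrict {0} := by
    rw [Measure.restrict_singleton, Measure.restrict_singleton, h00]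
  have hs : ∀ (ρ : Measure ℝ≥0), ρ = ρ.restrict {0} + ρ.restrict {0}ᶜ := fun ρ =>
    (Measure.restrict_add_restrict_compl (measurableSet_singleton 0)).symm
  refine ⟨μ.restrict {0}ᶜ, ν.restrict {0}ᶜ, inferInstance, inferInstance,
    (wmass_mono_measure ω Measure.restrict_le_self).trans_lt h1,
    (wmass_mono_measure ω Measure.restrict_le_self).trans_lt h2, ?_, ?_, ?_⟩
  · rw [h3, convOp_congr (hs μ), convOp_congr (hs ν), convOp_add, convOp_add, convOp_congr hr]
    abel
  · rw [Measure.restrict_apply (measurableSet_singleton 0)]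
    simp
  · rw [Measure.restrict_apply (measurableSet_singleton 0)]
    simp

/-- Existence of the resolvent, together with an exponential weight for it. -/
theorem exists_resolvent {n : ℕ} {ω : ℝ} (hω : 0 ≤ ω) (K : Matrix (Fin n) (Fin n) cvRing)
    (hK : ∀ i j, HasWeight ω (K i j)) (hK0 : ∀ i j, ((K i j).1 LocBdd.one).1 0 = 0) :
    ∃ ω', ω ≤ ω' ∧ ∃ R : Matrix (Fin n) (Fin n) cvRing,
      (∀ i j, HasWeight ω' (R i j)) ∧ R = K + K * R := by
  choose μ ν hμ hν hμm hνm hrep hμ0 hν0 using fun i j => (hK i j).exists_rep_no_atom (hK0 i j)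
  have hε : (0 : ENNReal) < ENNReal.ofReal (1 / (4 * (n + 1))) :=
    ENNReal.ofReal_pos.2 (by positivity)
  have hev : ∀ᶠ N : ℕ in atTop, ∀ i j,
      wmass (ω + N) (μ i j) ≤ ENNReal.ofReal (1 / (4 * (n + 1))) ∧
      wmass (ω + N) (ν i j) ≤ ENNReal.ofReal (1 / (4 * (n + 1))) := by
    refine eventually_all.2 fun i => eventually_all.2 fun j => ?_
    exact ((tendsto_wmass_atTop (hμm i j) (hμ0 i j)).eventually_le_const hε).and
      ((tendsto_wmass_atTop (hνm i j) (hν0 i j)).eventually_le_const hε)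
  obtain ⟨N, hN⟩ := hev.exists
  have hω' : 0 ≤ ω + N := by positivity
  obtain ⟨ρ, hρ, hρeq⟩ := exists_neumann hω'
    (fun i j b => if b then ν i j else μ i j) (fun i j b => by
      cases b
      · exact (hN i j).1
      · exact (hN i j).2)
  have hlf : ∀ i j b, IsLocallyFiniteMeasure (ρ i j b) := fun i j b =>
    isLocallyFiniteMeasure_of_wmass hω' (hρ i j b)
  let R : Matrix (Fin n) (Fin n) cvRing := fun i j =>
    ⟨convOp (ρ i j false) - convOp (ρ i j true), _, _, inferInstance, inferInstance, rfl⟩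
  refine ⟨ω + N, le_add_of_nonneg_right (Nat.cast_nonneg N), R, fun i j =>
    ⟨_, _, inferInstance, inferInstance, hρ i j false, hρ i j true, rfl⟩, ?_⟩
  ext1 i j
  apply Subtype.ext
  rw [Matrix.add_apply, Matrix.mul_apply, Subring.coe_add, AddSubmonoidClass.coe_finsetSum]
  simp_rw [Subring.coe_mul, hrep]
  change convOp (ρ i j false) - convOp (ρ i j true) = _
  have e1 : ρ i j false = μ i j + ∑ k, (μ i k ∗ ρ k j false + ν i k ∗ ρ k j true) := by
    simpa using hρeq i j false
  have e2 : ρ i j true = ν i j + ∑ k, (μ i k ∗ ρ k j true + ν i k ∗ ρ k j false) := by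
    simpa using hρeq i j true
  rw [convOp_congr e1, convOp_congr e2]
  simp only [convOp_add, convOp_finsetSum, convOp_conv]
  have : ∀ k, (convOp (μ i k) - convOp (ν i k)) * (R k j).1 =
      (convOp (μ i k) * convOp (ρ k j false) + convOp (ν i k) * convOp (ρ k j true)) -
      (convOp (μ i k) * convOp (ρ k j true) + convOp (ν i k) * convOp (ρ k j false)) := by
    intro k
    change _ * (convOp (ρ k j false) - convOp (ρ k j true)) = _
    noncomm_ring
  simp_rw [this, Finset.sum_sub_distrib]
  abel

section Algebra

variable {n : ℕ} {K R : Matrix (Fin n) (Fin n) cvRing}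

theorem resolvent_right_iff : R = K + K * R ↔ (1 - K) * (1 + R) = 1 := by
  have : (1 - K) * (1 + R) = 1 + R - (K + K * R) := by noncomm_ring
  rw [this, add_sub_assoc, add_eq_left, sub_eq_zero]

theorem resolvent_left_iff : R = K + R * K ↔ (1 + R) * (1 - K) = 1 := by
  have : (1 + R) * (1 - K) = 1 + R - (K + R * K) := by noncomm_ring
  rw [this, add_sub_assoc, add_eq_left, sub_eq_zero]

theorem isResolvent_fn_iff :
    IsResolvent (fun i j => fn (K i j)) (fun i j => fn (R i j)) ↔ (1 - K) * (1 + R) = 1 := by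
  have hent : ∀ A B : Matrix (Fin n) (Fin n) cvRing, R = K + A * B ↔ ∀ i j t,
      fn (R i j) t = fn (K i j) t + ∑ k, stieltjesConv (fn (A i k)) (fn (B k j)) t := by
    intro A B
    simp_rw [stieltjesConv_fn, ← fn_sum, ← fn_add]
    constructor
    · intro h i j t
      rw [congrFun (congrFun h i) j, Matrix.add_apply, Matrix.mul_apply]
    · intro h
      ext1 i j
      refine fn_injective (funext fun t => ?_)
      rw [h, Matrix.add_apply, Matrix.mul_apply]
  constructor
  · intro h
    exact resolvent_right_iff.1 ((hent K R).2 h.eq_right)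
  · intro h
    exact ⟨fun i j => isNBVLoc_fn _, (hent R K).1 (resolvent_left_iff.2 (mul_eq_one_comm.1 h)),
      (hent K R).1 (resolvent_right_iff.2 h)⟩

theorem isResolvent_unique (h : (1 - K) * (1 + R) = 1) {R' : Fin n → Fin n → ℝ≥0 → ℝ}
    (hR' : IsResolvent (fun i j => fn (K i j)) R') : R' = fun i j => fn (R i j) := by
  choose R'' hR'' using fun i j => (hR'.nbv i j).exists_fn_eq
  have e : R' = fun i j => fn (R'' i j) := funext₂ fun i j => (hR'' i j).symm
  subst e
  have h1 := isResolvent_fn_iff.1 hR'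
  have h2 : 1 + Matrix.of R'' = 1 + R := by
    calc 1 + Matrix.of R'' = ((1 + R) * (1 - K)) * (1 + Matrix.of R'') := by
          rw [mul_eq_one_comm.1 h, one_mul]
      _ = 1 + R := by rw [mul_assoc, show (1 - K) * (1 + Matrix.of R'') = 1 from h1, mul_one]
  have h3 := add_left_cancel h2
  funext i j
  rw [← h3]
  rfl

end Algebra

end cvRing

/-! ### Norming dual pairs -/

section DualPair

variable {Y Z : Type*} [NormedAddCommGroup Y] [NormedSpace ℝ Y]
  [NormedAddCommGroup Z] [NormedSpace ℝ Z] {B : Z →ₗ[ℝ] Y →ₗ[ℝ] ℝ}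

namespace IsNormingDualPair

theorem abs_le (hB : IsNormingDualPair B) (z : Z) (y : Y) : |B z y| ≤ ‖z‖ * ‖y‖ := by
  rcases eq_or_ne z 0 with rfl | hz
  · simp
  have hz' : 0 < ‖z‖ := norm_pos_iff.2 hz
  have h := (hB.norm_eq y).1 ⟨‖z‖⁻¹ • z, by
    rw [norm_smul, norm_inv, norm_norm, inv_mul_cancel₀ hz'.ne'], rfl⟩
  rw [map_smul, LinearMap.smul_apply, smul_eq_mul, abs_mul, abs_inv, abs_norm,
    inv_mul_le_iff₀ hz'] at h
  exact h

theorem norm_right_le (hB : IsNormingDualPair B) {y : Y} {c : ℝ} (hc : 0 ≤ c)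
    (h : ∀ z, |B z y| ≤ c * ‖z‖) : ‖y‖ ≤ c := by
  refine (hB.norm_eq y).2 ?_
  rintro _ ⟨z, hz, rfl⟩
  exact (h z).trans (mul_le_of_le_one_right hc hz)

theorem norm_left_le (hB : IsNormingDualPair B) {z : Z} {c : ℝ} (hc : 0 ≤ c)
    (h : ∀ y, |B z y| ≤ c * ‖y‖) : ‖z‖ ≤ c := by
  refine (hB.norm_eq' z).2 ?_
  rintro _ ⟨y, hy, rfl⟩
  exact (h y).trans (mul_le_of_le_one_right hc hy)

theorem ext_right (hB : IsNormingDualPair B) {y y' : Y} (h : ∀ z, B z y = B z y') : y = y' := by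
  rw [← sub_eq_zero, ← norm_le_zero_iff]
  exact hB.norm_right_le le_rfl fun z => by simp [h]

/-- The uniform boundedness principle for pointwise bounded families in the dual space. -/
theorem uniform_bound [CompleteSpace Y] (hB : IsNormingDualPair B) {ι : Type*} (z : ι → Z)
    (h : ∀ y, ∃ C, ∀ i, |B (z i) y| ≤ C) : ∃ C, 0 ≤ C ∧ ∀ i, ‖z i‖ ≤ C := by
  obtain ⟨C, hC⟩ := banach_steinhaus
    (g := fun i => (B (z i)).mkContinuous ‖z i‖ fun y => hB.abs_le _ y) h
  refine ⟨max C 0, le_max_right _ _, fun i => ?_⟩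
  refine hB.norm_left_le (le_max_right _ _) fun y => ?_
  have := ((B (z i)).mkContinuous ‖z i‖ fun y => hB.abs_le _ y).le_of_opNorm_le
    ((hC i).trans (le_max_left C 0)) y
  exact this

/-- A linear functional that is sequentially continuous for `σ(Z, Y)` is represented by an
element of `Y`. -/
theorem exists_right_of_seq (hcont : WeakSeqContinuousImpContinuous B) (φ : Z →ₗ[ℝ] ℝ)
    (h : ∀ (u : ℕ → Z) (z : Z), (∀ y, Tendsto (fun m => B (u m) y) atTop (𝓝 (B z y))) →
      Tendsto (fun m => φ (u m)) atTop (𝓝 (φ z))) : ∃ x, ∀ z, φ z = B z x := by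
  have hφ : SeqContinuous fun z : WeakBilin B => φ z := by
    intro u z hu
    refine h u z fun y => ?_
    exact ((WeakBilin.eval_continuous B y).tendsto z).comp hu
  obtain ⟨x, hx⟩ := LinearMap.dualEmbedding_surjective B
    (⟨φ, hcont φ hφ⟩ : StrongDual ℝ (WeakBilin B))
  exact ⟨x, fun z => (DFunLike.congr_fun hx z).symm⟩

end IsNormingDualPair

/-- A limit of functionals represented in `Z` is represented in `Z`. -/
theorem WeakSeqComplete.exists_left_of_tendsto (hc : WeakSeqComplete B) {φ : ℕ → Y → ℝ}
    {ψ : Y → ℝ} (hφ : ∀ m, ∃ z, ∀ y, φ m y = B z y)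
    (h : ∀ y, Tendsto (fun m => φ m y) atTop (𝓝 (ψ y))) : ∃ z, ∀ y, ψ y = B z y := by
  choose u hu using hφ
  simp_rw [hu] at h
  obtain ⟨z, hz⟩ := hc u fun y => (h y).cauchySeq
  exact ⟨z, fun y => tendsto_nhds_unique (h y) (hz y)⟩

namespace TwinOperator

/-- A bilinear form whose partial functionals are represented in `Y` and in `Z` is a twin operator;
boundedness is automatic by the uniform boundedness principle. -/
theorem exists_of_represented [CompleteSpace Y] (hB : IsNormingDualPair B)
    (form : Z →ₗ[ℝ] Y →ₗ[ℝ] ℝ) (hr : ∀ y, ∃ x, ∀ z, form z y = B z x)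
    (hl : ∀ z, ∃ w, ∀ y, form z y = B w y) : ∃ L : TwinOperator B, L.form = form := by
  refine ⟨⟨form, ?_, fun y => ?_, fun z => ?_⟩, rfl⟩
  · choose w hw using hl
    obtain ⟨C, hC0, hC⟩ := hB.uniform_bound (fun z : {z : Z // ‖z‖ ≤ 1} => w z) fun y => by
      obtain ⟨x, hx⟩ := hr y
      refine ⟨‖x‖, fun z => ?_⟩
      rw [← hw, hx]
      exact (hB.abs_le _ _).trans (mul_le_of_le_one_left (norm_nonneg _) z.2)
    refine ⟨C + 1, by positivity, fun z y => ?_⟩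
    rcases eq_or_ne z 0 with rfl | hz
    · simp
    have hz' : 0 < ‖z‖ := norm_pos_iff.2 hz
    have h1 := (hB.abs_le (w (‖z‖⁻¹ • z)) y).trans (mul_le_mul_of_nonneg_right
      (hC ⟨‖z‖⁻¹ • z, by
        rw [norm_smul, norm_inv, norm_norm, inv_mul_cancel₀ hz'.ne']⟩) (norm_nonneg y))
    rw [← hw, map_smul, LinearMap.smul_apply, smul_eq_mul, abs_mul, abs_inv, abs_norm,
      inv_mul_le_iff₀ hz'] at h1
    nlinarith [mul_nonneg hz'.le (norm_nonneg y)]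
  · obtain ⟨x, hx⟩ := hr y
    exact (WeakBilin.eval_continuous B x).congr fun z => (hx z).symm
  · obtain ⟨w, hw⟩ := hl z
    exact (WeakBilin.eval_continuous B.flip w).congr fun y => (hw y).symm

end TwinOperator

/-! ### Twin semigroups -/

section Semigroup

variable {S : ℝ≥0 → TwinOperator B}

namespace HasGrowthBound

variable {M ω : ℝ}

theorem expBdd (h : HasGrowthBound S M ω) (z : Z) (y : Y) :
    ExpBdd ω fun t => (S t).form z y :=
  ⟨M * ‖y‖ * ‖z‖, fun t => (h.2 t z y).trans_eq (by ring)⟩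

theorem mono (h : HasGrowthBound S M ω) {ω' : ℝ} (hω : ω ≤ ω') : HasGrowthBound S M ω' := by
  refine ⟨h.1, fun t z y => (h.2 t z y).trans ?_⟩
  have h1 := h.1
  have : Real.exp (ω * t) ≤ Real.exp (ω' * t) :=
    Real.exp_le_exp.2 (mul_le_mul_of_nonneg_right hω t.2)
  gcongr

end HasGrowthBound

namespace IsTwinSemigroup

theorem exists_growthBound (hS : IsTwinSemigroup S) : ∃ M ω, HasGrowthBound S M ω := by
  obtain ⟨M, ω, h, -⟩ := hS.laplace
  exact ⟨M, ω, h⟩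

/-- The trajectory `t ↦ z S(t) y`. -/
def orbit (hS : IsTwinSemigroup S) (z : Z) (y : Y) : LocBdd :=
  ⟨fun t => (S t).form z y, hS.measurable z y, fun t => by
    obtain ⟨M, ω, h⟩ := hS.exists_growthBound
    obtain ⟨C, hC⟩ := (h.expBdd z y).mono (le_max_left ω 0)
    have hC0 : 0 ≤ C := by simpa using (abs_nonneg _).trans (hC 0)
    refine ⟨C * Real.exp (max ω 0 * t), fun s hs => (hC s).trans ?_⟩
    refine mul_le_mul_of_nonneg_left (Real.exp_le_exp.2 ?_) hC0
    exact mul_le_mul_of_nonneg_left hs (le_max_right _ _)⟩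

theorem form_add_eq_right (hS : IsTwinSemigroup S) (t s : ℝ≥0) (z : Z) (y : Y) :
    (S (t + s)).form z y = (S t).form z ((S s).onRight y) := by
  rw [hS.map_add, TwinOperator.pairing_onLeft]

theorem form_add_eq_left (hS : IsTwinSemigroup S) (t s : ℝ≥0) (z : Z) (y : Y) :
    (S (t + s)).form z y = (S s).form ((S t).onLeft z) y := by
  rw [hS.map_add, TwinOperator.pairing_onRight]

end IsTwinSemigroup

theorem TwinOperator.norm_onRight_le (hB : IsNormingDualPair B) (L : TwinOperator B) {c : ℝ}
    (hc : 0 ≤ c) {y : Y} (h : ∀ z, |L.form z y| ≤ c * ‖y‖ * ‖z‖) : ‖L.onRight y‖ ≤ c * ‖y‖ :=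
  hB.norm_right_le (mul_nonneg hc (norm_nonneg _)) fun z => by
    rw [L.pairing_onRight]
    exact h z

end Semigroup

end DualPair

/-! ### Further properties of local signed measures -/

namespace cvRing

theorem exists_scalar (c : ℝ) : ∃ a : cvRing, ∀ h, a.1 h = c • h := by
  have key : ∀ r : ℝ≥0, ∃ a : cvRing, ∀ h, a.1 h = (r : ℝ) • h := by
    intro r
    have hlf : IsLocallyFiniteMeasure (r • Measure.dirac (0 : ℝ≥0)) := inferInstance
    refine ⟨⟨convOp (r • Measure.dirac 0) - convOp 0, _, _, hlf, inferInstance, rfl⟩,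
      fun h => ?_⟩
    change (convOp (r • Measure.dirac 0) - convOp 0) h = _
    rw [convOp_zero, sub_zero]
    ext t
    have h1 : (convOp (Measure.dirac 0) h).1 t = h.1 t := by
      rw [convOp_dirac_zero]
      rfl
    rw [convOp_apply, Measure.restrict_smul, integral_smul_nnreal_measure]
    rw [convOp_apply] at h1
    rw [h1]
    rfl
  obtain ⟨a, ha⟩ := key c.toNNReal
  obtain ⟨b, hb⟩ := key (-c).toNNReal
  refine ⟨a - b, fun h => ?_⟩
  rw [AddSubgroupClass.coe_sub, LinearMap.sub_apply, ha, hb]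
  ext t
  change (c.toNNReal : ℝ) * h.1 t - ((-c).toNNReal : ℝ) * h.1 t = c * h.1 t
  rw [← sub_mul]
  congr 1
  rw [Real.coe_toNNReal', Real.coe_toNNReal', max_zero_sub_eq_self]

/-- The scalar `c`, as the local signed measure `c δ₀`. -/
noncomputable def scalar (c : ℝ) : cvRing := (exists_scalar c).choose

theorem cv_scalar_mul (c : ℝ) (a : cvRing) (h : LocBdd) (t : ℝ≥0) :
    cv (scalar c * a) h t = c * cv a h t := by
  unfold cv
  split_ifs
  · simp
  · rw [Subring.coe_mul, Module.End.mul_apply, scalar, (exists_scalar c).choose_spec]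
    rfl

theorem fn_scalar_mul (c : ℝ) (a : cvRing) (t : ℝ≥0) : fn (scalar c * a) t = c * fn a t :=
  cv_scalar_mul c a _ t

/-- The Jordan decomposition of a local signed measure. -/
theorem exists_mutuallySingular_rep (a : cvRing) :
    ∃ (μ ν : Measure ℝ≥0) (_ : IsLocallyFiniteMeasure μ) (_ : IsLocallyFiniteMeasure ν)
      (P : Set ℝ≥0), a.1 = convOp μ - convOp ν ∧ MeasurableSet P ∧ μ Pᶜ = 0 ∧ ν P = 0 := by
  obtain ⟨μ, ν, _, _, h⟩ := exists_rep a
  set ρ := μ + ν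
  set f := μ.rnDeriv ρ
  set g := ν.rnDeriv ρ
  have hf : Measurable f := Measure.measurable_rnDeriv _ _
  have hg : Measurable g := Measure.measurable_rnDeriv _ _
  have hμ : ρ.withDensity f = μ := Measure.withDensity_rnDeriv_eq _ _
    (Measure.absolutelyContinuous_of_le (Measure.le_add_right le_rfl))
  have hν : ρ.withDensity g = ν := Measure.withDensity_rnDeriv_eq _ _
    (Measure.absolutelyContinuous_of_le (Measure.le_add_left le_rfl))
  have hle1 : ρ.withDensity (f - g) ≤ μ := by
    rw [← hμ]
    exact withDensity_mono (Eventually.of_forall fun x => tsub_le_self)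
  have hle2 : ρ.withDensity (g - f) ≤ ν := by
    rw [← hν]
    exact withDensity_mono (Eventually.of_forall fun x => tsub_le_self)
  have l1 : IsLocallyFiniteMeasure (ρ.withDensity (f - g)) :=
    isLocallyFiniteMeasure_of_Iic fun t => (hle1 _).trans_lt (measure_Iic_lt_top μ t)
  have l2 : IsLocallyFiniteMeasure (ρ.withDensity (g - f)) :=
    isLocallyFiniteMeasure_of_Iic fun t => (hle2 _).trans_lt (measure_Iic_lt_top ν t)
  have key : ρ.withDensity (f - g) + ν = ρ.withDensity (g - f) + μ := by
    conv_lhs => rw [← hν]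
    conv_rhs => rw [← hμ]
    rw [← withDensity_add_left (hf.sub hg), ← withDensity_add_left (hg.sub hf)]
    congr 1
    ext x
    simp only [Pi.add_apply, Pi.sub_apply, tsub_add_eq_max, max_comm]
  refine ⟨_, _, l1, l2, {x | g x < f x}, ?_, measurableSet_lt hg hf, ?_, ?_⟩
  · have := convOp_congr key
    rw [convOp_add, convOp_add] at this
    rw [h, sub_eq_sub_iff_add_eq_add, add_comm, ← this, add_comm]
  · rw [withDensity_apply _ (measurableSet_lt hg hf).compl]
    refine setLIntegral_eq_zero (measurableSet_lt hg hf).compl fun x hx => ?_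
    exact tsub_eq_zero_of_le (not_lt.1 hx)
  · rw [withDensity_apply _ (measurableSet_lt hg hf)]
    refine setLIntegral_eq_zero (measurableSet_lt hg hf) fun x hx => ?_
    exact tsub_eq_zero_of_le (le_of_lt hx)

/-- The total variation on `[0,t]` is attained by testing with a function of modulus `1`. -/
theorem exists_cv_eq_variation {a : cvRing} {μ ν : Measure ℝ≥0} [IsLocallyFiniteMeasure μ]
    [IsLocallyFiniteMeasure ν] {P : Set ℝ≥0} (h : a.1 = convOp μ - convOp ν)
    (hP : MeasurableSet P) (hμ : μ Pᶜ = 0) (hν : ν P = 0) {t : ℝ≥0} (ht : 0 < t) :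
    ∃ k : LocBdd, (∀ s, |k.1 s| ≤ 1) ∧ cv a k t = μ.real (Iic t) + ν.real (Iic t) := by
  classical
  have hm : MeasurableSet {s : ℝ≥0 | t - s ∈ P} :=
    (measurable_const.sub measurable_id : Measurable fun s : ℝ≥0 => t - s) hP
  have hb : ∀ s : ℝ≥0, |if t - s ∈ P then (1 : ℝ) else -1| ≤ 1 := by
    intro s
    split_ifs <;> simp
  let k : LocBdd := ⟨fun s => if t - s ∈ P then 1 else -1,
    Measurable.ite hm measurable_const measurable_const, fun _ => ⟨1, fun s _ => hb s⟩⟩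
  refine ⟨k, hb, ?_⟩
  have hk : ∀ τ ∈ Iic t, k.1 (t - τ) = if τ ∈ P then 1 else -1 := by
    intro τ hτ
    simp only [k, tsub_tsub_cancel_of_le (show τ ≤ t from hτ)]
  have e1 : (convOp μ k).1 t = μ.real (Iic t) := by
    rw [convOp_apply, setIntegral_congr_fun measurableSet_Iic hk]
    have : (fun τ => if τ ∈ P then (1 : ℝ) else -1) =ᵐ[μ.restrict (Iic t)] fun _ => 1 := by
      refine ae_restrict_of_ae ?_
      filter_upwards [show ∀ᵐ τ ∂μ, τ ∈ P from hμ] with τ hτ using if_pos hτ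
    rw [integral_congr_ae this]
    simp
  have e2 : (convOp ν k).1 t = -ν.real (Iic t) := by
    rw [convOp_apply, setIntegral_congr_fun measurableSet_Iic hk]
    have : (fun τ => if τ ∈ P then (1 : ℝ) else -1) =ᵐ[ν.restrict (Iic t)] fun _ => -1 := by
      refine ae_restrict_of_ae ?_
      filter_upwards [show ∀ᵐ τ ∂ν, τ ∉ P from measure_eq_zero_iff_ae_notMem.1 hν] with τ hτ
        using if_neg hτ
    rw [integral_congr_ae this]
    simp
  rw [cv_of_pos _ _ ht, h]
  change (convOp μ k).1 t - (convOp ν k).1 t = _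
  rw [e1, e2, sub_neg_eq_add]

theorem abs_cv_le {a : cvRing} {μ ν : Measure ℝ≥0} [IsLocallyFiniteMeasure μ]
    [IsLocallyFiniteMeasure ν] (h : a.1 = convOp μ - convOp ν) {k : LocBdd} {t : ℝ≥0} {C : ℝ}
    (hC : ∀ s ≤ t, |k.1 s| ≤ C) : |cv a k t| ≤ C * (μ.real (Iic t) + ν.real (Iic t)) := by
  have hC0 : 0 ≤ C := (abs_nonneg _).trans (hC 0 zero_le)
  rcases eq_zero_or_pos t with rfl | ht
  · rw [cv_zero, abs_zero]
    positivity
  rw [cv_of_pos _ _ ht, h, mul_add]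
  refine (abs_sub _ _).trans (add_le_add ?_ ?_)
  · exact abs_setIntegral_Iic_le μ fun τ _ => hC _ tsub_le_self
  · exact abs_setIntegral_Iic_le ν fun τ _ => hC _ tsub_le_self

/-- Dominated convergence for `cv`. -/
theorem tendsto_cv (a : cvRing) {k : ℕ → LocBdd} {l : LocBdd} {t : ℝ≥0} {C : ℝ}
    (hC : ∀ m, ∀ s ≤ t, |(k m).1 s| ≤ C)
    (h : ∀ s ≤ t, Tendsto (fun m => (k m).1 s) atTop (𝓝 (l.1 s))) :
    Tendsto (fun m => cv a (k m) t) atTop (𝓝 (cv a l t)) := by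
  rcases eq_zero_or_pos t with rfl | ht
  · simp only [cv_zero]
    exact tendsto_const_nhds
  obtain ⟨μ, ν, _, _, ha⟩ := exists_rep a
  have key : ∀ (ρ : Measure ℝ≥0) [IsLocallyFiniteMeasure ρ],
      Tendsto (fun m => (convOp ρ (k m)).1 t) atTop (𝓝 ((convOp ρ l).1 t)) := by
    intro ρ _
    refine tendsto_integral_of_dominated_convergence (fun _ => C) (fun m => ?_) ?_ ?_ ?_
    · exact ((LocBdd.measurable (k m)).comp
        (measurable_const.sub measurable_id)).aestronglyMeasurable
    · exact integrableOn_const (measure_Iic_lt_top ρ t).ne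
    · exact fun m => ae_restrict_of_forall_mem measurableSet_Iic fun τ _ => hC m _ tsub_le_self
    · exact ae_restrict_of_forall_mem measurableSet_Iic fun τ _ => h _ tsub_le_self
  simp only [cv_of_pos _ _ ht, ha]
  exact (key μ).sub (key ν)

/-- The translate of a locally finite measure: the part on `(s,∞)`, moved to `(0,∞)`. -/
theorem isLocallyFiniteMeasure_shift (μ : Measure ℝ≥0) [IsLocallyFiniteMeasure μ] (s : ℝ≥0) :
    IsLocallyFiniteMeasure ((μ.restrict (Ioi s)).map fun τ => τ - s) :=
  isLocallyFiniteMeasure_of_Iic fun t => by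
    rw [Measure.map_apply (by fun_prop) measurableSet_Iic]
    refine (Measure.restrict_apply_le _ _).trans_lt
      ((measure_mono ?_).trans_lt (measure_Iic_lt_top μ (t + s)))
    intro τ hτ
    exact tsub_le_iff_right.1 (show τ - s ≤ t from hτ)

theorem setIntegral_Iic_shift (μ : Measure ℝ≥0) (s t : ℝ≥0)
    {g : ℝ≥0 → ℝ} (hg : Measurable g) :
    ∫ τ in Iic t, g τ ∂((μ.restrict (Ioi s)).map fun τ => τ - s) =
      ∫ τ in Ioc s (t + s), g (τ - s) ∂μ := by
  rw [setIntegral_map measurableSet_Iic hg.aestronglyMeasurable (by fun_prop),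
    Measure.restrict_restrict (measurableSet_Iic.preimage (by fun_prop))]
  congr 2
  ext τ
  simp only [mem_inter_iff, mem_preimage, mem_Iic, mem_Ioi, mem_Ioc, tsub_le_iff_right,
    and_comm]

end cvRing

/-- The translate `u ↦ h (s + u)`. -/
def LocBdd.translate (s : ℝ≥0) (h : LocBdd) : LocBdd :=
  ⟨fun u => h.1 (s + u), (LocBdd.measurable h).comp (measurable_const_add s), fun t => by
    obtain ⟨C, -, hC⟩ := LocBdd.exists_bound h (s + t)
    exact ⟨C, fun u hu => hC _ (add_le_add_right hu s)⟩⟩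

/-- Splitting a convolution integral over `[0,t+s]` at `s`. -/
theorem convOp_apply_add (μ : Measure ℝ≥0) [IsLocallyFiniteMeasure μ] (h : LocBdd) (t s : ℝ≥0) :
    (convOp μ h).1 (t + s) = (convOp μ (LocBdd.translate t h)).1 s +
      (@convOp _ (cvRing.isLocallyFiniteMeasure_shift μ s) h).1 t := by
  have := cvRing.isLocallyFiniteMeasure_shift μ s
  have hm : Measurable fun τ => h.1 (t - τ) :=
    (LocBdd.measurable h).comp (measurable_const.sub measurable_id)
  have hI : Iic (t + s) = Iic s ∪ Ioc s (t + s) := by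
    rw [Iic_union_Ioc_eq_Iic le_add_self]
  rw [convOp_apply, hI, setIntegral_union (Iic_disjoint_Ioc le_rfl) measurableSet_Ioc
    ((LocBdd.integrableOn_sub μ h (t + s)).mono_set (Iic_subset_Iic.2 le_add_self))
    ((LocBdd.integrableOn_sub μ h (t + s)).mono_set Ioc_subset_Iic_self), convOp_apply,
    convOp_apply, cvRing.setIntegral_Iic_shift μ s t hm]
  congr 1
  · refine setIntegral_congr_fun measurableSet_Iic fun τ hτ => ?_
    simp only [LocBdd.translate]
    rw [add_tsub_assoc_of_le (show τ ≤ s from hτ)]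
  · refine setIntegral_congr_fun measurableSet_Ioc fun τ hτ => ?_
    rw [tsub_tsub_eq_add_tsub_of_le hτ.1.le]

namespace cvRing

/-- The local signed measure of `t ↦ f(t+s) - f(s)`. -/
theorem exists_shift (a : cvRing) (s : ℝ≥0) : ∃ b : cvRing, ∀ (h : LocBdd) (t : ℝ≥0),
    (a.1 h).1 (t + s) = (a.1 (LocBdd.translate t h)).1 s + (b.1 h).1 t := by
  obtain ⟨μ, ν, _, _, ha⟩ := exists_rep a
  have h1 := isLocallyFiniteMeasure_shift μ s
  have h2 := isLocallyFiniteMeasure_shift ν s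
  refine ⟨⟨convOp _ - convOp _, _, _, h1, h2, rfl⟩, fun h t => ?_⟩
  rw [ha]
  change (convOp μ h).1 (t + s) - (convOp ν h).1 (t + s) =
    ((convOp μ _).1 s - (convOp ν _).1 s) + ((convOp _ h).1 t - (convOp _ h).1 t)
  rw [convOp_apply_add, convOp_apply_add]
  ring

end cvRing

/-! ### The local measures of `V₀` -/

section Perturbation

variable {Y Z : Type*} [NormedAddCommGroup Y] [NormedSpace ℝ Y]
  [NormedAddCommGroup Z] [NormedSpace ℝ Z] {B : Z →ₗ[ℝ] Y →ₗ[ℝ] ℝ}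

/-- If the masses of all `[0,s]`, and the total mass, depend on `y` through the pairing with an
element of `Z`, then so do the integrals of all bounded Borel functions. -/
theorem WeakSeqComplete.exists_integral_eq (hc : WeakSeqComplete B) (μ ν : Y → Measure ℝ≥0)
    [∀ y, IsFiniteMeasure (μ y)] [∀ y, IsFiniteMeasure (ν y)]
    (hI : ∀ s, ∃ w, ∀ y, (μ y).real (Iic s) - (ν y).real (Iic s) = B w y)
    (hu : ∃ w, ∀ y, (μ y).real univ - (ν y).real univ = B w y)
    {g : ℝ≥0 → ℝ} (hg : Measurable g) {C : ℝ} (hC : ∀ s, |g s| ≤ C) :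
    ∃ w, ∀ y, (∫ s, g s ∂μ y) - ∫ s, g s ∂ν y = B w y := by
  have hset : ∀ A : Set ℝ≥0, MeasurableSet A →
      ∃ w, ∀ y, (μ y).real A - (ν y).real A = B w y := by
    intro A hA
    induction A, hA using MeasurableSpace.induction_on_inter
      measurableSpace_eq_generateFrom_Iic isPiSystem_Iic with
    | empty => exact ⟨0, by simp⟩
    | basic t ht =>
      obtain ⟨s, rfl⟩ := ht
      exact hI s
    | compl t ht ih =>
      obtain ⟨w, hw⟩ := ih
      obtain ⟨v, hv⟩ := hu
      refine ⟨v - w, fun y => ?_⟩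
      rw [measureReal_compl ht, measureReal_compl ht, map_sub, LinearMap.sub_apply, ← hw, ← hv]
      ring
    | iUnion f hd hf ih =>
      choose w hw using ih
      refine hc.exists_left_of_tendsto
        (φ := fun m y => ∑ i ∈ Finset.range m, ((μ y).real (f i) - (ν y).real (f i)))
        (fun m => ⟨∑ i ∈ Finset.range m, w i, fun y => ?_⟩) fun y => ?_
      · simp [hw]
      · have key : ∀ (ρ : Measure ℝ≥0) [IsFiniteMeasure ρ],
            HasSum (fun i => ρ.real (f i)) (ρ.real (⋃ i, f i)) := by
          intro ρ _
          simp only [measureReal_def]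
          rw [measure_iUnion hd hf, ENNReal.tsum_toReal_eq fun i => (measure_lt_top ρ _).ne]
          refine (ENNReal.summable_toReal ?_).hasSum
          rw [← measure_iUnion hd hf]
          exact (measure_lt_top ρ _).ne
        exact ((key (μ y)).sub (key (ν y))).tendsto_sum_nat
  have hint : ∀ (ρ : Measure ℝ≥0) [IsFiniteMeasure ρ] (f : SimpleFunc ℝ≥0 ℝ), Integrable f ρ :=
    fun ρ _ f => f.integrable_of_isFiniteMeasure
  have hsimple : ∀ f : SimpleFunc ℝ≥0 ℝ,
      ∃ w, ∀ y, (∫ s, f s ∂μ y) - ∫ s, f s ∂ν y = B w y := by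
    intro f
    induction f using SimpleFunc.induction with
    | @const c s hs =>
      obtain ⟨w, hw⟩ := hset s hs
      refine ⟨c • w, fun y => ?_⟩
      rw [map_smul, LinearMap.smul_apply, ← hw]
      have e : ⇑(SimpleFunc.piecewise s hs (SimpleFunc.const ℝ≥0 c) (SimpleFunc.const ℝ≥0 0)) =
          s.indicator fun _ => c := by
        ext x
        simp [indicator, Set.piecewise]
      rw [e, integral_indicator_const _ hs, integral_indicator_const _ hs]
      simp only [smul_eq_mul]
      ring
    | @add f g _ ihf ihg =>
      obtain ⟨w, hw⟩ := ihf
      obtain ⟨v, hv⟩ := ihg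
      refine ⟨w + v, fun y => ?_⟩
      rw [map_add, LinearMap.add_apply, ← hw, ← hv]
      simp only [SimpleFunc.coe_add, Pi.add_apply]
      rw [integral_add (hint _ f) (hint _ g), integral_add (hint _ f) (hint _ g)]
      ring
  have hg' := hg.stronglyMeasurable
  have hC0 : 0 ≤ C := (abs_nonneg _).trans (hC 0)
  refine hc.exists_left_of_tendsto (fun m => hsimple (hg'.approxBounded C m)) fun y => ?_
  have key : ∀ (ρ : Measure ℝ≥0) [IsFiniteMeasure ρ],
      Tendsto (fun m => ∫ s, hg'.approxBounded C m s ∂ρ) atTop (𝓝 (∫ s, g s ∂ρ)) := by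
    intro ρ _
    refine tendsto_integral_of_dominated_convergence (fun _ => C) (fun m => ?_)
      (integrable_const C) (fun m => Eventually.of_forall fun s => ?_)
      (Eventually.of_forall fun s => ?_)
    · exact (SimpleFunc.measurable _).aestronglyMeasurable
    · exact hg'.norm_approxBounded_le hC0 m s
    · exact hg'.tendsto_approxBounded_of_norm_le (hC s)
  exact (key (μ y)).sub (key (ν y))

namespace cvRing

/-- If the distribution functions of a family of local signed measures depend on the parameter
through pairings with elements of `Z`, then so do all convolutions with a fixed function. -/
theorem exists_cv_eq_pairing (hc : WeakSeqComplete B) (a : Y → cvRing)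
    (ha : ∀ t, 0 < t → ∃ w, ∀ y, fn (a y) t = B w y) (h : LocBdd) (t : ℝ≥0) :
    ∃ w, ∀ y, cv (a y) h t = B w y := by
  rcases eq_zero_or_pos t with rfl | ht
  · exact ⟨0, fun y => by simp [cv_zero]⟩
  have ha' : ∀ s, ∃ w, ∀ y, ((a y).1 LocBdd.one).1 s = B w y := by
    intro s
    rcases eq_zero_or_pos s with rfl | hs
    · -- the mass at `0` is a limit of the masses of `[0, 1/(m+1)]`
      refine hc.exists_left_of_tendsto
        (φ := fun m y => fn (a y) (1 / ((m : ℝ≥0) + 1))) (fun m => ha _ (by positivity)) fun y => ?_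
      have h1 := continuousWithinAt_one_apply (a y) 0
      have h2 : Tendsto (fun m : ℕ => 1 / ((m : ℝ≥0) + 1)) atTop (𝓝[≥] 0) :=
        tendsto_nhdsWithin_of_tendsto_nhds_of_eventually_within _
          (tendsto_one_div_add_atTop_nhds_zero_nat (𝕜 := ℝ≥0))
          (Eventually.of_forall fun m => mem_Ici.2 zero_le)
      refine (h1.tendsto.comp h2).congr fun m => ?_
      exact (fn_of_pos (a y) (by positivity)).symm
    · obtain ⟨w, hw⟩ := ha s hs
      exact ⟨w, fun y => by rw [← hw, fn_of_pos _ hs]⟩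
  choose μ ν hμ hν hrep using fun y => exists_rep (a y)
  have f1 : ∀ y, IsFiniteMeasure ((μ y).restrict (Iic t)) := fun y =>
    ⟨by simpa using measure_Iic_lt_top (μ y) t⟩
  have f2 : ∀ y, IsFiniteMeasure ((ν y).restrict (Iic t)) := fun y =>
    ⟨by simpa using measure_Iic_lt_top (ν y) t⟩
  obtain ⟨C, hC0, hC⟩ := LocBdd.exists_bound h t
  obtain ⟨w, hw⟩ := hc.exists_integral_eq (fun y => (μ y).restrict (Iic t))
    (fun y => (ν y).restrict (Iic t))
    (fun s => by
      obtain ⟨w, hw⟩ := ha' (min s t)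
      refine ⟨w, fun y => ?_⟩
      rw [← hw, one_apply_of_rep (hrep y), measureReal_restrict_apply measurableSet_Iic,
        measureReal_restrict_apply measurableSet_Iic, Iic_inter_Iic])
    (by
      obtain ⟨w, hw⟩ := ha' t
      refine ⟨w, fun y => ?_⟩
      rw [← hw, one_apply_of_rep (hrep y), measureReal_restrict_apply MeasurableSet.univ,
        measureReal_restrict_apply MeasurableSet.univ, univ_inter])
    (g := LocBdd.kernel h.1 t) (LocBdd.measurable_kernel (LocBdd.measurable h) t) (C := C)
    (fun s => by
      unfold LocBdd.kernel
      split_ifs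
      · exact hC _ tsub_le_self
      · simpa using hC0)
  refine ⟨w, fun y => ?_⟩
  rw [← hw, cv_of_pos _ _ ht, hrep]
  have e : ∀ τ ∈ Iic t, LocBdd.kernel h.1 t τ = h.1 (t - τ) := fun τ hτ => if_pos hτ
  rw [setIntegral_congr_fun measurableSet_Iic e, setIntegral_congr_fun measurableSet_Iic e]
  rfl

end cvRing

open cvRing

variable {n : ℕ} {S₀ : ℝ≥0 → TwinOperator B} {Q : Fin n → Z} {V₀ : Y → Fin n → cvRing}

theorem pertV₀_measure_add (hV : ∀ y i, fn (V₀ y i) = pertV₀ S₀ Q y i) (y y' : Y) (i : Fin n) :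
    V₀ (y + y') i = V₀ y i + V₀ y' i := by
  refine fn_injective (funext fun t => ?_)
  rw [fn_add, hV, hV, hV]
  simp only [pertV₀, map_add]
  ring

theorem pertV₀_measure_smul (hV : ∀ y i, fn (V₀ y i) = pertV₀ S₀ Q y i) (c : ℝ) (y : Y)
    (i : Fin n) : V₀ (c • y) i = scalar c * V₀ y i := by
  refine fn_injective (funext fun t => ?_)
  rw [fn_scalar_mul, hV, hV]
  simp only [pertV₀, map_smul, smul_eq_mul]
  ring

theorem exists_cv_pertV₀_eq (hc : WeakSeqComplete B)
    (hV : ∀ y i, fn (V₀ y i) = pertV₀ S₀ Q y i) (i : Fin n) (h : LocBdd) (t : ℝ≥0) :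
    ∃ w, ∀ y, cv (V₀ y i) h t = B w y := by
  refine exists_cv_eq_pairing hc (fun y => V₀ y i) (fun s _ => ?_) h t
  refine ⟨(S₀ s).onLeft (Q i) - Q i, fun y => ?_⟩
  rw [hV, map_sub, LinearMap.sub_apply, (S₀ s).pairing_onLeft]
  rfl

/-- By the uniform boundedness principle, the variation of `V₀ y` on `[0,1]` is at most a
multiple of the norm of `y`. -/
theorem exists_variation_bound [CompleteSpace Y] (hB : IsNormingDualPair B)
    (hc : WeakSeqComplete B) (hV : ∀ y i, fn (V₀ y i) = pertV₀ S₀ Q y i) :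
    ∃ c, 0 ≤ c ∧ ∀ (y : Y) (i : Fin n) (μ ν : Measure ℝ≥0) (_ : IsLocallyFiniteMeasure μ)
      (_ : IsLocallyFiniteMeasure ν) (P : Set ℝ≥0), (V₀ y i).1 = convOp μ - convOp ν →
      MeasurableSet P → μ Pᶜ = 0 → ν P = 0 → μ.real (Iic 1) + ν.real (Iic 1) ≤ c * ‖y‖ := by
  choose w hw using fun (p : Fin n × {k : LocBdd // ∀ s, |k.1 s| ≤ 1}) =>
    exists_cv_pertV₀_eq hc hV p.1 p.2.1 1
  obtain ⟨c, hc0, hcw⟩ := hB.uniform_bound w fun y => by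
    choose μ ν h1 h2 hrep using fun i => exists_rep (V₀ y i)
    obtain ⟨D, hD⟩ := Finite.exists_le fun i => (μ i).real (Iic 1) + (ν i).real (Iic 1)
    refine ⟨D, fun p => ?_⟩
    rw [← hw]
    refine (abs_cv_le (hrep p.1) (C := 1) fun s _ => p.2.2 s).trans ?_
    rw [one_mul]
    exact hD p.1
  refine ⟨c, hc0, fun y i μ ν _ _ P hrep hP hμ hν => ?_⟩
  obtain ⟨k, hk, hkv⟩ := exists_cv_eq_variation hrep hP hμ hν one_pos
  rw [← hkv, hw (i, ⟨k, hk⟩) y]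
  exact (le_abs_self _).trans ((hB.abs_le _ _).trans
    (mul_le_mul_of_nonneg_right (hcw _) (norm_nonneg y)))

/-- Exponentially growing variation on unit intervals gives finite weighted mass. -/
theorem wmass_lt_top_of_unit_intervals {ω ω' : ℝ} (hω' : 0 ≤ ω') (h : ω < ω') {μ : Measure ℝ≥0}
    [IsLocallyFiniteMeasure μ] {C : ℝ}
    (hμ : ∀ N : ℕ, μ.real (Ioc ((N : ℝ≥0) + 1) (N + 2)) ≤ C * Real.exp (ω * (N + 1))) :
    wmass ω' μ < ⊤ := by
  have hfin : ∀ s t : ℝ≥0, μ (Ioc s t) ≠ ⊤ := fun s t =>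
    ((measure_mono Ioc_subset_Iic_self).trans_lt (measure_Iic_lt_top μ t)).ne
  have hC : 0 ≤ C := by
    have := measureReal_nonneg.trans (hμ 0)
    exact nonneg_of_mul_nonneg_left this (Real.exp_pos _)
  have hcover : (univ : Set ℝ≥0) ⊆ Iic 1 ∪ ⋃ N : ℕ, Ioc ((N : ℝ≥0) + 1) (N + 2) := by
    intro t _
    by_cases ht : t ≤ 1
    · exact Or.inl ht
    · right
      rw [not_le] at ht
      obtain ⟨m, hm⟩ : ∃ m : ℕ, ⌈t⌉₊ = m + 2 := by
        have : 1 < ⌈t⌉₊ := by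
          rw [Nat.lt_ceil]
          simpa using ht
        exact ⟨⌈t⌉₊ - 2, by omega⟩
      refine mem_iUnion.2 ⟨m, ?_, ?_⟩
      · have : m + 1 < ⌈t⌉₊ := by omega
        rw [Nat.lt_ceil] at this
        exact_mod_cast this
      · have := Nat.le_ceil t
        rw [hm] at this
        exact_mod_cast this
  have hpiece : ∀ N : ℕ, ∫⁻ τ in Ioc ((N : ℝ≥0) + 1) (N + 2),
      ENNReal.ofReal (Real.exp (-ω' * τ)) ∂μ ≤
        ENNReal.ofReal (C * (Real.exp (-(ω' - ω))) ^ (N + 1)) := by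
    intro N
    calc ∫⁻ τ in Ioc ((N : ℝ≥0) + 1) (N + 2), ENNReal.ofReal (Real.exp (-ω' * τ)) ∂μ
        ≤ ∫⁻ _ in Ioc ((N : ℝ≥0) + 1) (N + 2),
            ENNReal.ofReal (Real.exp (-ω' * (N + 1))) ∂μ := by
          refine setLIntegral_mono' measurableSet_Ioc fun τ hτ =>
            ENNReal.ofReal_le_ofReal (Real.exp_le_exp.2 ?_)
          have : ((N : ℝ) + 1) ≤ τ := by exact_mod_cast hτ.1.le
          nlinarith
      _ = ENNReal.ofReal (Real.exp (-ω' * (N + 1)) *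
            μ.real (Ioc ((N : ℝ≥0) + 1) (N + 2))) := by
          rw [setLIntegral_const, ENNReal.ofReal_mul (Real.exp_pos _).le, measureReal_def,
            ENNReal.ofReal_toReal (hfin _ _)]
      _ ≤ _ := by
          refine ENNReal.ofReal_le_ofReal ?_
          refine (mul_le_mul_of_nonneg_left (hμ N) (Real.exp_pos _).le).trans_eq ?_
          rw [mul_left_comm, ← Real.exp_add, ← Real.exp_nat_mul]
          congr 2
          push_cast
          ring
  have hr1 : Real.exp (-(ω' - ω)) < 1 := Real.exp_lt_one_iff.mpr (by linarith)
  have hsum : Summable fun N : ℕ => C * (Real.exp (-(ω' - ω))) ^ (N + 1) :=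
    ((summable_nat_add_iff 1).2
      (summable_geometric_of_lt_one (Real.exp_pos _).le hr1)).mul_left C
  calc wmass ω' μ = ∫⁻ τ in univ, ENNReal.ofReal (Real.exp (-ω' * τ)) ∂μ := by
        rw [Measure.restrict_univ]
        rfl
    _ ≤ ∫⁻ τ in Iic 1 ∪ ⋃ N : ℕ, Ioc ((N : ℝ≥0) + 1) (N + 2),
          ENNReal.ofReal (Real.exp (-ω' * τ)) ∂μ := lintegral_mono_set hcover
    _ ≤ (∫⁻ τ in Iic 1, ENNReal.ofReal (Real.exp (-ω' * τ)) ∂μ) +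
          ∫⁻ τ in ⋃ N : ℕ, Ioc ((N : ℝ≥0) + 1) (N + 2),
          ENNReal.ofReal (Real.exp (-ω' * τ)) ∂μ := lintegral_union_le _ _ _
    _ ≤ μ (Iic 1) + ∑' N : ℕ, ENNReal.ofReal (C * (Real.exp (-(ω' - ω))) ^ (N + 1)) := by
        refine add_le_add ?_ ((lintegral_iUnion_le _ _).trans (ENNReal.tsum_le_tsum hpiece))
        calc ∫⁻ τ in Iic 1, ENNReal.ofReal (Real.exp (-ω' * τ)) ∂μ
            ≤ ∫⁻ _ in Iic 1, 1 ∂μ := by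
              refine lintegral_mono fun τ => ?_
              rw [← ENNReal.ofReal_one]
              refine ENNReal.ofReal_le_ofReal (Real.exp_le_one_iff.2 ?_)
              have : (0 : ℝ) ≤ τ := τ.2
              nlinarith
          _ = μ (Iic 1) := by simp
    _ < ⊤ := by
        rw [← ENNReal.ofReal_tsum_of_nonneg (fun N => by positivity) hsum]
        exact ENNReal.add_lt_top.2 ⟨measure_Iic_lt_top μ 1, ENNReal.ofReal_lt_top⟩

/-- The variation of `V₀ y` grows at most exponentially, since
`V₀(t+s)y - V₀(s)y = V₀(t)S₀(s)y`. -/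
theorem hasWeight_pertV₀ [CompleteSpace Y] (hB : IsNormingDualPair B) (hc : WeakSeqComplete B)
    (hS₀ : IsTwinSemigroup S₀) (hV : ∀ y i, fn (V₀ y i) = pertV₀ S₀ Q y i) {M ω ω' : ℝ}
    (hg : HasGrowthBound S₀ M ω) (hω' : 0 ≤ ω') (h : ω < ω') (y : Y) (i : Fin n) :
    HasWeight ω' (V₀ y i) := by
  obtain ⟨c, hc0, hcv⟩ := exists_variation_bound hB hc hV
  obtain ⟨μ, ν, _, _, P, hrep, hP, hμ, hν⟩ := exists_mutuallySingular_rep (V₀ y i)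
  have hM : 0 ≤ M := zero_le_one.trans hg.1
  -- the variation over `(N+1, N+2]`
  have key : ∀ N : ℕ, μ.real (Ioc ((N : ℝ≥0) + 1) (N + 2)) +
      ν.real (Ioc ((N : ℝ≥0) + 1) (N + 2)) ≤ c * M * ‖y‖ * Real.exp (ω * (N + 1)) := by
    intro N
    set s : ℝ≥0 := (N : ℝ≥0) + 1 with hs
    have hs0 : 0 < s := by positivity
    have l1 := isLocallyFiniteMeasure_shift μ s
    have l2 := isLocallyFiniteMeasure_shift ν s
    set x := (S₀ s).onRight y with hx
    have hmreal : ∀ (ρ : Measure ℝ≥0) [IsLocallyFiniteMeasure ρ] (t : ℝ≥0),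
        ((ρ.restrict (Ioi s)).map fun τ => τ - s).real (Iic t) = ρ.real (Ioc s (t + s)) := by
      intro ρ _ t
      have := setIntegral_Iic_shift ρ s t (g := fun _ => 1) measurable_const
      simpa using this
    have hdiff : ∀ (ρ : Measure ℝ≥0) [IsLocallyFiniteMeasure ρ] (t : ℝ≥0),
        ρ.real (Ioc s (t + s)) = ρ.real (Iic (t + s)) - ρ.real (Iic s) := by
      intro ρ _ t
      rw [← Iic_sdiff_Iic, measureReal_sdiff (show Iic s ⊆ Iic (t + s) from
        Iic_subset_Iic.2 le_add_self) measurableSet_Iic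
        (measure_Iic_lt_top ρ _).ne]
    have hshift : (V₀ x i).1 = convOp ((μ.restrict (Ioi s)).map fun τ => τ - s) -
        convOp ((ν.restrict (Ioi s)).map fun τ => τ - s) := by
      let b : cvRing := ⟨convOp ((μ.restrict (Ioi s)).map fun τ => τ - s) -
        convOp ((ν.restrict (Ioi s)).map fun τ => τ - s), _, _, l1, l2, rfl⟩
      suffices V₀ x i = b by rw [this]
      refine fn_injective (funext fun t => ?_)
      rcases eq_zero_or_pos t with rfl | ht
      · rw [fn_zero, fn_zero]
      have e1 : ∀ t, 0 < t → μ.real (Iic t) - ν.real (Iic t) = pertV₀ S₀ Q y i t := by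
        intro t ht
        rw [← hV, fn_of_pos _ ht, one_apply_of_rep hrep]
      rw [fn_of_pos b ht, one_apply_of_rep (a := b) rfl, hmreal, hmreal, hdiff, hdiff, hV]
      have e2 := e1 (t + s) (by positivity)
      have e3 := e1 s hs0
      have e4 : pertV₀ S₀ Q x i t = pertV₀ S₀ Q y i (t + s) - pertV₀ S₀ Q y i s := by
        unfold pertV₀
        rw [hS₀.form_add_eq_right, hx, (S₀ s).pairing_onRight]
        ring
      rw [e4, ← e2, ← e3]
      ring
    have hpre : MeasurableSet {t : ℝ≥0 | t + s ∈ P} := (measurable_add_const s) hP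
    have hcomp : ∀ τ ∈ Ioi s, τ - s + s = τ := fun τ hτ => tsub_add_cancel_of_le (le_of_lt hτ)
    have hb := hcv x i _ _ l1 l2 {t | t + s ∈ P} hshift hpre
      (by
        rw [Measure.map_apply (by fun_prop) hpre.compl,
          Measure.restrict_apply (hpre.compl.preimage (by fun_prop))]
        refine measure_mono_null ?_ hμ
        rintro τ ⟨h1, h2⟩
        simpa [hcomp τ h2] using h1)
      (by
        rw [Measure.map_apply (by fun_prop) hpre,
          Measure.restrict_apply (hpre.preimage (by fun_prop))]
        refine measure_mono_null ?_ hν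
        rintro τ ⟨h1, h2⟩
        simpa [hcomp τ h2] using h1)
    rw [hmreal, hmreal] at hb
    have e5 : (1 : ℝ≥0) + s = N + 2 := by rw [hs]; ring
    rw [e5] at hb
    have hxn : ‖x‖ ≤ M * Real.exp (ω * s) * ‖y‖ :=
      TwinOperator.norm_onRight_le hB _ (by positivity) (hg.2 s · y)
    have e6 : (s : ℝ) = N + 1 := by rw [hs]; push_cast; ring
    rw [e6] at hxn
    calc _ ≤ c * ‖x‖ := hb
      _ ≤ c * (M * Real.exp (ω * (N + 1)) * ‖y‖) := mul_le_mul_of_nonneg_left hxn hc0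
      _ = _ := by ring
  exact ⟨μ, ν, inferInstance, inferInstance,
    wmass_lt_top_of_unit_intervals hω' h fun N =>
      (le_add_of_nonneg_right measureReal_nonneg).trans (key N),
    wmass_lt_top_of_unit_intervals hω' h fun N =>
      (le_add_of_nonneg_left measureReal_nonneg).trans (key N), hrep⟩

end Perturbation

/-! ### The perturbed operators -/

theorem cvRing.measurable_cv (a : cvRing) (h : LocBdd) : Measurable (cvRing.cv a h) :=
  Measurable.ite (measurableSet_singleton 0) measurable_const (LocBdd.measurable _)

theorem LocBdd.translate_one (s : ℝ≥0) : LocBdd.translate s LocBdd.one = LocBdd.one := rfl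

section PerturbedSemigroup

open cvRing

variable {Y Z : Type*} {n : ℕ} {q : Fin n → Y} {V₀ : Y → Fin n → cvRing}
  {R : Matrix (Fin n) (Fin n) cvRing}

/-- The local signed measure of `V y = V₀ y + R ⋆ V₀ y`. -/
noncomputable def pertMeasure (R : Matrix (Fin n) (Fin n) cvRing) (V₀ : Y → Fin n → cvRing)
    (y : Y) (i : Fin n) : cvRing :=
  V₀ y i + ∑ j, R i j * V₀ y j

theorem pertMeasure_eq_mulVec (y : Y) : pertMeasure R V₀ y = (1 + R).mulVec (V₀ y) := by
  rw [Matrix.add_mulVec, Matrix.one_mulVec]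
  rfl

theorem hasWeight_pertMeasure {ω : ℝ} (hR : ∀ i j, HasWeight ω (R i j))
    (hV : ∀ y i, HasWeight ω (V₀ y i)) (y : Y) (i : Fin n) :
    HasWeight ω (pertMeasure R V₀ y i) :=
  (hV y i).add (HasWeight.sum fun j => (hR i j).mul (hV y j))

/-- `V₀ y` is recovered from `V y` as `V y - K ⋆ V y`, where `K_ij = V₀ q_j i`. -/
theorem eq_pertMeasure_sub (hR : (1 - Matrix.of fun i j => V₀ (q j) i) * (1 + R) = 1) (y : Y)
    (i : Fin n) :
    V₀ y i = pertMeasure R V₀ y i - ∑ j, V₀ (q j) i * pertMeasure R V₀ y j := by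
  have : V₀ y = (1 - Matrix.of fun i j => V₀ (q j) i).mulVec (pertMeasure R V₀ y) := by
    rw [pertMeasure_eq_mulVec, Matrix.mulVec_mulVec, hR, Matrix.one_mulVec]
  conv_lhs => rw [this, Matrix.sub_mulVec, Matrix.one_mulVec]
  rfl

theorem eq_pertMeasure_of_eq_sub (hR : (1 - Matrix.of fun i j => V₀ (q j) i) * (1 + R) = 1)
    {y : Y} {W : Fin n → cvRing} (hW : ∀ i, V₀ y i = W i - ∑ j, V₀ (q j) i * W j) :
    W = pertMeasure R V₀ y := by
  have h : V₀ y = (1 - Matrix.of fun i j => V₀ (q j) i).mulVec W := by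
    rw [Matrix.sub_mulVec, Matrix.one_mulVec]
    exact funext hW
  rw [pertMeasure_eq_mulVec, h, Matrix.mulVec_mulVec, mul_eq_one_comm.1 hR, Matrix.one_mulVec]

variable [NormedAddCommGroup Y] [NormedSpace ℝ Y]
  [NormedAddCommGroup Z] [NormedSpace ℝ Z] {B : Z →ₗ[ℝ] Y →ₗ[ℝ] ℝ}
  {S₀ S : ℝ≥0 → TwinOperator B} {Q : Fin n → Z}

theorem fn_pertMeasure (hV : ∀ y i, fn (V₀ y i) = pertV₀ S₀ Q y i) (y : Y) (i : Fin n) :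
    fn (pertMeasure R V₀ y i) = pertV S₀ Q (fun i j => fn (R i j)) y i := by
  ext t
  rw [pertMeasure, fn_add, fn_sum, pertV, hV]
  simp_rw [← stieltjesConv_fn, hV]

theorem pertMeasure_add (hV : ∀ y i, fn (V₀ y i) = pertV₀ S₀ Q y i) (y y' : Y) (i : Fin n) :
    pertMeasure R V₀ (y + y') i = pertMeasure R V₀ y i + pertMeasure R V₀ y' i := by
  simp only [pertMeasure, pertV₀_measure_add hV, mul_add, Finset.sum_add_distrib]
  ring

theorem pertMeasure_smul (hV : ∀ y i, fn (V₀ y i) = pertV₀ S₀ Q y i) (c : ℝ) (y : Y)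
    (i : Fin n) : pertMeasure R V₀ (c • y) i = scalar c * pertMeasure R V₀ y i := by
  simp only [pertMeasure, pertV₀_measure_smul hV, mul_add, Finset.mul_sum]
  congr 1
  exact Finset.sum_congr rfl fun j _ => mul_left_comm _ _ _

theorem exists_cv_pertMeasure_eq (hc : WeakSeqComplete B)
    (hV : ∀ y i, fn (V₀ y i) = pertV₀ S₀ Q y i) (i : Fin n) (h : LocBdd) (t : ℝ≥0) :
    ∃ w, ∀ y, cv (pertMeasure R V₀ y i) h t = B w y := by
  obtain ⟨w, hw⟩ := exists_cv_pertV₀_eq hc hV i h t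
  choose v hv using fun j => exists_cv_pertV₀_eq hc hV j ((R i j).1 h) t
  refine ⟨w + ∑ j, v j, fun y => ?_⟩
  rw [pertMeasure, cv_add, cv_sum, hw, map_add, LinearMap.add_apply, map_sum,
    LinearMap.sum_apply]
  congr 1
  exact Finset.sum_congr rfl fun j _ => by rw [mul_comm, cv_mul, hv]

namespace IsTwinSemigroup

theorem orbit_add_left (hS₀ : IsTwinSemigroup S₀) (z z' : Z) (y : Y) :
    hS₀.orbit (z + z') y = hS₀.orbit z y + hS₀.orbit z' y := by
  ext t
  simp [orbit]

theorem orbit_smul_left (hS₀ : IsTwinSemigroup S₀) (c : ℝ) (z : Z) (y : Y) :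
    hS₀.orbit (c • z) y = c • hS₀.orbit z y := by
  ext t
  simp [orbit]

theorem orbit_onLeft (hS₀ : IsTwinSemigroup S₀) (s : ℝ≥0) (z : Z) (y : Y) :
    hS₀.orbit ((S₀ s).onLeft z) y = LocBdd.translate s (hS₀.orbit z y) := by
  ext t
  exact (hS₀.form_add_eq_left s t z y).symm

end IsTwinSemigroup

theorem HasGrowthBound.abs_le_of_le {M ω : ℝ} (h : HasGrowthBound S₀ M ω) {s t : ℝ≥0}
    (hs : s ≤ t) (z : Z) (y : Y) :
    |(S₀ s).form z y| ≤ M * Real.exp (|ω| * t) * ‖y‖ * ‖z‖ := by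
  refine (h.2 s z y).trans ?_
  have hM : 0 ≤ M := zero_le_one.trans h.1
  have h1 : ω * s ≤ |ω| * t := by
    have h2 : (s : ℝ) ≤ t := hs
    have h3 : (0 : ℝ) ≤ s := s.2
    nlinarith [le_abs_self ω, abs_nonneg ω]
  gcongr

/-- The operators `S(t)` given by the variation-of-constants formula are twin operators. By
assumption on the pair, weak continuity in `z` may be checked along sequences. -/
theorem exists_perturbed_operators [CompleteSpace Y] (hB : IsNormingDualPair B)
    (hc : WeakSeqComplete B) (hcont : WeakSeqContinuousImpContinuous B)
    (hS₀ : IsTwinSemigroup S₀) (hV : ∀ y i, fn (V₀ y i) = pertV₀ S₀ Q y i)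
    (R : Matrix (Fin n) (Fin n) cvRing) (q : Fin n → Y) :
    ∃ S : ℝ≥0 → TwinOperator B, ∀ t z y, (S t).form z y = (S₀ t).form z y +
      ∑ j, cv (pertMeasure R V₀ y j) (hS₀.orbit z (q j)) t := by
  have key : ∀ t : ℝ≥0, ∃ L : TwinOperator B, ∀ z y, L.form z y = (S₀ t).form z y +
      ∑ j, cv (pertMeasure R V₀ y j) (hS₀.orbit z (q j)) t := by
    intro t
    let form : Z →ₗ[ℝ] Y →ₗ[ℝ] ℝ := LinearMap.mk₂ ℝ
      (fun z y => (S₀ t).form z y + ∑ j, cv (pertMeasure R V₀ y j) (hS₀.orbit z (q j)) t)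
      (fun z z' y => by
        simp only [hS₀.orbit_add_left, cv_add_right, Finset.sum_add_distrib, map_add,
          LinearMap.add_apply]
        ring)
      (fun c z y => by
        simp only [hS₀.orbit_smul_left, cv_smul_right, ← Finset.mul_sum, map_smul,
          LinearMap.smul_apply, smul_eq_mul]
        ring)
      (fun z y y' => by
        simp only [pertMeasure_add hV, cv_add, Finset.sum_add_distrib, map_add]
        ring)
      (fun c z y => by
        simp only [pertMeasure_smul hV, cv_scalar_mul, ← Finset.mul_sum, map_smul, smul_eq_mul]
        ring)
    suffices h : ∃ L : TwinOperator B, L.form = form by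
      obtain ⟨L, hL⟩ := h
      exact ⟨L, fun z y => by rw [hL]; rfl⟩
    refine TwinOperator.exists_of_represented hB form (fun y => ?_) (fun z => ?_)
    · refine IsNormingDualPair.exists_right_of_seq hcont (form.flip y) fun u z hu => ?_
      obtain ⟨M, ω, hg⟩ := hS₀.exists_growthBound
      have hM : 0 ≤ M := zero_le_one.trans hg.1
      -- weakly convergent sequences are bounded
      obtain ⟨C, hC0, hC⟩ := hB.uniform_bound u fun y => by
        obtain ⟨D, hD⟩ := (Metric.isBounded_range_of_tendsto _ (hu y)).exists_norm_le
        exact ⟨D, fun i => hD _ (mem_range_self i)⟩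
      have hform : ∀ s y, Tendsto (fun m => (S₀ s).form (u m) y) atTop
          (𝓝 ((S₀ s).form z y)) := by
        intro s y
        simp only [← TwinOperator.pairing_onRight]
        exact hu _
      refine (hform t y).add (tendsto_finsetSum _ fun j _ => ?_)
      refine tendsto_cv _ (C := M * Real.exp (|ω| * t) * ‖q j‖ * C) (fun m s hs => ?_)
        fun s _ => hform s (q j)
      refine (hg.abs_le_of_le hs _ _).trans ?_
      gcongr
      exact hC m
    · choose w hw using fun j =>
        exists_cv_pertMeasure_eq (R := R) hc hV j (hS₀.orbit z (q j)) t
      refine ⟨(S₀ t).onLeft z + ∑ j, w j, fun y => ?_⟩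
      rw [map_add, LinearMap.add_apply, map_sum, LinearMap.sum_apply,
        TwinOperator.pairing_onLeft]
      simp_rw [← hw]
      rfl
  choose S hS using key
  exact ⟨S, hS⟩

/-! ### The semigroup property and the growth bound -/

theorem perturbed_zero (hS₀ : IsTwinSemigroup S₀)
    (hS : ∀ t z y, (S t).form z y = (S₀ t).form z y +
      ∑ j, cv (pertMeasure R V₀ y j) (hS₀.orbit z (q j)) t)
    (z : Z) (y : Y) : (S 0).form z y = B z y := by
  rw [hS, hS₀.map_zero]
  simp [cv_zero]

theorem perturbed_measurable (hS₀ : IsTwinSemigroup S₀)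
    (hS : ∀ t z y, (S t).form z y = (S₀ t).form z y +
      ∑ j, cv (pertMeasure R V₀ y j) (hS₀.orbit z (q j)) t)
    (z : Z) (y : Y) : Measurable fun t => (S t).form z y := by
  simp_rw [hS]
  exact (hS₀.measurable z y).add (Finset.measurable_sum _ fun j _ => measurable_cv _ _)

/-- The increments of `V y` after time `s` are those of `V (S(s) y)`: both solve the renewal
equation `W = V₀ (S(s) y) + K ⋆ W`. -/
theorem perturbed_shift (hS₀ : IsTwinSemigroup S₀)
    (hS : ∀ t z y, (S t).form z y = (S₀ t).form z y +
      ∑ j, cv (pertMeasure R V₀ y j) (hS₀.orbit z (q j)) t)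
    (hV : ∀ y i, fn (V₀ y i) = pertV₀ S₀ Q y i)
    (hK0 : ∀ i j, ((V₀ (q j) i).1 LocBdd.one).1 0 = 0)
    (hR : (1 - Matrix.of fun i j => V₀ (q j) i) * (1 + R) = 1)
    {s : ℝ≥0} (hs : 0 < s) (y : Y) (h : LocBdd) (t : ℝ≥0) (j : Fin n) :
    ((pertMeasure R V₀ y j).1 h).1 (t + s) =
      ((pertMeasure R V₀ y j).1 (LocBdd.translate t h)).1 s +
      ((pertMeasure R V₀ ((S s).onRight y) j).1 h).1 t := by
  set V := pertMeasure R V₀ y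
  set x := (S s).onRight y with hx
  choose W hW using fun j => exists_shift (V j) s
  suffices hWV : W = pertMeasure R V₀ x by rw [hW j, hWV]
  refine eq_pertMeasure_of_eq_sub hR fun i => fn_injective (funext fun u => ?_)
  rcases eq_zero_or_pos u with rfl | hu
  · rw [fn_zero, fn_zero]
  have hus : 0 < u + s := by positivity
  -- the kernel as an element of `LocBdd`
  have hk : ∀ j, (V₀ (q j) i).1 LocBdd.one =
      hS₀.orbit (Q i) (q j) - B (Q i) (q j) • LocBdd.one := by
    intro j
    ext r
    change _ = (S₀ r).form (Q i) (q j) - B (Q i) (q j) * 1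
    rcases eq_zero_or_pos r with rfl | hr
    · rw [hK0, hS₀.map_zero]
      ring
    · rw [← fn_of_pos _ hr, hV, mul_one]
      rfl
  have hx1 : ∀ z, B z x = (S s).form z y := fun z => (S s).pairing_onRight z y
  have hcvk : ∀ (a : cvRing) (j : Fin n), (a.1 ((V₀ (q j) i).1 LocBdd.one)).1 s =
      (a.1 (hS₀.orbit (Q i) (q j))).1 s - B (Q i) (q j) * (a.1 LocBdd.one).1 s := by
    intro a j
    rw [hk, map_sub, map_smul]
    rfl
  have hcvk' : ∀ (a : cvRing) (j : Fin n),
      (a.1 (LocBdd.translate u ((V₀ (q j) i).1 LocBdd.one))).1 s =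
      (a.1 (LocBdd.translate u (hS₀.orbit (Q i) (q j)))).1 s -
        B (Q i) (q j) * (a.1 LocBdd.one).1 s := by
    intro a j
    have : LocBdd.translate u ((V₀ (q j) i).1 LocBdd.one) =
        LocBdd.translate u (hS₀.orbit (Q i) (q j)) - B (Q i) (q j) • LocBdd.one := by
      rw [hk]
      rfl
    rw [this, map_sub, map_smul]
    rfl
  -- the renewal equation for `V y` at the times `s` and `u + s`
  have hren : ∀ r, 0 < r → pertV₀ S₀ Q y i r =
      ((V i).1 LocBdd.one).1 r - ∑ j, ((V j).1 ((V₀ (q j) i).1 LocBdd.one)).1 r := by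
    intro r hr
    rw [← hV, eq_pertMeasure_sub hR y i, fn_sub, fn_sum, fn_of_pos _ hr]
    congr 1
    exact Finset.sum_congr rfl fun j _ => by
      rw [mul_comm, fn_of_pos _ hr]
      rfl
  have hlhs : fn (V₀ x i) u = pertV₀ S₀ Q y i (u + s) - pertV₀ S₀ Q y i s +
      ∑ j, ((V j).1 (LocBdd.translate u (hS₀.orbit (Q i) (q j)))).1 s -
      ∑ j, ((V j).1 (hS₀.orbit (Q i) (q j))).1 s := by
    rw [hV]
    unfold pertV₀
    rw [← (S₀ u).pairing_onLeft, hx1, hx1, hS, hS, ← hS₀.form_add_eq_left]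
    simp_rw [hS₀.orbit_onLeft, cv_of_pos _ _ hs]
    ring
  have hrhs : ∀ j, fn (V₀ (q j) i * W j) u =
      ((V j).1 ((V₀ (q j) i).1 LocBdd.one)).1 (u + s) -
      ((V j).1 (LocBdd.translate u (hS₀.orbit (Q i) (q j)))).1 s +
        B (Q i) (q j) * ((V j).1 LocBdd.one).1 s := by
    intro j
    rw [mul_comm, fn_of_pos _ hu, hW, hcvk']
    change ((W j).1 ((V₀ (q j) i).1 LocBdd.one)).1 u = _
    ring
  have hWi : fn (W i) u = ((V i).1 LocBdd.one).1 (u + s) - ((V i).1 LocBdd.one).1 s := by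
    rw [fn_of_pos _ hu, hW, LocBdd.translate_one]
    ring
  rw [hlhs, fn_sub, fn_sum, hWi, hren _ hus, hren _ hs]
  simp_rw [hrhs, hcvk, Finset.sum_add_distrib, Finset.sum_sub_distrib]
  ring

theorem perturbed_add (hS₀ : IsTwinSemigroup S₀)
    (hS : ∀ t z y, (S t).form z y = (S₀ t).form z y +
      ∑ j, cv (pertMeasure R V₀ y j) (hS₀.orbit z (q j)) t)
    (hB : IsNormingDualPair B) (hV : ∀ y i, fn (V₀ y i) = pertV₀ S₀ Q y i)
    (hK0 : ∀ i j, ((V₀ (q j) i).1 LocBdd.one).1 0 = 0)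
    (hR : (1 - Matrix.of fun i j => V₀ (q j) i) * (1 + R) = 1) (t s : ℝ≥0) (z : Z) (y : Y) :
    (S (t + s)).form z y = B ((S t).onLeft z) ((S s).onRight y) := by
  rw [TwinOperator.pairing_onLeft]
  rcases eq_zero_or_pos s with rfl | hs
  · have : (S 0).onRight y = y := hB.ext_right fun z => by
      rw [TwinOperator.pairing_onRight, perturbed_zero hS₀ hS]
    rw [this, add_zero]
  rcases eq_zero_or_pos t with rfl | ht
  · rw [perturbed_zero hS₀ hS, TwinOperator.pairing_onRight, zero_add]
  have hts : 0 < t + s := by positivity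
  have hx1 : (S₀ t).form z ((S s).onRight y) = (S₀ (t + s)).form z y +
      ∑ j, ((pertMeasure R V₀ y j).1 (LocBdd.translate t (hS₀.orbit z (q j)))).1 s := by
    rw [← (S₀ t).pairing_onLeft, (S s).pairing_onRight, hS, ← hS₀.form_add_eq_left]
    simp_rw [hS₀.orbit_onLeft, cv_of_pos _ _ hs]
  rw [hS, hS, hx1, add_assoc, ← Finset.sum_add_distrib]
  congr 1
  refine Finset.sum_congr rfl fun j _ => ?_
  rw [cv_of_pos _ _ hts, cv_of_pos _ _ ht]
  exact perturbed_shift hS₀ hS hV hK0 hR hs y _ t j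

/-- By the uniform boundedness principle, the operators `S(t)` with `t ≤ 1` are uniformly
bounded. -/
theorem perturbed_bound_unit_interval (hS₀ : IsTwinSemigroup S₀)
    (hS : ∀ t z y, (S t).form z y = (S₀ t).form z y +
      ∑ j, cv (pertMeasure R V₀ y j) (hS₀.orbit z (q j)) t)
    [CompleteSpace Y] (hB : IsNormingDualPair B) :
    ∃ C, 1 ≤ C ∧ ∀ t ≤ 1, ∀ z y, |(S t).form z y| ≤ C * ‖z‖ * ‖y‖ := by
  obtain ⟨M, ω, hg⟩ := hS₀.exists_growthBound
  have hM : 0 ≤ M := zero_le_one.trans hg.1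
  obtain ⟨C, hC0, hC⟩ := hB.uniform_bound
    (fun p : {p : ℝ≥0 × Z // p.1 ≤ 1 ∧ ‖p.2‖ ≤ 1} => (S p.1.1).onLeft p.1.2) fun y => by
      choose μ ν h1 h2 hrep using fun j => exists_rep (pertMeasure R V₀ y j)
      refine ⟨M * Real.exp (|ω| * (1 : ℝ≥0)) * ‖y‖ * 1 + ∑ j,
        M * Real.exp (|ω| * (1 : ℝ≥0)) * ‖q j‖ * 1 * ((μ j).real (Iic 1) + (ν j).real (Iic 1)),
        fun p => ?_⟩
      obtain ⟨⟨t, z⟩, ht, hz⟩ := p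
      dsimp only at ht hz ⊢
      rw [TwinOperator.pairing_onLeft, hS]
      refine (abs_add_le _ _).trans (add_le_add ?_ ?_)
      · refine (hg.abs_le_of_le ht z y).trans ?_
        gcongr
      · refine (Finset.abs_sum_le_sum_abs _ _).trans (Finset.sum_le_sum fun j _ => ?_)
        refine (abs_cv_le (hrep j) (C := M * Real.exp (|ω| * (1 : ℝ≥0)) * ‖q j‖ * 1)
          fun s hs => ?_).trans ?_
        · refine (hg.abs_le_of_le (hs.trans ht) z (q j)).trans ?_
          gcongr
        · have := (measure_Iic_lt_top (μ j) 1).ne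
          have := (measure_Iic_lt_top (ν j) 1).ne
          gcongr
  refine ⟨max C 1, le_max_right _ _, fun t ht z y => ?_⟩
  rcases eq_or_ne z 0 with rfl | hz
  · simp
  have hz' : 0 < ‖z‖ := norm_pos_iff.2 hz
  have h1 := (hB.abs_le ((S t).onLeft (‖z‖⁻¹ • z)) y).trans (mul_le_mul_of_nonneg_right
    (hC ⟨(t, ‖z‖⁻¹ • z), ht, by
      dsimp only
      rw [norm_smul, norm_inv, norm_norm, inv_mul_cancel₀ hz'.ne']⟩) (norm_nonneg y))
  rw [TwinOperator.pairing_onLeft, map_smul, LinearMap.smul_apply, smul_eq_mul, abs_mul, abs_inv,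
    abs_norm, inv_mul_le_iff₀ hz'] at h1
  have h2 : C * (‖z‖ * ‖y‖) ≤ max C 1 * (‖z‖ * ‖y‖) :=
    mul_le_mul_of_nonneg_right (le_max_left _ _) (by positivity)
  linarith

/-- A semigroup of twin operators that is bounded on `[0,1]` is exponentially bounded. -/
theorem exists_hasGrowthBound (hB : IsNormingDualPair B)
    (hadd : ∀ t s z y, (S (t + s)).form z y = B ((S t).onLeft z) ((S s).onRight y))
    {C : ℝ} (hC1 : 1 ≤ C) (hC : ∀ t ≤ 1, ∀ z y, |(S t).form z y| ≤ C * ‖z‖ * ‖y‖) :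
    ∃ M ω, HasGrowthBound S M ω := by
  have hC0 : 0 < C := zero_lt_one.trans_le hC1
  have key : ∀ N : ℕ, ∀ t : ℝ≥0, t ≤ N + 1 → ∀ z y,
      |(S t).form z y| ≤ C ^ (N + 1) * ‖z‖ * ‖y‖ := by
    intro N
    induction N with
    | zero =>
      intro t ht z y
      rw [zero_add, pow_one]
      exact hC t (by simpa using ht) z y
    | succ N ih =>
      intro t ht z y
      have hle : t - 1 ≤ N + 1 := by
        rw [tsub_le_iff_right]
        refine ht.trans_eq ?_
        push_cast
        ring
      rcases le_total t 1 with h1 | h1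
      · refine (hC t h1 z y).trans ?_
        gcongr
        exact le_self_pow₀ hC1 (by omega)
      · have e : t = (t - 1) + 1 := (tsub_add_cancel_of_le h1).symm
        rw [e, hadd, TwinOperator.pairing_onLeft]
        have hn : ‖(S 1).onRight y‖ ≤ C * ‖y‖ :=
          TwinOperator.norm_onRight_le hB _ hC0.le fun z =>
            (hC 1 le_rfl z y).trans_eq (by ring)
        calc _ ≤ C ^ (N + 1) * ‖z‖ * ‖(S 1).onRight y‖ := ih _ hle z _
          _ ≤ C ^ (N + 1) * ‖z‖ * (C * ‖y‖) := by gcongr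
          _ = _ := by ring
  refine ⟨C, Real.log C, hC1, fun t z y => ?_⟩
  refine (key ⌊t⌋₊ t (Nat.lt_floor_add_one t).le z y).trans ?_
  have h1 : C ^ (⌊t⌋₊ + 1) ≤ C * Real.exp (Real.log C * t) := by
    rw [pow_succ']
    refine mul_le_mul_of_nonneg_left ?_ hC0.le
    rw [← Real.rpow_natCast, Real.rpow_def_of_pos hC0]
    refine Real.exp_le_exp.2 (mul_le_mul_of_nonneg_left ?_ (Real.log_nonneg hC1))
    exact_mod_cast Nat.floor_le (zero_le : 0 ≤ t)
  calc _ ≤ C * Real.exp (Real.log C * t) * ‖z‖ * ‖y‖ := by gcongr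
    _ = _ := by ring

end PerturbedSemigroup

/-! ### Laplace–Stieltjes transforms -/

namespace cvRing

/-- The Laplace–Stieltjes transform `∫ e^{-λτ} a(dτ)` of a local signed measure, as `λ` times the
Laplace transform of its distribution function. -/
noncomputable def lst (lam : ℂ) (a : cvRing) : ℂ := lam * lapl lam (fn a)

theorem measurable_fn (a : cvRing) : Measurable (fn a) := measurable_cv a _

theorem HasWeight.expBdd_fn {ω : ℝ} (hω : 0 ≤ ω) {a : cvRing} (ha : HasWeight ω a) :
    ExpBdd ω (fn a) := by
  obtain ⟨C, hC⟩ := ha.expBdd (expBdd_one hω)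
  refine ⟨C, fun t => ?_⟩
  rcases eq_zero_or_pos t with rfl | ht
  · rw [fn_zero, abs_zero]
    exact (abs_nonneg _).trans (hC 0)
  · rw [fn_of_pos _ ht]
    exact hC t

theorem lapl_one_apply (lam : ℂ) (a : cvRing) : lapl lam (a.1 LocBdd.one).1 = lapl lam (fn a) :=
  lapl_congr fun _ ht => (fn_of_pos a ht).symm

theorem lst_add {ω : ℝ} (hω : 0 ≤ ω) {lam : ℂ} (hlam : ω < lam.re)
    {a b : cvRing} (ha : HasWeight ω a) (hb : HasWeight ω b) :
    lst lam (a + b) = lst lam a + lst lam b := by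
  have : fn (a + b) = fun t => fn a t + fn b t := funext fun t => fn_add a b t
  rw [lst, this, lapl_add hlam (measurable_fn a) (measurable_fn b) (ha.expBdd_fn hω)
    (hb.expBdd_fn hω), mul_add]
  rfl

theorem lst_sum {ω : ℝ} (hω : 0 ≤ ω) {lam : ℂ} (hlam : ω < lam.re)
    {ι : Type*} (s : Finset ι) {a : ι → cvRing}
    (ha : ∀ i, HasWeight ω (a i)) : lst lam (∑ i ∈ s, a i) = ∑ i ∈ s, lst lam (a i) := by
  have : fn (∑ i ∈ s, a i) = fun t => ∑ i ∈ s, fn (a i) t := funext fun t => fn_sum s a t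
  rw [lst, this, lapl_sum s hlam (fun i => measurable_fn (a i)) fun i => (ha i).expBdd_fn hω,
    Finset.mul_sum]
  rfl

theorem lst_mul {ω : ℝ} (hω : 0 ≤ ω) {lam : ℂ} (hlam : ω < lam.re)
    {a b : cvRing} (ha : HasWeight ω a) (hb : HasWeight ω b) :
    lst lam (a * b) = lst lam a * lst lam b := by
  have : fn (a * b) = cv a (b.1 LocBdd.one) := rfl
  rw [lst, this, lapl_cv hω hlam ha (hb.expBdd (expBdd_one hω)), lapl_one_apply, lst, lst]
  ring

end cvRing

/-! ### Twin operators on the complexified pair -/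

section TwinForms

variable {Y Z : Type*} [NormedAddCommGroup Y] [NormedSpace ℝ Y]
  [NormedAddCommGroup Z] [NormedSpace ℝ Z] {B : Z →ₗ[ℝ] Y →ₗ[ℝ] ℝ}

namespace TwinOperator

variable [CompleteSpace Y]

theorem exists_add (hB : IsNormingDualPair B) (L L' : TwinOperator B) :
    ∃ P : TwinOperator B, ∀ z y, P.form z y = L.form z y + L'.form z y := by
  obtain ⟨P, hP⟩ := exists_of_represented hB (L.form + L'.form)
    (fun y => ⟨L.onRight y + L'.onRight y, fun z => by
      simp [pairing_onRight]⟩)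
    (fun z => ⟨L.onLeft z + L'.onLeft z, fun y => by
      simp [pairing_onLeft]⟩)
  exact ⟨P, fun z y => by rw [hP]; rfl⟩

theorem exists_smul (hB : IsNormingDualPair B) (c : ℝ) (L : TwinOperator B) :
    ∃ P : TwinOperator B, ∀ z y, P.form z y = c * L.form z y := by
  obtain ⟨P, hP⟩ := exists_of_represented hB (c • L.form)
    (fun y => ⟨c • L.onRight y, fun z => by
      simp [pairing_onRight]⟩)
    (fun z => ⟨c • L.onLeft z, fun y => by
      simp [pairing_onLeft]⟩)
  exact ⟨P, fun z y => by rw [hP]; rfl⟩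

theorem exists_rankOne (hB : IsNormingDualPair B) (x : Y) (w : Z) :
    ∃ P : TwinOperator B, ∀ z y, P.form z y = B z x * B w y := by
  obtain ⟨P, hP⟩ := exists_of_represented hB
    (LinearMap.mk₂ ℝ (fun z y => B z x * B w y) (fun z z' y => by simp [add_mul])
      (fun c z y => by simp [mul_assoc]) (fun z y y' => by simp [mul_add])
      (fun c z y => by simp [mul_left_comm]))
    (fun y => ⟨B w y • x, fun z => by simp [mul_comm]⟩)
    (fun z => ⟨B z x • w, fun y => by simp⟩)
  exact ⟨P, fun z y => by rw [hP]; rfl⟩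

end TwinOperator

/-- The function `F` of two variables is the form of a twin operator on the complexified pair,
given on the real subspaces: its real and imaginary part are forms of twin operators. -/
def IsTwinForm (B : Z →ₗ[ℝ] Y →ₗ[ℝ] ℝ) (F : Z → Y → ℂ) : Prop :=
  ∃ P P' : TwinOperator B, ∀ z y, (P.form z y : ℂ) + (P'.form z y : ℂ) * Complex.I = F z y

namespace IsTwinForm

variable [CompleteSpace Y] {F G : Z → Y → ℂ}

theorem pairing (hB : IsNormingDualPair B) : IsTwinForm B fun z y => (B z y : ℂ) := by
  obtain ⟨P, hP⟩ := TwinOperator.exists_of_represented hB B (fun y => ⟨y, fun _ => rfl⟩)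
    fun z => ⟨z, fun _ => rfl⟩
  obtain ⟨P', hP'⟩ := TwinOperator.exists_rankOne hB 0 0
  exact ⟨P, P', fun z y => by simp [hP, hP']⟩

theorem zero (hB : IsNormingDualPair B) : IsTwinForm B fun _ _ => 0 := by
  obtain ⟨P, hP⟩ := TwinOperator.exists_rankOne hB 0 0
  exact ⟨P, P, fun z y => by simp [hP]⟩

theorem add (hB : IsNormingDualPair B) (hF : IsTwinForm B F) (hG : IsTwinForm B G) :
    IsTwinForm B fun z y => F z y + G z y := by
  obtain ⟨P, P', hP⟩ := hF
  obtain ⟨L, L', hL⟩ := hG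
  obtain ⟨A, hA⟩ := TwinOperator.exists_add hB P L
  obtain ⟨A', hA'⟩ := TwinOperator.exists_add hB P' L'
  refine ⟨A, A', fun z y => ?_⟩
  dsimp only
  rw [← hP, ← hL, hA, hA']
  push_cast
  ring

theorem sum (hB : IsNormingDualPair B) {ι : Type*} {s : Finset ι} {F : ι → Z → Y → ℂ}
    (hF : ∀ i, IsTwinForm B (F i)) : IsTwinForm B fun z y => ∑ i ∈ s, F i z y := by
  classical
  induction s using Finset.induction_on with
  | empty => simpa using zero hB
  | insert i s hi ih =>
    simp only [Finset.sum_insert hi]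
    exact (hF i).add hB ih

theorem const_mul (hB : IsNormingDualPair B) (c : ℂ) (hF : IsTwinForm B F) :
    IsTwinForm B fun z y => c * F z y := by
  obtain ⟨P, P', hP⟩ := hF
  obtain ⟨A₁, h1⟩ := TwinOperator.exists_smul hB c.re P
  obtain ⟨A₂, h2⟩ := TwinOperator.exists_smul hB (-c.im) P'
  obtain ⟨A₃, h3⟩ := TwinOperator.exists_smul hB c.im P
  obtain ⟨A₄, h4⟩ := TwinOperator.exists_smul hB c.re P'
  obtain ⟨A, hA⟩ := TwinOperator.exists_add hB A₁ A₂
  obtain ⟨A', hA'⟩ := TwinOperator.exists_add hB A₃ A₄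
  refine ⟨A, A', fun z y => ?_⟩
  dsimp only
  rw [← hP, hA, hA', h1, h2, h3, h4]
  apply Complex.ext
  · simp [sub_eq_add_neg]
  · simp
    ring

/-- The product of a functional `z ↦ F z x` and a functional `y ↦ G w y`. -/
theorem mul (hB : IsNormingDualPair B) (hF : IsTwinForm B F) (hG : IsTwinForm B G) (x : Y)
    (w : Z) : IsTwinForm B fun z y => F z x * G w y := by
  obtain ⟨P, P', hP⟩ := hF
  obtain ⟨L, L', hL⟩ := hG
  have key : ∀ A A' : TwinOperator B, ∃ T : TwinOperator B, ∀ z y,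
      T.form z y = A.form z x * A'.form w y := by
    intro A A'
    obtain ⟨T, hT⟩ := TwinOperator.exists_rankOne hB (A.onRight x) (A'.onLeft w)
    exact ⟨T, fun z y => by rw [hT, A.pairing_onRight, A'.pairing_onLeft]⟩
  obtain ⟨A₁, h1⟩ := key P L
  obtain ⟨A₂, h2⟩ := key P' L'
  obtain ⟨A₃, h3⟩ := key P L'
  obtain ⟨A₄, h4⟩ := key P' L
  obtain ⟨A₅, h5⟩ := TwinOperator.exists_smul hB (-1) A₂
  obtain ⟨A, hA⟩ := TwinOperator.exists_add hB A₁ A₅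
  obtain ⟨A', hA'⟩ := TwinOperator.exists_add hB A₃ A₄
  refine ⟨A, A', fun z y => ?_⟩
  dsimp only
  rw [← hP, ← hL, hA, hA', h5, h1, h2, h3, h4]
  apply Complex.ext
  · simp [sub_eq_add_neg]
  · simp

end IsTwinForm

end TwinForms

/-! ### The Laplace transform of the perturbed semigroup -/

section PerturbedLaplace

open cvRing

variable {Y Z : Type*} {n : ℕ} {V₀ : Y → Fin n → cvRing} {R : Matrix (Fin n) (Fin n) cvRing}
  {M ω : ℝ} {lam : ℂ}

theorem lst_pertMeasure (hω : 0 ≤ ω) (hlam : ω < lam.re) (hR : ∀ i j, HasWeight ω (R i j))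
    (hV₀ : ∀ y i, HasWeight ω (V₀ y i)) (y : Y) (i : Fin n) :
    lst lam (pertMeasure R V₀ y i) =
      lst lam (V₀ y i) + ∑ j, lst lam (R i j) * lst lam (V₀ y j) := by
  rw [pertMeasure, lst_add hω hlam (hV₀ y i) (HasWeight.sum fun j => (hR i j).mul (hV₀ y j)),
    lst_sum hω hlam _ fun j => (hR i j).mul (hV₀ y j)]
  simp_rw [fun j => lst_mul hω hlam (hR i j) (hV₀ y j)]

variable [NormedAddCommGroup Y] [NormedSpace ℝ Y]
  [NormedAddCommGroup Z] [NormedSpace ℝ Z] {B : Z →ₗ[ℝ] Y →ₗ[ℝ] ℝ}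
  {S₀ S : ℝ≥0 → TwinOperator B} {q : Fin n → Y} {Q : Fin n → Z}

theorem lst_pertV₀ (hS₀ : IsTwinSemigroup S₀) (hV : ∀ y i, fn (V₀ y i) = pertV₀ S₀ Q y i)
    (hg : HasGrowthBound S₀ M ω) (hω : 0 ≤ ω) (hlam : ω < lam.re) (y : Y) (i : Fin n) :
    lst lam (V₀ y i) = lam * lapl lam (fun t => (S₀ t).form (Q i) y) - B (Q i) y := by
  have h0 : lam ≠ 0 := by
    rintro rfl
    exact absurd hlam (by simpa using hω)
  have hc : ExpBdd ω fun _ => B (Q i) y := ⟨|B (Q i) y|, fun t =>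
    le_mul_of_one_le_right (abs_nonneg _) (Real.one_le_exp (mul_nonneg hω t.2))⟩
  rw [lst, hV]
  unfold pertV₀
  rw [lapl_sub hlam (hS₀.measurable _ _) measurable_const (hg.expBdd _ _) hc,
    lapl_const (hω.trans_lt hlam), mul_sub, mul_div_cancel₀ _ h0]

theorem lapl_perturbed (hS₀ : IsTwinSemigroup S₀)
    (hS : ∀ t z y, (S t).form z y = (S₀ t).form z y +
      ∑ j, cv (pertMeasure R V₀ y j) (hS₀.orbit z (q j)) t)
    (hg : HasGrowthBound S₀ M ω) (hω : 0 ≤ ω) (hlam : ω < lam.re)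
    (hR : ∀ i j, HasWeight ω (R i j)) (hV₀ : ∀ y i, HasWeight ω (V₀ y i)) (z : Z) (y : Y) :
    lapl lam (fun t => (S t).form z y) = lapl lam (fun t => (S₀ t).form z y) +
      ∑ j, lapl lam (fun t => (S₀ t).form z (q j)) * lst lam (pertMeasure R V₀ y j) := by
  have hw := fun j => hasWeight_pertMeasure hR hV₀ y j
  have hb : ∀ j, ExpBdd ω (hS₀.orbit z (q j)).1 := fun j => hg.expBdd z (q j)
  have hcv : ∀ j, ExpBdd ω (cv (pertMeasure R V₀ y j) (hS₀.orbit z (q j))) := by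
    intro j
    obtain ⟨C, hC⟩ := (hw j).expBdd (hb j)
    refine ⟨C, fun t => ?_⟩
    rcases eq_zero_or_pos t with rfl | ht
    · rw [cv_zero, abs_zero]
      exact (abs_nonneg _).trans (hC 0)
    · rw [cv_of_pos _ _ ht]
      exact hC t
  have hsum : ExpBdd ω fun t => ∑ j, cv (pertMeasure R V₀ y j) (hS₀.orbit z (q j)) t := by
    choose C hC using hcv
    refine ⟨∑ j, C j, fun t => ?_⟩
    rw [Finset.sum_mul]
    exact (Finset.abs_sum_le_sum_abs _ _).trans (Finset.sum_le_sum fun j _ => hC j t)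
  simp_rw [hS]
  rw [lapl_add hlam (hS₀.measurable z y)
    (Finset.measurable_sum _ fun j _ => measurable_cv _ _) (hg.expBdd z y) hsum,
    lapl_sum _ hlam (fun j => measurable_cv _ _) hcv]
  congr 1
  refine Finset.sum_congr rfl fun j _ => ?_
  rw [lapl_cv hω hlam (hw j) (hb j), mul_comm]
  rfl

/-- The Laplace transform of the perturbed semigroup is a twin operator: it is a combination of
the Laplace transform of `S₀` and operators of rank one. -/
theorem isTwinForm_lapl_perturbed [CompleteSpace Y] (hB : IsNormingDualPair B)
    (hS₀ : IsTwinSemigroup S₀)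
    (hS : ∀ t z y, (S t).form z y = (S₀ t).form z y +
      ∑ j, cv (pertMeasure R V₀ y j) (hS₀.orbit z (q j)) t)
    (hV : ∀ y i, fn (V₀ y i) = pertV₀ S₀ Q y i)
    (hg : HasGrowthBound S₀ M ω) (hω : 0 ≤ ω) (hlam : ω < lam.re)
    (hR : ∀ i j, HasWeight ω (R i j)) (hV₀ : ∀ y i, HasWeight ω (V₀ y i))
    (hL : IsTwinForm B fun z y => lapl lam fun t => (S₀ t).form z y) :
    IsTwinForm B fun z y => lapl lam fun t => (S t).form z y := by
  have h1 : ∀ j k, IsTwinForm B fun z y =>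
      lapl lam (fun t => (S₀ t).form z (q j)) * lst lam (V₀ y k) := by
    intro j k
    have h2 := ((hL.mul hB hL (q j) (Q k)).const_mul hB lam).add hB
      ((hL.mul hB (IsTwinForm.pairing hB) (q j) (Q k)).const_mul hB (-1))
    convert h2 using 3 with z y
    rw [lst_pertV₀ hS₀ hV hg hω hlam]
    ring
  have h3 := hL.add hB (IsTwinForm.sum hB (s := Finset.univ) fun j =>
    (h1 j j).add hB (IsTwinForm.sum hB (s := Finset.univ) fun k =>
      (h1 j k).const_mul hB (lst lam (R j k))))
  convert h3 using 3 with z y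
  rw [lapl_perturbed hS₀ hS hg hω hlam hR hV₀]
  congr 1
  refine Finset.sum_congr rfl fun j _ => ?_
  rw [lst_pertMeasure hω hlam hR hV₀, mul_add, Finset.mul_sum]
  congr 1
  exact Finset.sum_congr rfl fun k _ => mul_left_comm _ _ _

end PerturbedLaplace

/-! ### The resolvent identity and the generator -/

/-- The Laplace transform at a real `λ`, as a real number. -/
noncomputable def rlapl (lam : ℝ) (f : ℝ≥0 → ℝ) : ℝ :=
  ∫ t in Ioi (0 : ℝ), Real.exp (-lam * t) * f t.toNNReal

theorem lapl_ofReal (lam : ℝ) (f : ℝ≥0 → ℝ) : lapl lam f = (rlapl lam f : ℂ) := by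
  rw [lapl, rlapl, ← integral_complex_ofReal]
  congr 1
  ext t
  push_cast
  rfl

theorem integrableOn_exp_neg_mul {c : ℝ} (hc : 0 < c) :
    IntegrableOn (fun t : ℝ => Real.exp (-c * t)) (Ioi 0) := exp_neg_integrableOn_Ioi 0 hc

theorem ExpBdd.integrableOn_rlapl {ω : ℝ} {f : ℝ≥0 → ℝ} (hf : ExpBdd ω f) (hm : Measurable f)
    {lam : ℝ} (hlam : ω < lam) :
    IntegrableOn (fun t : ℝ => Real.exp (-lam * t) * f t.toNNReal) (Ioi 0) := by
  have h := (hf.integrableOn_lapl hm (lam := lam) (by simpa using hlam)).re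
  refine h.congr (Eventually.of_forall fun t => ?_)
  have : Complex.exp (-(lam : ℂ) * t) * ((f t.toNNReal : ℝ) : ℂ) =
      ((Real.exp (-lam * t) * f t.toNNReal : ℝ) : ℂ) := by
    push_cast
    rfl
  simp only [this]
  rfl

theorem ExpBdd.abs_exp_mul_le {ω : ℝ} {f : ℝ≥0 → ℝ} {C : ℝ}
    (hC : ∀ t : ℝ≥0, |f t| ≤ C * Real.exp (ω * t)) (lam : ℝ) {t : ℝ} (ht : 0 ≤ t) :
    |Real.exp (-lam * t) * f t.toNNReal| ≤ C * Real.exp (-(lam - ω) * t) := by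
  rw [abs_mul, Real.abs_exp]
  have h := hC t.toNNReal
  rw [Real.coe_toNNReal t ht] at h
  refine (mul_le_mul_of_nonneg_left h (Real.exp_pos _).le).trans_eq ?_
  rw [mul_left_comm, ← Real.exp_add]
  ring_nf

/-- The two Laplace transforms of `f(t+s)` commute. -/
theorem rlapl_translate_comm {ω lam mu : ℝ} (hlam : ω < lam) (hmu : ω < mu) {f : ℝ≥0 → ℝ}
    (hf : ExpBdd ω f) (hm : Measurable f) :
    rlapl mu (fun t => rlapl lam fun s => f (t + s)) =
      rlapl lam (fun t => rlapl mu fun s => f (t + s)) := by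
  obtain ⟨C, hC⟩ := hf
  set F : ℝ → ℝ → ℝ := fun t s =>
    Real.exp (-mu * t) * (Real.exp (-lam * s) * f (t.toNNReal + s.toNNReal)) with hF
  have hFm : Measurable (Function.uncurry F) := by
    have h1 : Measurable fun p : ℝ × ℝ => f (p.1.toNNReal + p.2.toNNReal) :=
      hm.comp (by fun_prop)
    have h2 : Measurable fun p : ℝ × ℝ => Real.exp (-mu * p.1) := by fun_prop
    have h3 : Measurable fun p : ℝ × ℝ => Real.exp (-lam * p.2) := by fun_prop
    exact h2.mul (h3.mul h1)
  have hint : Integrable (Function.uncurry F)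
      ((volume.restrict (Ioi 0)).prod (volume.restrict (Ioi 0))) := by
    refine (((integrableOn_exp_neg_mul (sub_pos.2 hmu)).mul_prod
      (integrableOn_exp_neg_mul (sub_pos.2 hlam))).const_mul C).mono'
      hFm.aestronglyMeasurable ?_
    rw [Measure.prod_restrict]
    refine ae_restrict_of_forall_mem (measurableSet_Ioi.prod measurableSet_Ioi) ?_
    rintro ⟨t, s⟩ ⟨ht, hs⟩
    simp only [Function.uncurry, hF, norm_mul, Real.norm_eq_abs, Real.abs_exp]
    have h := hC (t.toNNReal + s.toNNReal)
    rw [NNReal.coe_add, Real.coe_toNNReal t (le_of_lt ht), Real.coe_toNNReal s (le_of_lt hs)] at h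
    calc _ ≤ Real.exp (-mu * t) * (Real.exp (-lam * s) * (C * Real.exp (ω * (t + s)))) := by
          gcongr
      _ = C * (Real.exp (-mu * t + (-lam * s + ω * (t + s)))) := by
          rw [Real.exp_add, Real.exp_add]
          ring
      _ = _ := by
          rw [← Real.exp_add]
          ring_nf
  calc _ = ∫ t in Ioi (0 : ℝ), ∫ s in Ioi (0 : ℝ), F t s := by
        simp only [rlapl, hF, integral_const_mul]
    _ = ∫ s in Ioi (0 : ℝ), ∫ t in Ioi (0 : ℝ), F t s := integral_integral_swap hint
    _ = _ := by
        simp only [rlapl, hF, ← integral_const_mul]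
        congr 1
        ext s
        congr 1
        ext t
        rw [add_comm s.toNNReal]
        ring

theorem integral_Ioc_exp_neg_mul (c : ℝ) {r : ℝ} (hr : 0 ≤ r) :
    c * ∫ t in Ioc 0 r, Real.exp (-c * t) = 1 - Real.exp (-c * r) := by
  rw [← intervalIntegral.integral_of_le hr, ← intervalIntegral.integral_const_mul,
    intervalIntegral.integral_eq_sub_of_hasDerivAt (f := fun t => -Real.exp (-c * t))
      (fun t _ => ?_) (by apply Continuous.intervalIntegrable; fun_prop)]
  · simp
    ring
  · have := ((hasDerivAt_id t).const_mul (-c)).exp.fun_neg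
    simpa [mul_comm] using this

/-- The resolvent identity, for the trajectory `f` of a semigroup and `λ < μ`. -/
theorem sub_mul_rlapl_translate_of_lt {ω lam mu : ℝ} (hlam : ω < lam) (hmu : lam < mu)
    {f : ℝ≥0 → ℝ} (hf : ExpBdd ω f) (hm : Measurable f) :
    (mu - lam) * rlapl mu (fun t => rlapl lam fun s => f (t + s)) =
      rlapl lam f - rlapl mu f := by
  obtain ⟨C, hC⟩ := id hf
  set G : ℝ → ℝ → ℝ := fun t r => if t ≤ r then
    Real.exp (-(mu - lam) * t) * (Real.exp (-lam * r) * f r.toNNReal) else 0 with hG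
  have hGm : Measurable (Function.uncurry G) := by
    have h1 : Measurable fun p : ℝ × ℝ => f p.2.toNNReal := hm.comp (by fun_prop)
    have h2 : Measurable fun p : ℝ × ℝ => Real.exp (-(mu - lam) * p.1) := by fun_prop
    have h3 : Measurable fun p : ℝ × ℝ => Real.exp (-lam * p.2) := by fun_prop
    exact Measurable.ite (measurableSet_le measurable_fst measurable_snd)
      (h2.mul (h3.mul h1)) measurable_const
  have hint : Integrable (Function.uncurry G)
      ((volume.restrict (Ioi 0)).prod (volume.restrict (Ioi 0))) := by
    refine (((integrableOn_exp_neg_mul (sub_pos.2 hmu)).mul_prod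
      ((integrableOn_exp_neg_mul (sub_pos.2 hlam)).const_mul C))).mono'
      hGm.aestronglyMeasurable ?_
    rw [Measure.prod_restrict]
    refine ae_restrict_of_forall_mem (measurableSet_Ioi.prod measurableSet_Ioi) ?_
    rintro ⟨t, r⟩ ⟨ht, hr⟩
    have h := ExpBdd.abs_exp_mul_le hC lam (le_of_lt hr)
    simp only [Function.uncurry, hG]
    split_ifs
    · rw [norm_mul, Real.norm_eq_abs, Real.norm_eq_abs, Real.abs_exp]
      exact mul_le_mul_of_nonneg_left h (Real.exp_pos _).le
    · rw [norm_zero]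
      exact mul_nonneg (Real.exp_pos _).le ((abs_nonneg _).trans h)
  have h1 : rlapl mu (fun t => rlapl lam fun s => f (t + s)) =
      ∫ t in Ioi (0 : ℝ), ∫ r in Ioi (0 : ℝ), G t r := by
    refine setIntegral_congr_fun measurableSet_Ioi fun t ht => ?_
    have ht' : (t.toNNReal : ℝ) = t := Real.coe_toNNReal t (le_of_lt ht)
    have h2 := integral_Ioi_shift
      (fun s : ℝ≥0 => Real.exp (-lam * s) * f (t.toNNReal + s)) t.toNNReal
    have h3 : rlapl lam (fun s => f (t.toNNReal + s)) = ∫ s in Ioi (0 : ℝ),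
        Real.exp (-lam * (s.toNNReal : ℝ)) * f (t.toNNReal + s.toNNReal) := by
      refine setIntegral_congr_fun measurableSet_Ioi fun s hs => ?_
      simp only [Real.coe_toNNReal s (le_of_lt hs)]
    simp only
    rw [h3, ← h2, ← integral_const_mul]
    refine setIntegral_congr_fun measurableSet_Ioi fun r hr => ?_
    have hr' : (r.toNNReal : ℝ) = r := Real.coe_toNNReal r (le_of_lt hr)
    simp only [hG]
    by_cases htr : t ≤ r
    · have htr' : t.toNNReal ≤ r.toNNReal := Real.toNNReal_le_toNNReal htr
      rw [if_pos htr, if_pos htr', add_tsub_cancel_of_le htr', NNReal.coe_sub htr', hr', ht',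
        ← mul_assoc, ← mul_assoc, ← Real.exp_add, ← Real.exp_add]
      ring_nf
    · rw [if_neg htr, if_neg, mul_zero]
      rw [Real.toNNReal_le_toNNReal_iff (le_of_lt hr)]
      exact htr
  have h2 : ∀ r ∈ Ioi (0 : ℝ), (mu - lam) * ∫ t in Ioi (0 : ℝ), G t r =
      Real.exp (-lam * r) * f r.toNNReal - Real.exp (-mu * r) * f r.toNNReal := by
    intro r hr
    have e : (fun t => G t r) = (Iic r).indicator fun t =>
        Real.exp (-(mu - lam) * t) * (Real.exp (-lam * r) * f r.toNNReal) := by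
      ext t
      simp only [hG, indicator, mem_Iic]
    rw [e, setIntegral_indicator measurableSet_Iic, Ioi_inter_Iic, integral_mul_const,
      ← mul_assoc, integral_Ioc_exp_neg_mul _ (le_of_lt hr), sub_mul, one_mul,
      ← mul_assoc, ← Real.exp_add]
    ring_nf
  rw [h1, integral_integral_swap hint, ← integral_const_mul,
    setIntegral_congr_fun measurableSet_Ioi h2]
  exact integral_sub (hf.integrableOn_rlapl hm hlam)
    (hf.integrableOn_rlapl hm (hlam.trans hmu))

theorem sub_mul_rlapl_translate {ω lam mu : ℝ} (hlam : ω < lam) (hmu : ω < mu)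
    {f : ℝ≥0 → ℝ} (hf : ExpBdd ω f) (hm : Measurable f) :
    (mu - lam) * rlapl mu (fun t => rlapl lam fun s => f (t + s)) =
      rlapl lam f - rlapl mu f := by
  rcases lt_trichotomy lam mu with h | rfl | h
  · exact sub_mul_rlapl_translate_of_lt hlam h hf hm
  · simp
  · rw [rlapl_translate_comm hlam hmu hf hm, ← neg_sub lam mu, neg_mul,
      sub_mul_rlapl_translate_of_lt hmu h hf hm, neg_sub]

section Generator

variable {Y Z : Type*} [NormedAddCommGroup Y] [NormedSpace ℝ Y]
  [NormedAddCommGroup Z] [NormedSpace ℝ Z] {B : Z →ₗ[ℝ] Y →ₗ[ℝ] ℝ} {S : ℝ≥0 → TwinOperator B}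

namespace TwinOperator

theorem onRight_add (hB : IsNormingDualPair B) (L : TwinOperator B) (y y' : Y) :
    L.onRight (y + y') = L.onRight y + L.onRight y' :=
  hB.ext_right fun z => by simp [L.pairing_onRight]

theorem onRight_smul (hB : IsNormingDualPair B) (L : TwinOperator B) (c : ℝ) (y : Y) :
    L.onRight (c • y) = c • L.onRight y :=
  hB.ext_right fun z => by simp [L.pairing_onRight]

end TwinOperator

theorem IsTwinSemigroup.resolvent_identity (hB : IsNormingDualPair B) (hS : IsTwinSemigroup S)
    {M ω lam mu : ℝ} (hg : HasGrowthBound S M ω) (hlam : ω < lam) (hmu : ω < mu)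
    {P P' : TwinOperator B} (hP : ∀ z y, P.form z y = rlapl lam fun t => (S t).form z y)
    (hP' : ∀ z y, P'.form z y = rlapl mu fun t => (S t).form z y) (u : Y) :
    (mu - lam) • P'.onRight (P.onRight u) = P.onRight u - P'.onRight u := by
  refine hB.ext_right fun z => ?_
  rw [map_smul, smul_eq_mul, map_sub, P'.pairing_onRight, P'.pairing_onRight, P.pairing_onRight,
    hP, hP', hP', ← sub_mul_rlapl_translate hlam hmu (hg.expBdd z u) (hS.measurable z u)]
  congr 2
  ext t
  rw [← (S t).pairing_onLeft, P.pairing_onRight, hP]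
  simp_rw [hS.form_add_eq_left]

/-- The generator may be computed from the Laplace transform at any admissible `λ`. -/
theorem mem_twinGenerator_iff (hB : IsNormingDualPair B) (hS : IsTwinSemigroup S)
    {M ω lam : ℝ} (hg : HasGrowthBound S M ω) (hlam : ω < lam) {P : TwinOperator B}
    (hP : ∀ z y, P.form z y = rlapl lam fun t => (S t).form z y) (p : Y × Y) :
    p ∈ twinGenerator S ↔ p.1 = P.onRight (lam • p.1 - p.2) := by
  constructor
  · rintro ⟨M', ω', mu, hg', hmu, P', hP', hp⟩
    obtain ⟨M'', ω'', hg'', h1, h2⟩ : ∃ M'' ω'', HasGrowthBound S M'' ω'' ∧ ω'' < lam ∧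
        ω'' < mu := by
      rcases le_total ω ω' with h | h
      · exact ⟨M, ω, hg, hlam, h.trans_lt hmu⟩
      · exact ⟨M', ω', hg', h.trans_lt hlam, hmu⟩
    have hr := hS.resolvent_identity hB hg'' h2 h1 hP' hP (mu • p.1 - p.2)
    rw [← hp] at hr
    have e : lam • p.1 - p.2 = (lam - mu) • p.1 + (mu • p.1 - p.2) := by
      rw [sub_smul]
      abel
    rw [e, TwinOperator.onRight_add hB, TwinOperator.onRight_smul hB, hr, sub_add_cancel]
  · exact fun hp => ⟨M, ω, lam, hg, hlam, P, hP, hp⟩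

end Generator

section PerturbedGenerator

open cvRing

variable {Y Z : Type*} [NormedAddCommGroup Y] [NormedSpace ℝ Y]
  [NormedAddCommGroup Z] [NormedSpace ℝ Z] {B : Z →ₗ[ℝ] Y →ₗ[ℝ] ℝ} {n : ℕ}

/-- The algebra that relates the resolvents `P₀` of `C₀` and `P` of `C` at `λ`. Here `v₀` and `v`
are the Laplace–Stieltjes transforms of `V₀` and `V`, and `1 + r` is the inverse of `1 - k`. -/
theorem resolvent_rel_iff (hB : IsNormingDualPair B) {P₀ P : TwinOperator B} {lam : ℝ}
    {q : Fin n → Y} {Q : Fin n → Z} {v₀ v : Y → Fin n → ℝ} {r : Matrix (Fin n) (Fin n) ℝ}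
    (hv₀ : ∀ y i, v₀ y i = lam * P₀.form (Q i) y - B (Q i) y)
    (hv : ∀ y, v y = (1 + r).mulVec (v₀ y))
    (hr : (1 - Matrix.of fun i j => v₀ (q j) i) * (1 + r) = 1)
    (hP : ∀ z y, P.form z y = P₀.form z y + ∑ j, P₀.form z (q j) * v y j) (y x : Y) :
    y = P.onRight (lam • y - x) ↔
      ∃ w, y = P₀.onRight (lam • y - w) ∧ x = w + ∑ j, B (Q j) w • q j := by
  have hPr : ∀ u, P.onRight u = P₀.onRight (u + ∑ j, v u j • q j) := by
    intro u
    refine hB.ext_right fun z => ?_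
    rw [P.pairing_onRight, P₀.pairing_onRight, hP, map_add, map_sum]
    simp [mul_comm]
  have hadd : ∀ u (c : Fin n → ℝ), v₀ (u + ∑ j, c j • q j) =
      v₀ u + (Matrix.of fun i j => v₀ (q j) i).mulVec c := by
    intro u c
    ext i
    simp only [Pi.add_apply, Matrix.mulVec, dotProduct, Matrix.of_apply, hv₀, map_add, map_sum,
      map_smul, smul_eq_mul, sub_mul, Finset.sum_sub_distrib]
    have : ∀ j, lam * (c j * P₀.form (Q i) (q j)) = lam * P₀.form (Q i) (q j) * c j :=
      fun j => by ring
    simp_rw [mul_add, Finset.mul_sum, this, fun j => mul_comm (c j) (B (Q i) (q j))]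
    ring
  -- if `u = λy - w` and `P₀ u = y`, then `v₀ u = ⟨Q, w⟩`
  have hQ : ∀ u, y = P₀.onRight u → ∀ i, v₀ u i = B (Q i) (lam • y - u) := by
    intro u hu i
    rw [hv₀, ← P₀.pairing_onRight, ← hu, map_sub, map_smul, smul_eq_mul]
  have hv₀v : ∀ u, v₀ u = v u - (Matrix.of fun i j => v₀ (q j) i).mulVec (v u) := by
    intro u
    rw [← Matrix.one_mulVec (v u), Matrix.mulVec_mulVec, mul_one, ← Matrix.sub_mulVec, hv,
      Matrix.mulVec_mulVec, hr, Matrix.one_mulVec]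
  constructor
  · intro h
    rw [hPr] at h
    set u := lam • y - x with hu
    have h1 : ∀ i, v u i = B (Q i) (x - ∑ j, v u j • q j) := by
      intro i
      have h2 := hQ _ h i
      have h3 : lam • y - (u + ∑ j, v u j • q j) = x - ∑ j, v u j • q j := by
        rw [hu]
        abel
      rw [hadd, h3] at h2
      rw [← h2, hv₀v u, sub_add_cancel]
    refine ⟨x - ∑ j, v u j • q j, ?_, ?_⟩
    · rwa [sub_sub_eq_add_sub, add_sub_right_comm]
    · simp_rw [← h1]
      rw [sub_add_cancel]
  · rintro ⟨w, h, rfl⟩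
    set c : Fin n → ℝ := fun j => B (Q j) w with hc
    have h1 : v₀ (lam • y - w) = c := by
      ext i
      rw [hQ _ h i, sub_sub_cancel]
    have e : lam • y - (w + ∑ j, c j • q j) = (lam • y - w) + ∑ j, (-c) j • q j := by
      simp only [Pi.neg_apply, neg_smul, Finset.sum_neg_distrib]
      abel
    have h2 : v (lam • y - (w + ∑ j, c j • q j)) = c := by
      rw [hv, e, hadd, h1, Matrix.mulVec_neg, ← sub_eq_add_neg]
      conv_lhs => rw [← Matrix.one_mulVec c, Matrix.mulVec_mulVec, mul_one,
        ← Matrix.sub_mulVec, Matrix.mulVec_mulVec, mul_eq_one_comm.1 hr, Matrix.one_mulVec]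
    rw [hPr, h2, sub_add_eq_sub_sub, sub_add_cancel]
    exact h

variable {S₀ S : ℝ≥0 → TwinOperator B} {q : Fin n → Y} {Q : Fin n → Z}
  {V₀ : Y → Fin n → cvRing} {R : Matrix (Fin n) (Fin n) cvRing} {M₀ M ω lam : ℝ}

/-- The generator of the perturbed semigroup, by comparison of the resolvents at one `λ`. -/
theorem twinGenerator_perturbed (hB : IsNormingDualPair B)
    (hS₀ : IsTwinSemigroup S₀) (hS' : IsTwinSemigroup S)
    (hS : ∀ t z y, (S t).form z y = (S₀ t).form z y +
      ∑ j, cv (pertMeasure R V₀ y j) (hS₀.orbit z (q j)) t)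
    (hV : ∀ y i, fn (V₀ y i) = pertV₀ S₀ Q y i)
    (hg₀ : HasGrowthBound S₀ M₀ ω) (hg : HasGrowthBound S M ω) (hω : 0 ≤ ω) (hlam : ω < lam)
    (hRw : ∀ i j, HasWeight ω (R i j)) (hVw : ∀ y i, HasWeight ω (V₀ y i))
    (hR : R = (Matrix.of fun i j => V₀ (q j) i) + (Matrix.of fun i j => V₀ (q j) i) * R)
    {P₀ P : TwinOperator B} (hP₀ : ∀ z y, P₀.form z y = rlapl lam fun t => (S₀ t).form z y)
    (hP : ∀ z y, P.form z y = rlapl lam fun t => (S t).form z y) :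
    twinGenerator S = relBoundedPerturbation B (twinGenerator S₀) Q q := by
  have hlam' : ω < (lam : ℂ).re := hlam
  -- at a real `λ`, the Laplace–Stieltjes transforms are real
  set T : cvRing → ℝ := fun a => lam * rlapl lam (fn a) with hT
  have hTc : ∀ a, lst lam a = (T a : ℂ) := by
    intro a
    rw [lst, lapl_ofReal, ← Complex.ofReal_mul]
  have hv₀ : ∀ y i, T (V₀ y i) = lam * P₀.form (Q i) y - B (Q i) y := by
    intro y i
    have h := lst_pertV₀ hS₀ hV hg₀ hω hlam' y i
    rw [hTc, lapl_ofReal, ← hP₀] at h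
    exact_mod_cast h
  have hv : ∀ y, (fun i => T (pertMeasure R V₀ y i)) =
      (1 + Matrix.of fun i j => T (R i j)).mulVec fun i => T (V₀ y i) := by
    intro y
    ext i
    have h := lst_pertMeasure hω hlam' hRw hVw y i
    simp only [hTc] at h
    rw [Matrix.add_mulVec, Matrix.one_mulVec]
    exact_mod_cast h
  have hr : (1 - Matrix.of fun i j => T (V₀ (q j) i)) * (1 + Matrix.of fun i j => T (R i j)) =
      1 := by
    have e : (Matrix.of fun i j => T (R i j)) = (Matrix.of fun i j => T (V₀ (q j) i)) +
        (Matrix.of fun i j => T (V₀ (q j) i)) * Matrix.of fun i j => T (R i j) := by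
      ext i j
      have h1 : R i j = V₀ (q j) i + ∑ k, V₀ (q k) i * R k j := by
        conv_lhs => rw [hR]
        rfl
      have h2 := congrArg (lst lam) h1
      rw [lst_add hω hlam' (hVw _ _) (HasWeight.sum fun k => (hVw _ _).mul (hRw _ _)),
        lst_sum hω hlam' _ fun k => (hVw _ _).mul (hRw _ _)] at h2
      simp only [lst_mul hω hlam' (hVw _ _) (hRw _ _), hTc] at h2
      exact_mod_cast h2
    rw [sub_mul, one_mul, mul_add, mul_one, sub_eq_iff_eq_add, ← e]
  have hPf : ∀ z y, P.form z y =
      P₀.form z y + ∑ j, P₀.form z (q j) * T (pertMeasure R V₀ y j) := by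
    intro z y
    have h := lapl_perturbed hS₀ hS hg₀ hω hlam' hRw hVw z y
    simp only [lapl_ofReal, hTc, ← hP₀, ← hP] at h
    exact_mod_cast h
  ext ⟨y, x⟩
  rw [mem_twinGenerator_iff hB hS' hg hlam hP,
    resolvent_rel_iff hB (v₀ := fun y i => T (V₀ y i))
      (v := fun y i => T (pertMeasure R V₀ y i)) hv₀ hv hr hPf]
  simp only [relBoundedPerturbation, mem_ofPred_eq, mem_twinGenerator_iff hB hS₀ hg₀ hlam hP₀]

end PerturbedGenerator

theorem theorem10p1 {Y Z : Type*} [NormedAddCommGroup Y] [NormedSpace ℝ Y] [CompleteSpace Y]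
    [NormedAddCommGroup Z] [NormedSpace ℝ Z] [CompleteSpace Z]
    (B : Z →ₗ[ℝ] Y →ₗ[ℝ] ℝ) (hB : IsNormingDualPair B)
    (hcomplete : WeakSeqComplete B) (hcont : WeakSeqContinuousImpContinuous B)
    (S₀ : ℝ≥0 → TwinOperator B) (hS₀ : IsTwinSemigroup S₀)
    (n : ℕ) (q : Fin n → Y) (Q : Fin n → Z)
    (hK : ∀ i j, IsNBVLoc (pertK S₀ Q q i j))
    (hK0 : ∀ i j, ContinuousAt (pertK S₀ Q q i j) 0)
    (hV₀ : ∀ y i, IsNBVLoc (pertV₀ S₀ Q y i)) :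
    ∃ R : Fin n → Fin n → ℝ≥0 → ℝ,
      IsResolvent (pertK S₀ Q q) R ∧
      (∀ R', IsResolvent (pertK S₀ Q q) R' → R' = R) ∧
      (∀ y i, IsNBVLoc (pertV S₀ Q R y i)) ∧
      ∃ S : ℝ≥0 → TwinOperator B,
        (∀ t z y, (S t).form z y = (S₀ t).form z y +
          ∑ j, stieltjesIntegral (pertV S₀ Q R y j) t fun τ => (S₀ (t - τ)).form z (q j)) ∧
        IsTwinSemigroup S ∧
        twinGenerator S = relBoundedPerturbation B (twinGenerator S₀) Q q := by
  choose V₀ hV using fun y i => (hV₀ y i).exists_fn_eq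
  obtain ⟨M₀, ω₀, hg₀, hL₀⟩ := hS₀.laplace
  -- a nonnegative exponent above the growth exponent of `S₀`
  set ω₁ : ℝ := max ω₀ 0 + 1 with hω₁
  have hω₁0 : 0 ≤ ω₁ := by positivity
  have h01 : ω₀ < ω₁ := (le_max_left ω₀ 0).trans_lt (lt_add_one _)
  have hVw₁ := hasWeight_pertV₀ hB hcomplete hS₀ hV hg₀ hω₁0 h01
  have hKfn : pertK S₀ Q q = fun i j => cvRing.fn (V₀ (q j) i) := by
    ext i j t
    rw [hV]
    rfl
  have hKat : ∀ i j, ((V₀ (q j) i).1 LocBdd.one).1 0 = 0 := fun i j =>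
    cvRing.one_apply_zero_of_continuousAt (by
      have := hK0 i j
      rwa [hKfn] at this)
  obtain ⟨ω₂, h12, R, hRw, hR⟩ := cvRing.exists_resolvent hω₁0
    (Matrix.of fun i j => V₀ (q j) i) (fun i j => hVw₁ (q j) i) hKat
  have hR1 := cvRing.resolvent_right_iff.1 hR
  have hω₂0 : 0 ≤ ω₂ := hω₁0.trans h12
  have hVw₂ := fun y i => (hVw₁ y i).mono h12
  refine ⟨fun i j => cvRing.fn (R i j), ?_, fun R' hR' => ?_, fun y i => ?_, ?_⟩
  · rw [hKfn]
    exact cvRing.isResolvent_fn_iff.2 hR1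
  · rw [hKfn] at hR'
    exact cvRing.isResolvent_unique hR1 hR'
  · rw [← fn_pertMeasure hV]
    exact cvRing.isNBVLoc_fn _
  obtain ⟨S, hS⟩ := exists_perturbed_operators hB hcomplete hcont hS₀ hV R q
  have hadd := perturbed_add hS₀ hS hB hV hKat hR1
  obtain ⟨C, hC1, hC⟩ := perturbed_bound_unit_interval hS₀ hS hB
  obtain ⟨M, ω₃, hg₃⟩ := exists_hasGrowthBound hB hadd hC1 hC
  -- an exponent that is admissible for `S₀`, `V₀`, `R` and `S`
  set ω := max ω₂ ω₃ with hω
  have h2ω : ω₂ ≤ ω := le_max_left _ _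
  have hω0 : 0 ≤ ω := hω₂0.trans h2ω
  have h0ω : ω₀ < ω := h01.trans_le (h12.trans h2ω)
  have hg : HasGrowthBound S M ω := hg₃.mono (le_max_right _ _)
  have hg₀' : HasGrowthBound S₀ M₀ ω := hg₀.mono h0ω.le
  have hRw' := fun i j => (hRw i j).mono h2ω
  have hVw' := fun y i => (hVw₂ y i).mono h2ω
  have hLS : ∀ lam : ℂ, ω < lam.re → ∃ P P' : TwinOperator B, HasLaplaceTransformAt S lam P P' :=
    fun lam hlam => isTwinForm_lapl_perturbed hB hS₀ hS hV hg₀' hω0 hlam hRw' hVw'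
      (hL₀ lam (h0ω.trans hlam))
  have hSt : IsTwinSemigroup S :=
    ⟨perturbed_zero hS₀ hS, hadd, perturbed_measurable hS₀ hS, M, ω, hg, hLS⟩
  refine ⟨S, fun t z y => ?_, hSt, ?_⟩
  · rw [hS]
    congr 1
    refine Finset.sum_congr rfl fun j _ => ?_
    rw [← fn_pertMeasure hV]
    exact (stieltjesIntegral_fn _ (hS₀.orbit z (q j)) t).symm
  · have hlam : ω < ω + 1 := lt_add_one ω
    -- at a real `λ`, the real part of the Laplace transform is the real Laplace transform
    have key : ∀ T : ℝ≥0 → TwinOperator B,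
        (∃ P P' : TwinOperator B, HasLaplaceTransformAt T ((ω + 1 : ℝ) : ℂ) P P') →
        ∃ P : TwinOperator B, ∀ z y, P.form z y = rlapl (ω + 1) fun t => (T t).form z y := by
      rintro T ⟨P, P', h⟩
      refine ⟨P, fun z y => ?_⟩
      have h1 := (h z y).trans (lapl_ofReal (ω + 1) fun t => (T t).form z y)
      simpa using congrArg Complex.re h1
    obtain ⟨P₀, hP₀⟩ := key S₀ (hL₀ _ (h0ω.trans hlam))
    obtain ⟨P, hP⟩ := key S (hLS _ hlam)
    exact twinGenerator_perturbed hB hS₀ hSt hS hV hg₀' hg hω0 hlam hRw' hVw' hR hP₀ hP
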